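/- All schemes are locally Noetherian. For a scheme $X$ let $\operatorname{Ass} X$ be the set of its associated points (the points $x$ such that the maximal ideal of $\mathcal{O}_{X,x}$ is an associated prime of $\mathcal{O}_{X,x}$), let $i\colon \operatorname{Ass} X\to X$ be the inclusion of this subspace, and let $\mathcal{Q}_X=i_*i^{-1}\mathcal{O}_X$ be the sheaf of rational functions on $X$; it contains $\mathcal{O}_X$. A fractional ideal on $X$ is a coherent $\mathcal{O}_X$-submodule $\mathcal{I}\subseteq\mathcal{Q}_X$ which has a rank, that is, for some $r\in\mathbb{N}$ the stalk $\mathcal{I}_x$ is a free $\mathcal{O}_{X,x}$-module of rank $r$ at every $x\in\operatorname{Ass} X$ (the zero ideal is allowed). It is invertible if it is locally isomorphic to $\mathcal{O}_X$ as an $\mathcal{O}_X$-module. Its blow up is the $X$-scheme $\operatorname{Bl}_{\mathcal{I}}X=\operatorname{Proj}_X\bigl(\bigoplus_{n\ge 0}\mathcal{I}^n\bigr)$, where $\mathcal{I}^0=\mathcal{O}_X$ and powers are formed in $\mathcal{Q}_X$. A morphism $f\colon Y\to X$ is bifractional if $f^\#\colon\mathcal{O}_X\to f_*\mathcal{O}_Y$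 extends to a morphism $\mathcal{Q}_X\to f_*\mathcal{Q}_Y$ of sheaves of rings which is an isomorphism; one then identifies $\mathcal{Q}_X=f_*\mathcal{Q}_Y$. Theorem. Let $f\colon Y\to X$ be a finite bifractional morphism, and let $\mathcal{J}$ and $\mathcal{I}$ be fractional ideals on $Y$ and $X$ respectively. Then there is a unique fractional ideal $\mathcal{C}_{\mathcal{J}/\mathcal{I}}$ on $X$, the conductor, such that multiplication in $\mathcal{Q}_X=f_*\mathcal{Q}_Y$ defines an isomorphism $$\mathcal{C}_{\mathcal{J}/\mathcal{I}}\;\cong\;\mathcal{H}om_{\mathcal{O}_X}(f_*\mathcal{J},\mathcal{I}),$$ and there is a unique fractional ideal $\mathcal{C}'_{\mathcal{J}/\mathcal{I}}$ on $Y$ such that $f_*\mathcal{C}'_{\mathcal{J}/\mathcal{I}}=\mathcal{C}_{\mathcal{J}/\mathcal{I}}$ in $\mathcal{Q}_X=f_*\mathcal{Q}_Y$. Moreover $\operatorname{Bl}_{\mathcal{C}_{\mathcal{J}/\mathcal{I}}}X$ and $Y$ are isomorphic as schemes over $X$ if and only if $\mathcal{C}'_{\mathcal{J}/\mathcal{I}}$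 is an invertible fractional ideal on $Y$. -/

import Mathlib

open AlgebraicGeometry CategoryTheory

universe u

namespace ConductorBlowUp

section ProjLocalization

open HomogeneousLocalization

variable {A B : Type u} [CommRing A] [CommRing B] {σ τ : Type u}
  [SetLike σ A] [AddSubgroupClass σ A] [SetLike τ B] [AddSubgroupClass τ B]
  {𝒜 : ℕ → σ} {ℬ : ℕ → τ} [GradedRing 𝒜] [GradedRing ℬ]

/-- A graded ring homomorphism which inverts one element `g` of degree zero. -/
structure IsGradedAway (φ : GradedRingHom 𝒜 ℬ) (g : 𝒜 0) : Prop where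
  isUnit : IsUnit (φ g)
  surj : ∀ (i : ℕ) (b : B), b ∈ ℬ i → ∃ (n : ℕ) (a : A), a ∈ 𝒜 i ∧ φ a = φ g ^ n * b
  inj : ∀ a : A, φ a = 0 → ∃ n : ℕ, (g : A) ^ n * a = 0

variable {φ : GradedRingHom 𝒜 ℬ} {g : 𝒜 0}

theorem IsGradedAway.irrelevant_le (h : IsGradedAway φ g) :
    HomogeneousIdeal.irrelevant ℬ ≤ (HomogeneousIdeal.irrelevant 𝒜).map φ := by
  rw [HomogeneousIdeal.irrelevant_le]
  intro i hi b hb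
  obtain ⟨n, a, ha, hab⟩ := h.surj i b hb
  obtain ⟨u, hu⟩ := h.isUnit.pow n
  have hb' : b = ↑u⁻¹ * φ a := by
    rw [hab, ← hu, ← mul_assoc, Units.inv_mul, one_mul]
  change b ∈ ((HomogeneousIdeal.irrelevant 𝒜).map φ).toIdeal
  rw [hb']
  refine Ideal.mul_mem_left _ _ (Ideal.mem_map_of_mem φ ?_)
  exact (HomogeneousIdeal.irrelevant_le _).mp (le_refl (HomogeneousIdeal.irrelevant 𝒜)) i hi ha

theorem IsGradedAway.isLocalization (h : IsGradedAway φ g) {d : ℕ} {s : A} (hs : s ∈ 𝒜 d) :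
    letI := (Away.map φ s).toAlgebra
    IsLocalization.Away (fromZeroRingHom 𝒜 (.powers s) g) (Away ℬ (φ s)) := by
  let := (Away.map φ s).toAlgebra
  have hg (k : ℕ) : (g : A) ^ k ∈ 𝒜 0 := by
    simpa using SetLike.pow_mem_graded k g.2
  have hval (k : ℕ) : (Away.map φ s (fromZeroRingHom 𝒜 (.powers s) g) ^ k).val =
      Localization.mk (φ g ^ k) 1 := by
    rw [HomogeneousLocalization.val_pow]
    change (Localization.mk (φ g) _) ^ k = _
    rw [Localization.mk_pow]
    congr 1
    ext; simp
  constructor; constructor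
  · rintro ⟨r, n, rfl⟩
    rw [map_pow, RingHom.algebraMap_toAlgebra]
    refine IsUnit.pow _ ?_
    obtain ⟨n, a, ha, hab⟩ := h.surj 0 1 (SetLike.one_mem_graded ℬ)
    obtain ⟨u, hu⟩ := h.isUnit
    -- the inverse of the unit is the degree zero part of `u⁻¹`
    have hmem : φ g ∈ ℬ 0 := φ.map_mem g.2
    let w : ℬ 0 := DirectSum.decompose ℬ (↑u⁻¹ : B) 0
    have hw : φ g * (w : B) = 1 := by
      have := DirectSum.coe_decompose_mul_of_left_mem_zero ℬ (b := (↑u⁻¹ : B)) hmem (j := 0)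
      rw [← hu, Units.mul_inv] at this
      rw [DirectSum.decompose_of_mem_same ℬ (SetLike.one_mem_graded ℬ)] at this
      rw [this, hu]
    refine IsUnit.of_mul_eq_one (fromZeroRingHom ℬ (.powers (φ s)) w) ?_
    ext
    have h1 := hval 1
    rw [pow_one, pow_one] at h1
    rw [HomogeneousLocalization.val_mul, h1, HomogeneousLocalization.val_one]
    change Localization.mk (φ g) 1 * Localization.mk (w : B) _ = 1
    rw [Localization.mk_mul, hw, ← Localization.mk_one]
    congr 1
    ext; simp
  · intro z
    obtain ⟨n, b, hb, rfl⟩ := Away.mk_surjective ℬ (φ.map_mem hs) z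
    obtain ⟨k, a, ha, hab⟩ := h.surj _ b hb
    refine ⟨⟨Away.mk 𝒜 hs n a ha, ⟨_, ⟨k, rfl⟩⟩⟩, ?_⟩
    ext
    dsimp only
    rw [HomogeneousLocalization.val_mul, RingHom.algebraMap_toAlgebra, map_pow, hval, Away.map_mk]
    rw [Away.val_mk, Away.val_mk, Localization.mk_mul, hab]
    rw [Localization.mk_eq_mk_iff, Localization.r_iff_exists]
    refine ⟨1, ?_⟩
    simp [mul_comm]
  · intro a b e
    obtain ⟨n, a, ha, rfl⟩ := Away.mk_surjective 𝒜 hs a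
    obtain ⟨m, b, hb, rfl⟩ := Away.mk_surjective 𝒜 hs b
    replace e := congr_arg HomogeneousLocalization.val e
    simp only [RingHom.algebraMap_toAlgebra, Away.map_mk, Away.val_mk,
      Localization.mk_eq_mk_iff, Localization.r_iff_exists] at e
    obtain ⟨⟨_, k, rfl⟩, hc⟩ := e
    have hc' : φ (s ^ k * (s ^ m * a - s ^ n * b)) = 0 := by
      have : φ s ^ k * (φ s ^ m * φ a) = φ s ^ k * (φ s ^ n * φ b) := hc
      simp only [map_mul, map_sub, map_pow]
      rw [mul_sub, this, sub_self]
    obtain ⟨l, hl⟩ := h.inj _ hc'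
    refine ⟨⟨_, l, rfl⟩, ?_⟩
    have hval' : (fromZeroRingHom 𝒜 (.powers s) g ^ l).val = Localization.mk ((g : A) ^ l) 1 := by
      rw [HomogeneousLocalization.val_pow]
      change (Localization.mk (g : A) _) ^ l = _
      rw [Localization.mk_pow]
      congr 1
      ext; simp
    ext
    simp only [HomogeneousLocalization.val_mul, hval', Away.val_mk, Localization.mk_mul]
    rw [Localization.mk_eq_mk_iff, Localization.r_iff_exists]
    refine ⟨⟨_, k, rfl⟩, ?_⟩
    simp only [one_mul]
    linear_combination hl

theorem IsGradedAway.opensRange_specMap (h : IsGradedAway φ g) {d : ℕ} {s : A} (hs : s ∈ 𝒜 d) :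
    ∃ _ : IsOpenImmersion (Spec.map (CommRingCat.ofHom (Away.map φ s))),
    (Spec.map (CommRingCat.ofHom (Away.map φ s))).opensRange =
      PrimeSpectrum.basicOpen (fromZeroRingHom 𝒜 (.powers s) g) := by
  let := (Away.map φ s).toAlgebra
  have := h.isLocalization hs
  refine ⟨IsOpenImmersion.of_isLocalization (fromZeroRingHom 𝒜 (.powers s) g), ?_⟩
  ext1
  exact PrimeSpectrum.localization_away_comap_range (Away ℬ (φ s))
    (fromZeroRingHom 𝒜 (.powers s) g)

theorem IsGradedAway.isPullback_awayι (h : IsGradedAway φ g) {d : ℕ} (hd : 0 < d) {s : A}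
    (hs : s ∈ 𝒜 d) :
    IsPullback (Spec.map (CommRingCat.ofHom (Away.map φ s))) (Proj.awayι ℬ (φ s) (φ.map_mem hs) hd)
      (Proj.awayι 𝒜 s hs hd) (Proj.map φ h.irrelevant_le) := by
  refine IsOpenImmersion.isPullback _ _ _ _ (Proj.awayι_comp_map φ h.irrelevant_le hd s hs) ?_
  rw [Proj.opensRange_awayι, Proj.opensRange_awayι]
  rfl

theorem IsGradedAway.isOpenImmersion (h : IsGradedAway φ g) :
    IsOpenImmersion (Proj.map φ h.irrelevant_le) := by
  have key {d : ℕ} (hd : 0 < d) {s : A} (hs : s ∈ 𝒜 d) : IsOpenImmersion (Limits.pullback.snd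
      (Proj.map φ h.irrelevant_le) (Proj.awayι 𝒜 s hs hd)) := by
    have := (h.opensRange_specMap hs).1
    have hp := (h.isPullback_awayι hd hs).flip
    rw [← hp.isoPullback_inv_snd]
    infer_instance
  exact (IsZariskiLocalAtTarget.iff_of_openCover (P := @IsOpenImmersion)
    (Proj.affineOpenCover 𝒜).openCover).mpr fun s ↦ key s.1.2 s.2.2

theorem IsGradedAway.opensRange_map (h : IsGradedAway φ g) :
    haveI := h.isOpenImmersion
    (Proj.map φ h.irrelevant_le).opensRange =
      Proj.toSpecZero 𝒜 ⁻¹ᵁ (PrimeSpectrum.basicOpen g : (Spec (.of (𝒜 0))).Opens) := by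
  have := h.isOpenImmersion
  ext x
  obtain ⟨d, hd, s, hs, z, rfl⟩ : ∃ (d : ℕ) (hd : 0 < d) (s : A) (hs : s ∈ 𝒜 d)
      (z : Spec (.of (Away 𝒜 s))), Proj.awayι 𝒜 s hs hd z = x := by
    obtain ⟨s, z, hz⟩ := (Proj.affineOpenCover 𝒜).openCover.exists_eq x
    exact ⟨s.1.1, s.1.2, s.2.1, s.2.2, z, hz⟩
  have hp := h.isPullback_awayι hd hs
  obtain ⟨h1, h2⟩ := h.opensRange_specMap hs
  have e1 : (Proj.awayι 𝒜 s hs hd) z ∈ Set.range (Proj.map φ h.irrelevant_le) ↔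
      z ∈ Set.range (Spec.map (CommRingCat.ofHom (Away.map φ s))) := by
    constructor
    · rintro ⟨y, hy⟩
      obtain ⟨w, hw, -⟩ := Scheme.exists_preimage_of_isPullback hp z y hy.symm
      exact ⟨w, hw⟩
    · rintro ⟨w, rfl⟩
      refine ⟨Proj.awayι ℬ (φ s) (φ.map_mem hs) hd w, ?_⟩
      rw [← Scheme.Hom.comp_apply, ← Scheme.Hom.comp_apply, hp.w]
  refine e1.trans ?_
  have e2 : z ∈ Set.range (Spec.map (CommRingCat.ofHom (Away.map φ s))) ↔
    z ∈ PrimeSpectrum.basicOpen (fromZeroRingHom 𝒜 (.powers s) g) := by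
    rw [← h2]; rfl
  rw [e2]
  change _ ↔ (Proj.toSpecZero 𝒜) ((Proj.awayι 𝒜 s hs hd) z) ∈ PrimeSpectrum.basicOpen g
  have e3 : (Proj.toSpecZero 𝒜) ((Proj.awayι 𝒜 s hs hd) z) =
      Spec.map (CommRingCat.ofHom (fromZeroRingHom 𝒜 (.powers s))) z := by
    rw [← Scheme.Hom.comp_apply, Proj.awayι_toSpecZero]
  rw [e3]
  rfl

/-- Compatibility of `Proj φ` with the morphisms to the spectra of the degree zero parts. -/
theorem proj_map_toSpecZero (φ : GradedRingHom 𝒜 ℬ)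
    (hφ : HomogeneousIdeal.irrelevant ℬ ≤ (HomogeneousIdeal.irrelevant 𝒜).map φ)
    (φ₀ : 𝒜 0 →+* ℬ 0) (h : ∀ a, (φ₀ a : B) = φ a) :
    Proj.map φ hφ ≫ Proj.toSpecZero 𝒜 =
      Proj.toSpecZero ℬ ≫ Spec.map (CommRingCat.ofHom φ₀) := by
  refine (Proj.mapAffineOpenCover φ hφ).openCover.hom_ext _ _ fun s ↦ ?_
  have key {d : ℕ} (hd : 0 < d) {s : A} (hs : s ∈ 𝒜 d) :
      Proj.awayι ℬ (φ s) (φ.map_mem hs) hd ≫ Proj.map φ hφ ≫ Proj.toSpecZero 𝒜 =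
        Proj.awayι ℬ (φ s) (φ.map_mem hs) hd ≫ Proj.toSpecZero ℬ ≫
          Spec.map (CommRingCat.ofHom φ₀) := by
    rw [Proj.awayι_comp_map_assoc φ hφ hd s hs, Proj.awayι_toSpecZero,
      Proj.awayι_toSpecZero_assoc, ← Spec.map_comp, ← Spec.map_comp]
    congr 1
    ext a
    change Localization.mk (φ a) _ = Localization.mk (φ₀ a : B) _
    rw [h]
    congr 1
    ext; simp
  exact key s.1.2 s.2.2

end ProjLocalization


section Rees

open Polynomial

variable {A Q : Type u} [CommRing A] [CommRing Q] [Algebra A Q] (M : Submodule A Q)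

/-- The graded ring `⨁ₙ Mⁿ` of an `A`-submodule `M` of an `A`-algebra `Q`, realised as the
subring `{∑ qₙ Tⁿ | qₙ ∈ Mⁿ}` of `Q[T]`; here `M⁰` is the image of `A`. -/
def rees : Subalgebra A Q[X] where
  carrier := {p | ∀ n, p.coeff n ∈ M ^ n}
  mul_mem' {p q} hp hq n := by
    rw [coeff_mul]
    refine Submodule.sum_mem _ fun ij hij ↦ ?_
    rw [← Finset.HasAntidiagonal.mem_antidiagonal.mp hij, pow_add]
    exact Submodule.mul_mem_mul (hp _) (hq _)
  add_mem' {p q} hp hq n := by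
    rw [coeff_add]
    exact add_mem (hp n) (hq n)
  algebraMap_mem' a n := by
    rw [Polynomial.algebraMap_apply, coeff_C]
    split_ifs with h
    · subst h
      rw [pow_zero]
      exact Submodule.algebraMap_mem a
    · exact zero_mem _

/-- The homogeneous part `Mⁿ Tⁿ` of degree `n`. -/
def reesGrade (n : ℕ) : Submodule A (rees M) where
  carrier := {p | ∀ m, m ≠ n → p.1.coeff m = 0}
  add_mem' {p q} hp hq m hm := by
    change (p.1 + q.1).coeff m = 0
    rw [coeff_add, hp m hm, hq m hm, add_zero]
  zero_mem' m _ := coeff_zero m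
  smul_mem' a p hp m hm := by
    change (a • p.1).coeff m = 0
    rw [coeff_smul, hp m hm, smul_zero]

variable {M}

/-- The element `q Tⁿ`. -/
noncomputable def reesMonomial (n : ℕ) (q : Q) (hq : q ∈ M ^ n) : reesGrade M n :=
  ⟨⟨monomial n q, fun m ↦ by
    rw [coeff_monomial]
    split_ifs with h
    · exact h ▸ hq
    · exact zero_mem _⟩, fun m hm ↦ by
    change (monomial n q).coeff m = 0
    rw [coeff_monomial, if_neg hm.symm]⟩

theorem coe_reesMonomial (n : ℕ) (q : Q) (hq : q ∈ M ^ n) :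
    ((reesMonomial n q hq : rees M) : Q[X]) = monomial n q := rfl

theorem coe_eq_monomial {n : ℕ} {p : rees M} (hp : p ∈ reesGrade M n) :
    (p : Q[X]) = monomial n (p.1.coeff n) := by
  ext m
  rw [coeff_monomial]
  split_ifs with h
  · rw [h]
  · exact hp m (Ne.symm h)

theorem reesGrade_ext {n : ℕ} {p q : reesGrade M n} (h : p.1.1.coeff n = q.1.1.coeff n) :
    p = q := by
  apply Subtype.ext
  apply Subtype.ext
  rw [coe_eq_monomial p.2, coe_eq_monomial q.2, h]

theorem coeff_coeAddMonoidHom (x : DirectSum ℕ fun i ↦ reesGrade M i) (n : ℕ) :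
    (DirectSum.coeAddMonoidHom (reesGrade M) x).1.coeff n = (x n).1.1.coeff n := by
  induction x using DirectSum.induction_on with
  | zero => simp
  | of i y =>
    rw [DirectSum.coeAddMonoidHom_of]
    by_cases h : i = n
    · subst h
      rw [DirectSum.of_eq_same]
    · rw [DirectSum.of_eq_of_ne _ _ _ (Ne.symm h)]
      exact y.2 n (Ne.symm h)
  | add x y hx hy =>
    rw [map_add, DirectSum.add_apply]
    change (_ + _ : Q[X]).coeff n = (_ + _ : Q[X]).coeff n
    rw [coeff_add, coeff_add, hx, hy]

noncomputable instance : GradedRing (reesGrade M) where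
  one_mem m hm := by
    change (1 : Q[X]).coeff m = 0
    rw [coeff_one, if_neg hm]
  mul_mem i j p q hp hq m hm := by
    change (p.1 * q.1).coeff m = 0
    rw [coe_eq_monomial hp, coe_eq_monomial hq, monomial_mul_monomial, coeff_monomial,
      if_neg hm.symm]
  decompose' p := ∑ n ∈ p.1.support, DirectSum.of (fun i ↦ reesGrade M i) n
    (reesMonomial n (p.1.coeff n) (p.2 n))
  left_inv p := by
    rw [map_sum]
    simp only [DirectSum.coeAddMonoidHom_of]
    apply Subtype.ext
    rw [AddSubmonoidClass.coe_finsetSum]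
    simp only [coe_reesMonomial]
    exact p.1.as_sum_support.symm
  right_inv x := by
    apply DFinsupp.ext
    intro n
    apply reesGrade_ext
    rw [← coeff_coeAddMonoidHom, ← coeff_coeAddMonoidHom]
    congr 2
    rw [map_sum]
    simp only [DirectSum.coeAddMonoidHom_of]
    apply Subtype.ext
    rw [AddSubmonoidClass.coe_finsetSum]
    simp only [coe_reesMonomial]
    exact (DirectSum.coeAddMonoidHom (reesGrade M) x).1.as_sum_support.symm

variable (M) in
/-- The structure homomorphism from `A` to the degree zero part. -/
noncomputable def toReesZero : A →+* reesGrade M 0 where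
  toFun a := ⟨algebraMap A (rees M) a, fun m hm ↦ by
    change (algebraMap A Q[X] a).coeff m = 0
    rw [Polynomial.algebraMap_apply, coeff_C, if_neg hm]⟩
  map_one' := Subtype.ext (map_one _)
  map_mul' _ _ := Subtype.ext (map_mul _ _ _)
  map_zero' := Subtype.ext (map_zero _)
  map_add' _ _ := Subtype.ext (map_add _ _ _)

theorem coe_toReesZero (a : A) : ((toReesZero M a : rees M) : Q[X]) = C (algebraMap A Q a) := rfl

variable {A' Q' : Type u} [CommRing A'] [CommRing Q'] [Algebra A' Q'] {M' : Submodule A' Q'}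
  {φ : A →+* A'} {ψ : Q →+* Q'}

theorem map_mem_pow (hφ : ∀ a, ψ (algebraMap A Q a) = algebraMap A' Q' (φ a))
    (hM : ∀ q ∈ M, ψ q ∈ M') (n : ℕ) : ∀ q ∈ M ^ n, ψ q ∈ M' ^ n := by
  induction n with
  | zero =>
    intro q hq
    rw [pow_zero] at hq ⊢
    obtain ⟨a, rfl⟩ := Submodule.mem_one.mp hq
    rw [hφ]
    exact Submodule.algebraMap_mem _
  | succ n ih =>
    intro q hq
    rw [pow_succ] at hq ⊢
    induction hq using Submodule.mul_induction_on' with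
    | mem_mul_mem m hm n hn =>
      rw [map_mul]
      exact Submodule.mul_mem_mul (ih m hm) (hM n hn)
    | add x _ y _ hx hy =>
      rw [map_add]
      exact add_mem hx hy

/-- Functoriality of `⨁ₙ Mⁿ`. -/
noncomputable def reesMap (hφ : ∀ a, ψ (algebraMap A Q a) = algebraMap A' Q' (φ a))
    (hM : ∀ q ∈ M, ψ q ∈ M') : GradedRingHom (reesGrade M) (reesGrade M') where
  toRingHom := ((mapRingHom ψ).comp (rees M).val.toRingHom).codRestrict (rees M') fun p n ↦ by
    change (p.1.map ψ).coeff n ∈ _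
    rw [coeff_map]
    exact map_mem_pow hφ hM n _ (p.2 n)
  map_mem {n} p hp m hm := by
    change (p.1.map ψ).coeff m = 0
    rw [coeff_map, hp m hm, map_zero]

theorem coe_reesMap (hφ : ∀ a, ψ (algebraMap A Q a) = algebraMap A' Q' (φ a))
    (hM : ∀ q ∈ M, ψ q ∈ M') (p : rees M) : (reesMap hφ hM p : Q'[X]) = p.1.map ψ := rfl

theorem isGradedAway_reesMap (hφ : ∀ a, ψ (algebraMap A Q a) = algebraMap A' Q' (φ a))
    (hM : ∀ q ∈ M, ψ q ∈ M') (g : A) (hg : IsUnit (φ g))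
    (hA : ∀ a' : A', ∃ (n : ℕ) (a : A), φ a = φ g ^ n * a')
    (hs : ∀ q' ∈ M', ∃ (n : ℕ) (q : Q), q ∈ M ∧ ψ q = φ g ^ n • q')
    (hk : ∀ q : Q, ψ q = 0 → ∃ n : ℕ, g ^ n • q = 0) :
    IsGradedAway (reesMap hφ hM) (toReesZero M g) := by
  have hgval : (reesMap hφ hM (toReesZero M g)) = toReesZero M' (φ g) := by
    apply Subtype.ext
    rw [coe_reesMap, coe_toReesZero, coe_toReesZero, map_C, hφ]
  have hpow (n : ℕ) : ∀ q' ∈ M' ^ n, ∃ (k : ℕ) (q : Q), q ∈ M ^ n ∧ ψ q = φ g ^ k • q' := by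
    induction n with
    | zero =>
      intro q' hq'
      rw [pow_zero] at hq'
      obtain ⟨a', rfl⟩ := Submodule.mem_one.mp hq'
      obtain ⟨k, a, h⟩ := hA a'
      refine ⟨k, algebraMap A Q a, ?_, ?_⟩
      · rw [pow_zero]; exact Submodule.algebraMap_mem a
      · rw [hφ, h, map_mul, Algebra.smul_def]
    | succ n ih =>
      intro q' hq'
      rw [pow_succ] at hq'
      induction hq' using Submodule.mul_induction_on' with
      | mem_mul_mem x hx y hy =>
        obtain ⟨k, q, hq, h⟩ := ih x hx
        obtain ⟨l, r, hr, h'⟩ := hs y hy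
        refine ⟨k + l, q * r, ?_, ?_⟩
        · rw [pow_succ]; exact Submodule.mul_mem_mul hq hr
        · rw [map_mul, h, h', smul_mul_smul_comm, pow_add]
      | add x _ y _ hx hy =>
        obtain ⟨k, q, hq, h⟩ := hx
        obtain ⟨l, r, hr, h'⟩ := hy
        refine ⟨k + l, g ^ l • q + g ^ k • r, ?_, ?_⟩
        · exact add_mem (Submodule.smul_mem _ _ hq) (Submodule.smul_mem _ _ hr)
        · rw [map_add, Algebra.smul_def, Algebra.smul_def, map_mul, map_mul, hφ, hφ, h, h',
            ← Algebra.smul_def, ← Algebra.smul_def, smul_smul, smul_smul, map_pow, map_pow,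
            smul_add, pow_add, mul_comm (φ g ^ l)]
  refine ⟨?_, ?_, ?_⟩
  · rw [hgval]
    change IsUnit (algebraMap A' (rees M') (φ g))
    exact hg.map _
  · intro i b hb
    obtain ⟨k, q, hq, h⟩ := hpow i (b.1.coeff i) (b.2 i)
    refine ⟨k, reesMonomial i q hq, (reesMonomial i q hq).2, ?_⟩
    rw [hgval]
    apply Subtype.ext
    change _ = ((toReesZero M' (φ g) : rees M') : Q'[X]) ^ k * b.1
    rw [coe_reesMap, coe_reesMonomial, map_monomial, h, coe_toReesZero, ← C_pow,
      coe_eq_monomial hb, C_mul_monomial, Algebra.smul_def, map_pow]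
    simp
  · intro p hp
    have hp' (n : ℕ) : ψ (p.1.coeff n) = 0 := by
      rw [← coeff_map, ← coe_reesMap hφ hM, hp]
      exact coeff_zero n
    choose N hN using fun n ↦ hk _ (hp' n)
    refine ⟨∑ n ∈ p.1.support, N n, ?_⟩
    apply Subtype.ext
    change ((toReesZero M g : rees M) : Q[X]) ^ _ * p.1 = 0
    rw [coe_toReesZero, ← C_pow]
    ext n
    rw [coeff_C_mul, coeff_zero]
    by_cases hn : n ∈ p.1.support
    · rw [← Finset.add_sum_erase _ _ hn, pow_add, mul_right_comm, ← map_pow,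
        ← Algebra.smul_def, hN, zero_mul]
    · rw [notMem_support_iff.mp hn, mul_zero]

/-- Compatibility of `Proj (⨁ₙ M'ⁿ) → Proj (⨁ₙ Mⁿ)` with the morphisms to `Spec A'` and
`Spec A`. -/
theorem proj_map_reesMap_toSpec (hφ : ∀ a, ψ (algebraMap A Q a) = algebraMap A' Q' (φ a))
    (hM : ∀ q ∈ M, ψ q ∈ M')
    (h : HomogeneousIdeal.irrelevant (reesGrade M') ≤
      (HomogeneousIdeal.irrelevant (reesGrade M)).map (reesMap hφ hM)) :
    Proj.map (reesMap hφ hM) h ≫ Proj.toSpecZero (reesGrade M) ≫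
        Spec.map (CommRingCat.ofHom (toReesZero M)) =
      (Proj.toSpecZero (reesGrade M') ≫ Spec.map (CommRingCat.ofHom (toReesZero M'))) ≫
        Spec.map (CommRingCat.ofHom φ) := by
  let φ₀ : reesGrade M 0 →+* reesGrade M' 0 :=
    { toFun := fun a ↦ ⟨_, (reesMap hφ hM).map_mem a.2⟩
      map_one' := Subtype.ext (map_one (reesMap hφ hM))
      map_mul' := fun _ _ ↦ Subtype.ext (map_mul (reesMap hφ hM) _ _)
      map_zero' := Subtype.ext (map_zero (reesMap hφ hM))
      map_add' := fun _ _ ↦ Subtype.ext (map_add (reesMap hφ hM) _ _) }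
  have hφ₀ : φ₀.comp (toReesZero M) = (toReesZero M').comp φ := by
    ext1 a
    apply Subtype.ext
    apply Subtype.ext
    change Polynomial.map ψ (C (algebraMap A Q a)) = C (algebraMap A' Q' (φ a))
    rw [map_C, hφ]
  rw [← Category.assoc, proj_map_toSpecZero _ h φ₀ (fun _ ↦ rfl), Category.assoc, Category.assoc,
    ← Spec.map_comp, ← Spec.map_comp, ← CommRingCat.ofHom_comp, ← CommRingCat.ofHom_comp, hφ₀]

end Rees

section RationalFunctions

variable (X : Scheme.{u})

/-- The set `Ass X` of associated points of a scheme: those `x` for which the maximal ideal of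
the local ring at `x` is an associated prime of that ring. -/
def assPoints : Set X :=
  {x | IsLocalRing.maximalIdeal (X.presheaf.stalk x) ∈
    associatedPrimes (X.presheaf.stalk x) (X.presheaf.stalk x)}

/-- `U ∩ Ass X`. -/
abbrev AssIn (U : X.Opens) : Type u := {x : X // x ∈ U ∧ x ∈ assPoints X}

/-- The sections over `U` of the sheaf of rational functions `𝒬_X = i_* i⁻¹ 𝒪_X`,
where `i : Ass X → X` is the inclusion of the subspace of associated points. A section of the
inverse image sheaf `i⁻¹ 𝒪_X` over `U ∩ Ass X` is a family of germs of `𝒪_X`, one at each point of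
`U ∩ Ass X`, which locally on `U ∩ Ass X` is the family of germs of a section of `𝒪_X`. -/
def ratFunSubring (U : X.Opens) : Subring (∀ x : AssIn X U, X.presheaf.stalk x.1) where
  carrier := {s | ∀ x : AssIn X U, ∃ (V : X.Opens) (t : Γ(X, V)), x.1 ∈ V ∧
    ∀ (y : AssIn X U) (hy : y.1 ∈ V), s y = X.presheaf.germ V y.1 hy t}
  mul_mem' {a b} ha hb x := by
    obtain ⟨V, t, hx, h⟩ := ha x
    obtain ⟨V', t', hx', h'⟩ := hb x
    refine ⟨V ⊓ V', X.presheaf.map (homOfLE inf_le_left).op t *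
      X.presheaf.map (homOfLE inf_le_right).op t', ⟨hx, hx'⟩, fun y hy ↦ ?_⟩
    rw [map_mul, TopCat.Presheaf.germ_res_apply, TopCat.Presheaf.germ_res_apply, ← h y hy.1,
      ← h' y hy.2]
    rfl
  one_mem' x := ⟨⊤, 1, trivial, fun y hy ↦ (map_one _).symm⟩
  add_mem' {a b} ha hb x := by
    obtain ⟨V, t, hx, h⟩ := ha x
    obtain ⟨V', t', hx', h'⟩ := hb x
    refine ⟨V ⊓ V', X.presheaf.map (homOfLE inf_le_left).op t +
      X.presheaf.map (homOfLE inf_le_right).op t', ⟨hx, hx'⟩, fun y hy ↦ ?_⟩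
    rw [map_add, TopCat.Presheaf.germ_res_apply, TopCat.Presheaf.germ_res_apply, ← h y hy.1,
      ← h' y hy.2]
    rfl
  zero_mem' x := ⟨⊤, 0, trivial, fun y hy ↦ (map_zero _).symm⟩
  neg_mem' {a} ha x := by
    obtain ⟨V, t, hx, h⟩ := ha x
    refine ⟨V, -t, hx, fun y hy ↦ ?_⟩
    rw [map_neg, ← h y hy]
    rfl

/-- The ring `𝒬_X(U)` of rational functions on `U`. -/
def RatFun (U : X.Opens) : Type u := ratFunSubring X U

variable {X}

noncomputable instance (U : X.Opens) : CommRing (RatFun X U) :=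
  inferInstanceAs (CommRing (ratFunSubring X U))

/-- The germ of a rational function at an associated point. -/
def RatFun.germ {U : X.Opens} (s : RatFun X U) (x : AssIn X U) : X.presheaf.stalk x.1 := s.1 x

theorem RatFun.ext {U : X.Opens} {s t : RatFun X U} (h : ∀ x, s.germ x = t.germ x) : s = t :=
  Subtype.ext (funext h)

/-- The `𝒪_X(U)`-algebra structure of `𝒬_X(U)`: a function goes to its family of germs. -/
noncomputable instance (U : X.Opens) : Algebra Γ(X, U) (RatFun X U) :=
  RingHom.toAlgebra
    { toFun := fun a ↦ ⟨fun x ↦ X.presheaf.germ U x.1 x.2.1 a, fun x ↦ ⟨U, a, x.2.1, fun _ _ ↦ rfl⟩⟩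
      map_one' := Subtype.ext (funext fun _ ↦ map_one _)
      map_mul' := fun _ _ ↦ Subtype.ext (funext fun _ ↦ map_mul _ _ _)
      map_zero' := Subtype.ext (funext fun _ ↦ map_zero _)
      map_add' := fun _ _ ↦ Subtype.ext (funext fun _ ↦ map_add _ _ _) }

theorem algebraMap_ratFun_apply {U : X.Opens} (a : Γ(X, U)) (x : AssIn X U) :
    (algebraMap Γ(X, U) (RatFun X U) a).1 x = X.presheaf.germ U x.1 x.2.1 a := rfl

theorem smul_ratFun_apply {U : X.Opens} (a : Γ(X, U)) (s : RatFun X U) (x : AssIn X U) :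
    (a • s).1 x = X.presheaf.germ U x.1 x.2.1 a * s.1 x := by
  rw [Algebra.smul_def]
  rfl

/-- The restriction homomorphism `𝒬_X(V) → 𝒬_X(U)` for `U ⊆ V`. -/
def ratRes {U V : X.Opens} (h : U ≤ V) : RatFun X V →+* RatFun X U where
  toFun s := ⟨fun x ↦ s.1 ⟨x.1, h x.2.1, x.2.2⟩, fun x ↦ by
    obtain ⟨W, t, hx, hW⟩ := s.2 ⟨x.1, h x.2.1, x.2.2⟩
    exact ⟨W, t, hx, fun y hy ↦ hW ⟨y.1, h y.2.1, y.2.2⟩ hy⟩⟩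
  map_one' := rfl
  map_mul' _ _ := rfl
  map_zero' := rfl
  map_add' _ _ := rfl

theorem ratRes_apply {U V : X.Opens} (h : U ≤ V) (s : RatFun X V) (x : AssIn X U) :
    (ratRes h s).1 x = s.1 ⟨x.1, h x.2.1, x.2.2⟩ := rfl

theorem ratRes_algebraMap {U V : X.Opens} (h : U ≤ V) (a : Γ(X, V)) :
    ratRes h (algebraMap Γ(X, V) (RatFun X V) a) =
      algebraMap Γ(X, U) (RatFun X U) (X.presheaf.map (homOfLE h).op a) := by
  apply Subtype.ext
  funext x
  rw [ratRes_apply, algebraMap_ratFun_apply, algebraMap_ratFun_apply]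
  exact (TopCat.Presheaf.germ_res_apply X.presheaf (homOfLE h) x.1 x.2.1 a).symm

/-- On a locally Noetherian scheme, a function on an affine open set is zero if its germs at all
associated points are. -/
theorem eq_zero_of_germ_eq_zero [IsLocallyNoetherian X] {U : X.Opens} (hU : IsAffineOpen U)
    (a : Γ(X, U)) (ha : ∀ x : AssIn X U, X.presheaf.germ U x.1 x.2.1 a = 0) : a = 0 := by
  by_contra hne
  have : IsNoetherianRing Γ(X, U) := IsLocallyNoetherian.component_noetherian ⟨U, hU⟩
  obtain ⟨P, hP, hle⟩ := exists_le_isAssociatedPrime_of_isNoetherianRing Γ(X, U) a hne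
  obtain ⟨hPp, b, hb⟩ := isAssociatedPrime_iff.mp hP
  have hPb (r : Γ(X, U)) : r ∈ P ↔ r * b = 0 := by
    rw [hb, Submodule.mem_colon_singleton, Submodule.mem_bot, smul_eq_mul]
  let y : PrimeSpectrum Γ(X, U) := ⟨P, hPp⟩
  have hx : hU.fromSpec y ∈ U := by
    have : hU.fromSpec y ∈ Set.range hU.fromSpec := ⟨y, rfl⟩
    rwa [hU.range_fromSpec] at this
  let := X.presheaf.algebra_section_stalk ⟨hU.fromSpec y, hx⟩
  have hloc : IsLocalization.AtPrime (X.presheaf.stalk (hU.fromSpec y)) P :=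
    hU.isLocalization_stalk' y hx
  have hgerm (r : Γ(X, U)) : X.presheaf.germ U _ hx r =
    algebraMap Γ(X, U) (X.presheaf.stalk (hU.fromSpec y)) r := rfl
  have hass : hU.fromSpec y ∈ assPoints X := by
    refine isAssociatedPrime_iff.mpr ⟨inferInstance, algebraMap _ _ b, ?_⟩
    ext r
    rw [Submodule.mem_colon_singleton, Submodule.mem_bot, smul_eq_mul]
    obtain ⟨p, m, rfl⟩ := IsLocalization.exists_mk'_eq P.primeCompl r
    rw [IsLocalization.AtPrime.mk'_mem_maximal_iff (X.presheaf.stalk (hU.fromSpec y)) P, hPb,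
      ← IsLocalization.mk'_one (M := P.primeCompl) (X.presheaf.stalk (hU.fromSpec y)) b,
      ← IsLocalization.mk'_mul, IsLocalization.mk'_eq_zero_iff]
    constructor
    · intro h
      exact ⟨1, by rw [h, mul_zero]⟩
    · rintro ⟨m', hm'⟩
      have : (m' : Γ(X, U)) * p ∈ P := by rw [hPb, mul_assoc, hm']
      exact (hPb p).mp ((hPp.mem_or_mem this).resolve_left m'.2)
  have h0 := ha ⟨_, hx, hass⟩
  rw [hgerm, IsLocalization.map_eq_zero_iff P.primeCompl] at h0
  obtain ⟨m, hm⟩ := h0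
  refine m.2 (hle ?_)
  rw [Submodule.mem_colon_singleton, Submodule.mem_bot, smul_eq_mul, hm]

/-- Let `U` be an affine open set of a locally Noetherian scheme and `g` a function on `U`. A
rational function on `U` which vanishes on `D(g)` is annihilated by a power of `g`. -/
theorem exists_pow_smul_eq_zero [IsLocallyNoetherian X] {U : X.Opens} (hU : IsAffineOpen U)
    (g : Γ(X, U)) (s : RatFun X U) (hs : ratRes (X.basicOpen_le g) s = 0) :
    ∃ n : ℕ, g ^ n • s = 0 := by
  have : IsNoetherianRing Γ(X, U) := IsLocallyNoetherian.component_noetherian ⟨U, hU⟩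
  have hN : TopologicalSpace.NoetherianSpace {x : X // x ∈ U} := noetherianSpace_of_isAffineOpen U hU
  have hloc (x : AssIn X U) : ∃ (W : X.Opens) (n : ℕ), x.1 ∈ W ∧
      ∀ y : AssIn X U, y.1 ∈ W → (g ^ n • s).1 y = 0 := by
    obtain ⟨V, t, hxV, ht⟩ := s.2 x
    obtain ⟨W, hW, hxW, hWle⟩ := X.isBasis_affineOpens.exists_subset_of_mem_open
      (show x.1 ∈ (V ⊓ U : X.Opens) from ⟨hxV, x.2.1⟩) (V ⊓ U).2
    obtain ⟨W, rfl⟩ : ∃ W' : X.Opens, (W' : Set X) = W := by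
      obtain ⟨W', hW', rfl⟩ := hW
      exact ⟨_, rfl⟩
    have hWa : IsAffineOpen W := by
      obtain ⟨W', hW', h⟩ := hW
      rwa [← TopologicalSpace.Opens.coe_inj.mp h]
    have hWV : W ≤ V := fun y hy ↦ (hWle hy).1
    have hWU : W ≤ U := fun y hy ↦ (hWle hy).2
    let t' : Γ(X, W) := X.presheaf.map (homOfLE hWV).op t
    let g' : Γ(X, W) := X.presheaf.map (homOfLE hWU).op g
    have hbo : X.basicOpen g' ≤ X.basicOpen g := by
      rw [Scheme.basicOpen_res]
      exact inf_le_right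
    have h0 : X.presheaf.map (homOfLE (X.basicOpen_le g')).op t' = 0 := by
      refine eq_zero_of_germ_eq_zero (hWa.basicOpen g') _ fun y ↦ ?_
      rw [TopCat.Presheaf.germ_res_apply, TopCat.Presheaf.germ_res_apply]
      have hyW : y.1 ∈ W := X.basicOpen_le g' y.2.1
      rw [← ht ⟨y.1, hWU hyW, y.2.2⟩ (hWV hyW)]
      exact congr_fun (congr_arg Subtype.val hs) ⟨y.1, hbo y.2.1, y.2.2⟩
    obtain ⟨n, hn⟩ := exists_pow_mul_eq_zero_of_res_basicOpen_eq_zero_of_isCompact X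
      hWa.isCompact t' g' h0
    refine ⟨W, n, hxW, fun y hy ↦ ?_⟩
    rw [smul_ratFun_apply, ht y (hWV hy), ← TopCat.Presheaf.germ_res_apply X.presheaf (homOfLE hWV) y.1 hy,
      ← TopCat.Presheaf.germ_res_apply X.presheaf (homOfLE hWU) y.1 hy, ← map_mul, map_pow, hn,
      map_zero]
  choose W n hxW hW using hloc
  have hK : IsCompact {x : {x : X // x ∈ U} | x.1 ∈ assPoints X} := hN.isCompact _
  obtain ⟨T, hT⟩ := hK.elim_finite_subcover
    (fun x : AssIn X U ↦ (Subtype.val : {x : X // x ∈ U} → X) ⁻¹' (W x : Set X))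
    (fun x ↦ (W x).2.preimage continuous_subtype_val)
    (fun x hx ↦ Set.mem_iUnion.mpr ⟨⟨x.1, x.2, hx⟩, hxW _⟩)
  refine ⟨T.sup n, ?_⟩
  apply Subtype.ext
  funext y
  obtain ⟨x, hxT, hyx⟩ : ∃ x ∈ T, y.1 ∈ W x := by
    obtain ⟨x, hx⟩ := Set.mem_iUnion.mp (hT (a := ⟨y.1, y.2.1⟩) y.2.2)
    obtain ⟨hxT, hyx⟩ := Set.mem_iUnion.mp hx
    exact ⟨x, hxT, hyx⟩
  have hle : n x ≤ T.sup n := Finset.le_sup hxT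
  have h2 : g ^ T.sup n • s = g ^ (T.sup n - n x) • (g ^ n x • s) := by
    rw [smul_smul, ← pow_add, Nat.sub_add_cancel hle]
  rw [h2, smul_ratFun_apply, hW x y hyx, mul_zero]
  rfl

end RationalFunctions

section Submodules

variable (X : Scheme.{u})

/-- An `𝒪_X`-submodule (subsheaf) of the sheaf of rational functions `𝒬_X`. -/
@[ext]
structure RatSubmodule where
  /-- The sections over an open set. -/
  sections (U : X.Opens) : Submodule Γ(X, U) (RatFun X U)
  res_mem {U V : X.Opens} (h : U ≤ V) {s : RatFun X V} (hs : s ∈ sections V) :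
    ratRes h s ∈ sections U
  mem_of_local {U : X.Opens} (s : RatFun X U)
    (hs : ∀ x ∈ U, ∃ (V : X.Opens) (h : V ≤ U), x ∈ V ∧ ratRes h s ∈ sections V) : s ∈ sections U

variable {X}

/-- Coherence (on a locally Noetherian scheme): on each affine open `U`, the restriction of `I` is
the quasi-coherent sheaf associated with a finitely generated `Γ(X, U)`-module, that is, `I(U)` is
finitely generated and `I(D(g))` is the localization `I(U)_g` for every function `g` on `U`. -/
structure RatSubmodule.IsCoherent (I : RatSubmodule X) : Prop where
  fg {U : X.Opens} (hU : IsAffineOpen U) : (I.sections U).FG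
  exists_of_res_eq_zero {U : X.Opens} (hU : IsAffineOpen U) (g : Γ(X, U)) :
    ∀ s ∈ I.sections U, ratRes (X.basicOpen_le g) s = 0 → ∃ n : ℕ, g ^ n • s = 0
  exists_res_eq_smul {U : X.Opens} (hU : IsAffineOpen U) (g : Γ(X, U)) :
    ∀ s ∈ I.sections (X.basicOpen g), ∃ (n : ℕ) (t : RatFun X U), t ∈ I.sections U ∧
      ratRes (X.basicOpen_le g) t =
        (X.presheaf.map (homOfLE (X.basicOpen_le g)).op g) ^ n • s

end Submodules

section BlowUp

open Scheme.AffineZariskiSite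

variable {X : Scheme.{u}}

/-- The restriction homomorphism `⨁ₙ I(V)ⁿ → ⨁ₙ I(U)ⁿ` for `U ⊆ V`. -/
noncomputable def reesRes (I : RatSubmodule X) {U V : X.Opens} (h : U ≤ V) :
    GradedRingHom (reesGrade (I.sections V)) (reesGrade (I.sections U)) :=
  reesMap (φ := (X.presheaf.map (homOfLE h).op).hom) (ψ := ratRes h) (ratRes_algebraMap h)
    (fun _ hs ↦ I.res_mem h hs)

theorem isGradedAway_reesRes [IsLocallyNoetherian X] {I : RatSubmodule X} (hI : I.IsCoherent)
    {V : X.Opens} (hV : IsAffineOpen V) (g : Γ(X, V)) :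
    IsGradedAway (reesRes I (X.basicOpen_le g)) (toReesZero (I.sections V) g) := by
  let := (X.presheaf.map (homOfLE (X.basicOpen_le g)).op).hom.toAlgebra
  have hloc : IsLocalization.Away g Γ(X, X.basicOpen g) := hV.isLocalization_basicOpen g
  refine isGradedAway_reesMap _ _ g ?_ ?_ (hI.exists_res_eq_smul hV g)
    (exists_pow_smul_eq_zero hV g)
  · exact IsLocalization.Away.algebraMap_isUnit (S := Γ(X, X.basicOpen g)) g
  · intro a'
    obtain ⟨⟨a, ⟨_, n, rfl⟩⟩, h⟩ := IsLocalization.surj (.powers g) a'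
    refine ⟨n, a, ?_⟩
    rw [mul_comm]
    simpa [RingHom.algebraMap_toAlgebra] using h.symm

/-- `Proj (⨁ₙ I(U)ⁿ)` for an open set `U`. -/
noncomputable abbrev projRees (I : RatSubmodule X) (U : X.Opens) : Scheme.{u} :=
  Proj (reesGrade (I.sections U))

/-- The structure morphism `Proj (⨁ₙ I(U)ⁿ) → Spec Γ(X, U)`. -/
noncomputable def projReesToSpec (I : RatSubmodule X) (U : X.Opens) :
    projRees I U ⟶ Spec Γ(X, U) :=
  Proj.toSpecZero (reesGrade (I.sections U)) ≫
    Spec.map (CommRingCat.ofHom (toReesZero (I.sections U)))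

theorem exists_isGradedAway_of_le [IsLocallyNoetherian X] {I : RatSubmodule X} (hI : I.IsCoherent) {U V : X.AffineZariskiSite} (h : U ≤ V) :
    ∃ g : Γ(X, V.1), X.basicOpen g = U.1 ∧
      IsGradedAway (reesRes I (toOpens_mono h)) (toReesZero (I.sections V.1) g) := by
  obtain ⟨g, hg⟩ := h
  obtain rfl : V.basicOpen g = U := Subtype.ext hg
  exact ⟨g, rfl, isGradedAway_reesRes hI V.2 g⟩

theorem irrelevant_le_map_reesRes [IsLocallyNoetherian X] {I : RatSubmodule X} (hI : I.IsCoherent) {U V : X.AffineZariskiSite} (h : U ≤ V) :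
    HomogeneousIdeal.irrelevant (reesGrade (I.sections U.1)) ≤
      (HomogeneousIdeal.irrelevant (reesGrade (I.sections V.1))).map
        (reesRes I (toOpens_mono h)) :=
  (exists_isGradedAway_of_le hI h).choose_spec.2.irrelevant_le

/-- The morphism `Proj (⨁ₙ I(U)ⁿ) → Proj (⨁ₙ I(V)ⁿ)` for `U = D(g) ⊆ V` affine. -/
noncomputable def projReesMap [IsLocallyNoetherian X] {I : RatSubmodule X} (hI : I.IsCoherent) {U V : X.AffineZariskiSite} (h : U ≤ V) :
    projRees I U.1 ⟶ projRees I V.1 :=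
  Proj.map (reesRes I (toOpens_mono h)) (irrelevant_le_map_reesRes hI h)

theorem projReesMap_toSpec [IsLocallyNoetherian X] {I : RatSubmodule X} (hI : I.IsCoherent) {U V : X.AffineZariskiSite} (h : U ≤ V) :
    projReesMap hI h ≫ projReesToSpec I V.1 =
      projReesToSpec I U.1 ≫ Spec.map (X.presheaf.map (homOfLE (toOpens_mono h)).op) :=
  proj_map_reesMap_toSpec _ _ (irrelevant_le_map_reesRes hI h)

/-- The structure morphism `Proj (⨁ₙ I(U)ⁿ) → U` for an affine open set `U`. -/
noncomputable def projReesToOpen (I : RatSubmodule X) (U : X.AffineZariskiSite) :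
    projRees I U.1 ⟶ U.1.toScheme :=
  projReesToSpec I U.1 ≫ U.2.isoSpec.inv

theorem projReesToOpen_ι (I : RatSubmodule X) (U : X.AffineZariskiSite) :
    projReesToOpen I U ≫ U.1.ι = projReesToSpec I U.1 ≫ U.2.fromSpec := by
  rw [projReesToOpen, Category.assoc, U.2.isoSpec_inv_ι]

theorem projReesMap_toOpen [IsLocallyNoetherian X] {I : RatSubmodule X} (hI : I.IsCoherent) {U V : X.AffineZariskiSite} (h : U ≤ V) :
    projReesMap hI h ≫ projReesToOpen I V =
      projReesToOpen I U ≫ X.homOfLE (toOpens_mono h) := by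
  rw [← cancel_mono V.1.ι, Category.assoc, Category.assoc, projReesToOpen_ι, Scheme.homOfLE_ι,
    projReesToOpen_ι, ← Category.assoc, projReesMap_toSpec hI h, Category.assoc,
    V.2.map_fromSpec U.2]

theorem isPullback_projReesMap [IsLocallyNoetherian X] {I : RatSubmodule X} (hI : I.IsCoherent) {U V : X.AffineZariskiSite} (h : U ≤ V) :
    IsPullback (projReesMap hI h) (projReesToOpen I U) (projReesToOpen I V)
      (X.homOfLE (toOpens_mono h)) := by
  obtain ⟨g, hg, hφ⟩ := exists_isGradedAway_of_le hI h
  have h1 : IsOpenImmersion (projReesMap hI h) := hφ.isOpenImmersion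
  have h2 : (projReesMap hI h).opensRange = Proj.toSpecZero (reesGrade (I.sections V.1)) ⁻¹ᵁ
      (PrimeSpectrum.basicOpen (toReesZero (I.sections V.1) g) :
        (Spec (.of (reesGrade (I.sections V.1) 0))).Opens) := hφ.opensRange_map
  have h3 : projReesToOpen I V ⁻¹ᵁ (X.homOfLE (toOpens_mono h)).opensRange =
      (projReesMap hI h).opensRange := by
    have e1 : (X.homOfLE (toOpens_mono h)).opensRange = V.1.ι ⁻¹ᵁ U.1 := by
      rw [Scheme.opensRange_homOfLE]
    have e2 : projReesToOpen I V ⁻¹ᵁ (V.1.ι ⁻¹ᵁ U.1) =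
        (projReesToOpen I V ≫ V.1.ι) ⁻¹ᵁ U.1 := rfl
    have e3 : (projReesToOpen I V ≫ V.1.ι) ⁻¹ᵁ U.1 =
        (projReesToSpec I V.1 ≫ V.2.fromSpec) ⁻¹ᵁ U.1 := by rw [projReesToOpen_ι]
    have e4 : (projReesToSpec I V.1 ≫ V.2.fromSpec) ⁻¹ᵁ U.1 =
        projReesToSpec I V.1 ⁻¹ᵁ (V.2.fromSpec ⁻¹ᵁ U.1) := rfl
    have e5 : V.2.fromSpec ⁻¹ᵁ U.1 = PrimeSpectrum.basicOpen g := by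
      rw [← hg, V.2.fromSpec_preimage_basicOpen]
    rw [e1, e2, e3, e4, e5, h2]
    rfl
  exact (IsOpenImmersion.isPullback (projReesToOpen I U) (projReesMap hI h)
    (X.homOfLE (toOpens_mono h)) (projReesToOpen I V) (projReesMap_toOpen hI h) h3).flip

theorem projReesMap_id [IsLocallyNoetherian X] {I : RatSubmodule X} (hI : I.IsCoherent)
    (U : X.AffineZariskiSite) : projReesMap hI (le_refl U) = 𝟙 (projRees I U.1) := by
  have : reesRes I (toOpens_mono (le_refl U)) = GradedRingHom.id _ := by
    ext1 p
    apply Subtype.ext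
    ext1 n
    exact Polynomial.coeff_map _ n
  simp only [projReesMap, this]
  exact Proj.map_id

theorem projReesMap_comp [IsLocallyNoetherian X] {I : RatSubmodule X} (hI : I.IsCoherent)
    {U V W : X.AffineZariskiSite} (h : U ≤ V) (h' : V ≤ W) :
    projReesMap hI h ≫ projReesMap hI h' = projReesMap hI (h.trans h') := by
  refine (Proj.map_comp (reesRes I (toOpens_mono h')) (reesRes I (toOpens_mono h))
    (irrelevant_le_map_reesRes hI h') (irrelevant_le_map_reesRes hI h)).symm.trans ?_
  have : (reesRes I (toOpens_mono h)).comp (reesRes I (toOpens_mono h')) =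
      reesRes I (toOpens_mono (h.trans h')) := by
    ext1 p
    apply Subtype.ext
    ext1 n
    refine (Polynomial.coeff_map _ n).trans ((congr_arg (ratRes (toOpens_mono h))
      (Polynomial.coeff_map _ n)).trans ?_)
    exact (Polynomial.coeff_map (ratRes (toOpens_mono (h.trans h'))) n).symm
  simp only [projReesMap, this]

/-- The schemes `Proj (⨁ₙ I(U)ⁿ)`, where `U` runs over the affine open sets of `X`, with their
structure morphisms to `U`, as a datum for gluing schemes over `X`. -/
noncomputable def blowUpGluingData [IsLocallyNoetherian X] {I : RatSubmodule X} (hI : I.IsCoherent) : (directedCover X).RelativeGluingData where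
  functor :=
    { obj := fun U : X.AffineZariskiSite ↦ projRees I U.1
      map := fun i ↦ projReesMap hI i.le
      map_id := projReesMap_id hI
      map_comp := fun i j ↦ (projReesMap_comp hI i.le j.le).symm }
  natTrans :=
    { app := projReesToOpen I
      naturality := fun _ _ i ↦ projReesMap_toOpen hI i.le }
  equifibered := fun _ _ i ↦ isPullback_projReesMap hI i.le

instance [IsLocallyNoetherian X] {I : RatSubmodule X} (hI : I.IsCoherent) :
    ((blowUpGluingData hI).functor ⋙ Scheme.forget).IsLocallyDirected :=
  Scheme.Cover.RelativeGluingData.instIsLocallyDirectedI₀CompFunctorForgetOfIsThin ..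

/-- The blow up `Bl_I X = Proj_X (⨁ₙ Iⁿ)` of a locally Noetherian scheme along a coherent
submodule of the sheaf of rational functions. -/
noncomputable def blowUp [IsLocallyNoetherian X] {I : RatSubmodule X} (hI : I.IsCoherent) : Scheme.{u} := (blowUpGluingData hI).glued

/-- The structure morphism of the blow up. -/
noncomputable def blowUpMap [IsLocallyNoetherian X] {I : RatSubmodule X} (hI : I.IsCoherent) : blowUp hI ⟶ X := (blowUpGluingData hI).toBase

end BlowUp

section FractionalIdeals

/-- At an associated point `x` the stalk of `𝒬_X` is the local ring `𝒪_{X,x}`. This is the stalk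
at `x` of a submodule `I` of `𝒬_X`, as a submodule of `𝒪_{X,x}`. -/
def RatSubmodule.stalk {X : Scheme.{u}} (I : RatSubmodule X) {x : X} (hx : x ∈ assPoints X) :
    Submodule (X.presheaf.stalk x) (X.presheaf.stalk x) where
  carrier := {a | ∃ (U : X.Opens) (h : x ∈ U) (s : RatFun X U),
    s ∈ I.sections U ∧ s.1 ⟨x, h, hx⟩ = a}
  add_mem' {a b} ha hb := by
    obtain ⟨U, hU, s, hs, rfl⟩ := ha
    obtain ⟨V, hV, t, ht, rfl⟩ := hb
    exact ⟨U ⊓ V, ⟨hU, hV⟩, ratRes inf_le_left s + ratRes inf_le_right t,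
      add_mem (I.res_mem _ hs) (I.res_mem _ ht), rfl⟩
  zero_mem' := ⟨⊤, trivial, 0, zero_mem _, rfl⟩
  smul_mem' a b hb := by
    obtain ⟨U, hU, s, hs, rfl⟩ := hb
    obtain ⟨V, hV, t, rfl⟩ := X.presheaf.exists_germ_eq a
    refine ⟨U ⊓ V, ⟨hU, hV⟩, X.presheaf.map (homOfLE inf_le_right).op t • ratRes inf_le_left s,
      Submodule.smul_mem _ _ (I.res_mem _ hs), ?_⟩
    rw [smul_ratFun_apply, TopCat.Presheaf.germ_res_apply]
    rfl

/-- A submodule of `𝒬_X` has a rank if for some `r` its stalk at each associated point `x` is a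
free `𝒪_{X,x}`-module of rank `r`. -/
def RatSubmodule.HasRank {X : Scheme.{u}} (I : RatSubmodule X) : Prop :=
  ∃ r : ℕ, ∀ (x : X) (hx : x ∈ assPoints X),
    Nonempty (I.stalk hx ≃ₗ[X.presheaf.stalk x] (Fin r → X.presheaf.stalk x))

/-- A fractional ideal on a locally Noetherian scheme: a coherent `𝒪_X`-submodule of `𝒬_X`
which has a rank. -/
@[ext]
structure FracIdeal (X : Scheme.{u}) extends RatSubmodule X where
  isCoherent : toRatSubmodule.IsCoherent
  hasRank : toRatSubmodule.HasRank

/-- A submodule `I` of `𝒬_X` is invertible if it is locally isomorphic to `𝒪_X` as an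
`𝒪_X`-module. An isomorphism `𝒪_U → I|_U` is given by the image `s ∈ I(U)` of `1`. -/
def RatSubmodule.IsInvertible {X : Scheme.{u}} (I : RatSubmodule X) : Prop :=
  ∀ x : X, ∃ (U : X.Opens) (s : RatFun X U), x ∈ U ∧ s ∈ I.sections U ∧
    ∀ (V : X.Opens) (h : V ≤ U), ∀ t ∈ I.sections V, ∃! a : Γ(X, V), a • ratRes h s = t

variable {X Y : Scheme.{u}} (f : Y ⟶ X)

/-- A morphism of sheaves of rings `𝒬_X → f_* 𝒬_Y` (equivalently `f⁻¹ 𝒬_X → 𝒬_Y`) which extends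
`f^# : 𝒪_X → f_* 𝒪_Y`. The morphism `f` is fractional if this exists (it is then unique). -/
structure RatComorphism where
  /-- The homomorphism on sections. -/
  app (U : X.Opens) : RatFun X U →+* RatFun Y (f ⁻¹ᵁ U)
  app_res {U V : X.Opens} (h : U ≤ V) (s : RatFun X V) :
    app U (ratRes h s) = ratRes (f.preimage_mono h) (app V s)
  app_algebraMap (U : X.Opens) (a : Γ(X, U)) :
    app U (algebraMap Γ(X, U) (RatFun X U) a) =
      algebraMap Γ(Y, f ⁻¹ᵁ U) (RatFun Y (f ⁻¹ᵁ U)) (f.app U a)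

variable {f}

/-- The comorphism is an isomorphism `𝒬_X ≅ f_* 𝒬_Y`. The morphism `f` is bifractional if it is
fractional and its comorphism is an isomorphism. -/
def RatComorphism.IsIso (θ : RatComorphism f) : Prop :=
  ∀ U : X.Opens, Function.Bijective (θ.app U)

/-- The submodule of `𝒬_X` corresponding to `f_* J ⊆ f_* 𝒬_Y` under the comorphism
`𝒬_X → f_* 𝒬_Y`. -/
def RatComorphism.pushforward (θ : RatComorphism f) (J : RatSubmodule Y) : RatSubmodule X where
  sections U :=
    { carrier := {s | θ.app U s ∈ J.sections (f ⁻¹ᵁ U)}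
      add_mem' := fun {s t} hs ht ↦ by
        change θ.app U (s + t) ∈ J.sections (f ⁻¹ᵁ U)
        rw [map_add]
        exact add_mem hs ht
      zero_mem' := by
        change θ.app U 0 ∈ J.sections (f ⁻¹ᵁ U)
        rw [map_zero]
        exact zero_mem _
      smul_mem' := fun a s hs ↦ by
        change θ.app U (a • s) ∈ J.sections (f ⁻¹ᵁ U)
        rw [Algebra.smul_def, map_mul, θ.app_algebraMap, ← Algebra.smul_def]
        exact Submodule.smul_mem _ _ hs }
  res_mem h s hs := by
    change θ.app _ (ratRes h s) ∈ J.sections _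
    rw [θ.app_res]
    exact J.res_mem _ hs
  mem_of_local {U} s hs := by
    refine J.mem_of_local (θ.app U s) fun y hy ↦ ?_
    obtain ⟨V, h, hxV, hV⟩ := hs (f y) hy
    refine ⟨f ⁻¹ᵁ V, f.preimage_mono h, hxV, ?_⟩
    rw [← θ.app_res h s]
    exact hV

variable (f) in
/-- A section over `U` of the sheaf `ℋom_{𝒪_X}(f_* J, I)`: a morphism of `𝒪_U`-modules
`(f_* J)|_U → I|_U`. -/
structure HomSection (J : RatSubmodule Y) (I : RatSubmodule X) (U : X.Opens) where
  /-- The homomorphism on sections. -/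
  app (V : X.Opens) (h : V ≤ U) : J.sections (f ⁻¹ᵁ V) →+ I.sections V
  app_smul (V : X.Opens) (h : V ≤ U) (a : Γ(X, V)) (j : J.sections (f ⁻¹ᵁ V)) :
    app V h (f.app V a • j) = a • app V h j
  app_res (V W : X.Opens) (h : V ≤ U) (h' : W ≤ V) (j : J.sections (f ⁻¹ᵁ V)) :
    (app W (h'.trans h) ⟨ratRes (f.preimage_mono h') j.1, J.res_mem _ j.2⟩ : RatFun X W) =
      ratRes h' (app V h j).1

/-- The submodule `C` of `𝒬_X` is the conductor `ℋom_{𝒪_X}(f_* J, I)`, where homomorphisms are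
identified with rational functions: multiplication of the sections of `f_* J` by sections of `C`
(both viewed in `f_* 𝒬_Y` by means of the comorphism) is an isomorphism `C ≅ ℋom(f_* J, I)`. -/
def IsConductor (θ : RatComorphism f) (J : RatSubmodule Y) (I C : RatSubmodule X) : Prop :=
  ∀ U : X.Opens, ∃ e : C.sections U → HomSection f J I U, Function.Bijective e ∧
    ∀ (c : C.sections U) (V : X.Opens) (h : V ≤ U) (j : J.sections (f ⁻¹ᵁ V)),
      θ.app V ((e c).app V h j).1 = θ.app V (ratRes h c.1) * j.1

end FractionalIdeals

end ConductorBlowUp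

open ConductorBlowUp

/-!
The proof works on affine open sets `U` of `X`, with `A = Γ(X, U)`, `B = Γ(Y, f⁻¹ U)` and
`K = 𝒬_X(U) = 𝒬_Y(f⁻¹ U)`, so that `A ⊆ B ⊆ K`. The sheaf `𝒬_X` need not be quasi-coherent; only
the coherence of its submodules is used.

*The conductor.* At an associated point `x` every regular element of `𝒪_{X,x}` is a unit. Hence a
fractional ideal is either zero or generates `𝒬_X` at every associated point
(`RatSubmodule.HasRank.isZero_or_isFull`). An ideal of `A` which contains a unit of `𝒪_{X,x}` for
all associated points `x` of `U` contains a regular element (`exists_mem_nonZeroDivisors`),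
therefore every element of `K` is a fraction `a / b` with `b ∈ A` regular
(`exists_smul_eq_algebraMap`), and a nonzero fractional ideal has sections over `U` which are units
of `K` (`RatSubmodule.IsFull.exists_isUnit`). If `p` is such a section of `f_* 𝒥`, then a
homomorphism `φ : f_* 𝒥 → ℐ` is the multiplication by `φ(p) / p`. So the conductor is the quotient
`(ℐ : f_* 𝒥)`, or `0` if `𝒥 = 0` (`RatSubmodule.exists_isConductor`). It is an `f_* 𝒪_Y`-module, and
since `f` is affine, it is the direct image of the `𝒪_Y`-submodule of `𝒬_Y` which it generates
(`RatSubmodule.mem_extend_iff`).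

*The blow up.* Let `M ⊆ K` be the sections of the conductor over `U`. For `c ∈ M`, the ring of the
chart `D₊(cT)` of `Proj (⨁ₙ Mⁿ Tⁿ)` consists of the fractions `q / cⁿ` with `q ∈ Mⁿ`, and it is a
subring of `K[c⁻¹]` (`awayEval_injective`). Because `B M ⊆ M`, it is a `B`-algebra, where `b` acts
as `bc / c` (`chartHom`), and this is the only structure of a `B`-algebra over `A`, because the
elements of `B` are fractions of elements of `A` (`ringHom_away_ext`). So there is always a morphism
`Bl X → Y` over `X` (`blowUpTo`), and morphisms from a chart to `Y` over `X` are unique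
(`spec_away_hom_ext`).

The module `𝒞'` is invertible if and only if each point of `Y` lies in some `D(g) ⊆ f⁻¹ U` such that
`M` is generated over `B[g⁻¹]` by a regular element `c ∈ M`
(`RatSubmodule.IsInvertible.exists_isGeneratorAway`,
`RatSubmodule.isInvertible_of_isGeneratorAway`). In this case the ring of the chart `D₊(gcT)` is
`B[g⁻¹]` (`IsGeneratorAway.isLocalization_chartHom`), and `D₊(gcT)` is the whole inverse image of
`D(g)` (`IsGeneratorAway.basicOpen_chartHom_le`), so that `Bl X → Y` is an isomorphism
(`isIso_blowUpTo`). Conversely, an isomorphism `Bl X ≅ Y` over `X` restricts to the canonical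
morphisms on the charts. So `B` becomes isomorphic to the ring of `D₊(cT)` over any `D(g)` inside
the image of this chart, and then `c` is a regular generator of `M` over `D(g)`
(`IsGeneratorAway.of_chartHom`).
-/

namespace ConductorBlowUp

/-! ### The charts of the projective spectrum of a Rees algebra -/

section ReesCharts

open Polynomial HomogeneousLocalization

variable {A K : Type u} [CommRing A] [CommRing K] [Algebra A K] {M : Submodule A K}

variable (M) in
/-- The specialization `T = 1` of the graded ring `⨁ₙ Mⁿ Tⁿ`. -/
noncomputable def reesEval : rees M →+* K := (evalRingHom 1).comp (rees M).val.toRingHom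

theorem reesEval_apply (p : rees M) : reesEval M p = (p : K[X]).eval 1 := rfl

theorem reesEval_of_mem {d : ℕ} {p : rees M} (hp : p ∈ reesGrade M d) :
    reesEval M p = p.1.coeff d := by
  rw [reesEval_apply, coe_eq_monomial hp, eval_monomial, coeff_monomial_same, one_pow, mul_one]

/-- The specialization `T = 1` is injective on homogeneous elements of a given degree. -/
theorem eq_of_reesEval_eq {d : ℕ} {p q : rees M} (hp : p ∈ reesGrade M d)
    (hq : q ∈ reesGrade M d) (h : reesEval M p = reesEval M q) : p = q := by
  apply Subtype.ext
  rw [coe_eq_monomial hp, coe_eq_monomial hq, ← reesEval_of_mem hp, h, reesEval_of_mem hq]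

theorem reesEval_mem {d : ℕ} {p : rees M} (hp : p ∈ reesGrade M d) : reesEval M p ∈ M ^ d := by
  rw [reesEval_of_mem hp]
  exact p.2 d

/-- The degree zero part of `R[s⁻¹]`, where `R = ⨁ₙ Mⁿ Tⁿ`, maps to the localization of `K` by
the specialization `T = 1`. -/
noncomputable def awayEval (s : rees M) :
    Away (reesGrade M) s →+* Localization.Away (reesEval M s) :=
  (Localization.awayMap (reesEval M) s).comp
    (algebraMap (Away (reesGrade M) s) (Localization.Away s))

theorem awayEval_apply (s : rees M) (z : Away (reesGrade M) s) :
    awayEval s z = Localization.awayMap (reesEval M) s z.val := rfl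

/-- The specialization `T = 1` maps the fraction `a / sⁿ` to `a(1) / s(1)ⁿ`. -/
theorem awayEval_mk {d : ℕ} {s : rees M} (hs : s ∈ reesGrade M d) (n : ℕ) (a : rees M)
    (ha : a ∈ reesGrade M (n • d)) :
    awayEval s (Away.mk _ hs n a ha) * algebraMap _ _ (reesEval M s ^ n) =
      algebraMap _ _ (reesEval M a) := by
  have h : (Away.mk _ hs n a ha).val * algebraMap (rees M) (Localization.Away s) (s ^ n) =
      algebraMap _ _ a := by
    rw [Away.val_mk, Localization.mk_eq_mk']
    exact IsLocalization.mk'_spec (M := Submonoid.powers s) (Localization.Away s) a ⟨s ^ n, n, rfl⟩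
  have h' := congr_arg (Localization.awayMap (reesEval M) s) h
  rw [map_mul, ← awayEval_apply] at h'
  simpa [Localization.awayMap, IsLocalization.Away.map, IsLocalization.map_eq] using h'

theorem isUnit_algebraMap_pow {R : Type*} [CommRing R] (r : R) (n : ℕ) :
    IsUnit (algebraMap R (Localization.Away r) (r ^ n)) := by
  rw [map_pow]
  exact (IsLocalization.Away.algebraMap_isUnit r).pow n

/-- The ring of the chart given by a homogeneous element `s` is a subring of `K[s(1)⁻¹]`. -/
theorem awayEval_injective {d : ℕ} {s : rees M} (hs : s ∈ reesGrade M d) :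
    Function.Injective (awayEval s) := by
  rw [injective_iff_map_eq_zero]
  intro z hz
  obtain ⟨n, a, ha, rfl⟩ := Away.mk_surjective _ hs z
  have h := awayEval_mk hs n a ha
  rw [hz, zero_mul] at h
  obtain ⟨⟨_, k, rfl⟩, hk⟩ := (IsLocalization.map_eq_zero_iff (Submonoid.powers (reesEval M s))
    (Localization.Away (reesEval M s)) _).mp h.symm
  have h0 : s ^ k * a = 0 := by
    refine eq_of_reesEval_eq (SetLike.mul_mem_graded (SetLike.pow_mem_graded k hs) ha)
      (zero_mem _) ?_
    rw [map_mul, map_pow, map_zero]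
    exact hk
  ext
  rw [Away.val_mk, val_zero, Localization.mk_eq_mk', IsLocalization.mk'_eq_zero_iff]
  exact ⟨⟨_, k, rfl⟩, h0⟩

/-- The structure homomorphism of the chart given by `s`. -/
noncomputable def toAway (s : rees M) : A →+* Away (reesGrade M) s :=
  (fromZeroRingHom _ _).comp (toReesZero M)

theorem awayEval_toAway (s : rees M) (a : A) :
    awayEval s (toAway s a) = algebraMap _ _ (algebraMap A K a) := by
  have h : (toAway s a).val = algebraMap (rees M) (Localization.Away s) (toReesZero M a) := by
    rw [← Localization.mk_one_eq_algebraMap]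
    change Localization.mk (toReesZero M a : rees M) _ = _
    rfl
  rw [awayEval_apply, h, Localization.awayMap, IsLocalization.Away.map, IsLocalization.map_eq]
  congr 1
  rw [reesEval_of_mem (toReesZero M a).2]
  rw [coe_toReesZero, coeff_C_zero]

/-- If every element of an `A`-algebra `B` is a fraction with a denominator in `A` which becomes a
unit in `K`, then there is at most one `A`-algebra homomorphism from `B` to a chart. -/
theorem ringHom_away_ext {B : Type u} [CommRing B] (β : A →+* B)
    (hβ : ∀ b : B, ∃ s a : A, IsUnit (algebraMap A K s) ∧ β s * b = β a)
    {d : ℕ} {s : rees M} (hs : s ∈ reesGrade M d) {u v : B →+* Away (reesGrade M) s}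
    (hu : u.comp β = toAway s) (hv : v.comp β = toAway s) : u = v := by
  ext1 b
  obtain ⟨r, a, hr, hb⟩ := hβ b
  apply awayEval_injective hs
  have h (w : B →+* Away (reesGrade M) s) (hw : w.comp β = toAway s) :
      algebraMap K (Localization.Away (reesEval M s)) (algebraMap A K r) * awayEval s (w b) =
        algebraMap _ _ (algebraMap A K a) := by
    rw [← awayEval_toAway, ← awayEval_toAway, ← hw, ← map_mul, RingHom.comp_apply,
      RingHom.comp_apply, ← map_mul, hb]
  exact (hr.map (algebraMap K (Localization.Away (reesEval M s)))).mul_left_cancel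
    ((h u hu).trans (h v hv).symm)

/-- The element `c T`. -/
noncomputable def degOne (c : M) : rees M := reesMonomial 1 c.1 (by rw [pow_one]; exact c.2)

theorem degOne_mem (c : M) : degOne c ∈ reesGrade M 1 := (reesMonomial 1 c.1 _).2

theorem reesEval_degOne (c : M) : reesEval M (degOne c) = c := by
  rw [reesEval_of_mem (degOne_mem c)]
  exact coeff_monomial_same 1 c.1

/-- The fraction `xT / cT` is mapped to `x / c`. -/
theorem awayEval_mk_degOne (c x : M) (h : degOne x ∈ reesGrade M (1 • 1)) :
    awayEval (degOne c) (Away.mk _ (degOne_mem c) 1 (degOne x) h) * algebraMap _ _ c.1 =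
      algebraMap _ _ x.1 := by
  have := awayEval_mk (degOne_mem c) 1 (degOne x) h
  simpa only [pow_one, reesEval_degOne] using this

theorem isUnit_algebraMap_degOne (c : M) :
    IsUnit (algebraMap K (Localization.Away (reesEval M (degOne c))) c.1) := by
  have := isUnit_algebraMap_pow (reesEval M (degOne c)) 1
  simpa only [pow_one, reesEval_degOne] using this

/-- The irrelevant ideal is generated in degree one, so the charts given by the elements `c T` cover
the projective spectrum. -/
theorem irrelevant_le_span_degOne : (HomogeneousIdeal.irrelevant (reesGrade M)).toIdeal ≤
    Ideal.span (Set.range (degOne (M := M))) := by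
  have key (n : ℕ) (q : K) (hq : q ∈ M ^ (n + 1)) :
      (reesMonomial (n + 1) q hq : rees M) ∈ Ideal.span (Set.range (degOne (M := M))) := by
    have hq' := hq
    rw [pow_succ] at hq'
    induction hq' using Submodule.mul_induction_on' with
    | mem_mul_mem x hx y hy =>
      have : (reesMonomial (n + 1) (x * y) hq : rees M) = reesMonomial n x hx * degOne ⟨y, hy⟩ := by
        apply Subtype.ext
        change monomial (n + 1) (x * y) = monomial n x * monomial 1 y
        rw [monomial_mul_monomial]
      rw [this]
      exact Ideal.mul_mem_left _ _ (Ideal.subset_span ⟨_, rfl⟩)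
    | add x hx y hy ihx ihy =>
      rw [← pow_succ] at hx hy
      have : (reesMonomial (n + 1) (x + y) hq : rees M) =
          reesMonomial (n + 1) x hx + reesMonomial (n + 1) y hy := by
        apply Subtype.ext
        exact map_add (monomial (n + 1)) x y
      rw [this]
      exact add_mem (ihx hx) (ihy hy)
  rw [HomogeneousIdeal.toIdeal_irrelevant_le]
  intro i hi p hp
  obtain ⟨n, rfl⟩ := Nat.exists_eq_succ_of_ne_zero hi.ne'
  have : p = reesMonomial (n + 1) (p.1.coeff (n + 1)) (p.2 (n + 1)) :=
    Subtype.ext (coe_eq_monomial hp)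
  rw [this]
  exact key n _ _

variable {B : Type u} [CommRing B] (ι : B →+* K) (hM : ∀ b, ∀ m ∈ M, ι b * m ∈ M)

/-- If `M` is a `B`-submodule of `K`, then the ring of the chart given by `c T` is a `B`-algebra:
the element `b` is mapped to the fraction `bcT / cT`. -/
noncomputable def chartHom (c : M) : B →+* Away (reesGrade M) (degOne c) :=
  have h (b : B) : awayEval (degOne c) (Away.mk _ (degOne_mem c) 1 (degOne ⟨ι b * c, hM b c c.2⟩)
      (degOne_mem _)) = algebraMap _ _ (ι b) := by
    refine (isUnit_algebraMap_degOne c).mul_right_cancel ?_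
    rw [awayEval_mk_degOne, map_mul]
  { toFun := fun b ↦ Away.mk _ (degOne_mem c) 1 (degOne ⟨ι b * c, hM b c c.2⟩) (degOne_mem _)
    map_one' := awayEval_injective (degOne_mem c) (by rw [h, map_one, map_one, map_one])
    map_mul' := fun x y ↦ awayEval_injective (degOne_mem c)
      (by rw [h, map_mul, map_mul, map_mul, h, h])
    map_zero' := awayEval_injective (degOne_mem c) (by rw [h, map_zero, map_zero, map_zero])
    map_add' := fun x y ↦ awayEval_injective (degOne_mem c)
      (by rw [h, map_add, map_add, map_add, h, h]) }

theorem chartHom_apply (c : M) (b : B) : chartHom ι hM c b =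
    Away.mk _ (degOne_mem c) 1 (degOne ⟨ι b * c, hM b c c.2⟩) (degOne_mem _) := rfl

theorem awayEval_chartHom (c : M) (b : B) :
    awayEval (degOne c) (chartHom ι hM c b) = algebraMap _ _ (ι b) := by
  refine (isUnit_algebraMap_degOne c).mul_right_cancel ?_
  rw [chartHom_apply, awayEval_mk_degOne, map_mul]

theorem chartHom_comp (β : A →+* B) (hβ : ι.comp β = algebraMap A K) (c : M) :
    (chartHom ι hM c).comp β = toAway (degOne c) := by
  ext1 a
  apply awayEval_injective (degOne_mem c)
  rw [RingHom.comp_apply, awayEval_chartHom, awayEval_toAway, ← hβ, RingHom.comp_apply]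

theorem exists_pow_mul_eq_zero_of_regular {r c : K}
    (hc : ∀ k, c * k = 0 → ∃ n : ℕ, r ^ n * k = 0) (m : ℕ) (k : K) (hk : c ^ m * k = 0) :
    ∃ n : ℕ, r ^ n * k = 0 := by
  induction m generalizing k with
  | zero => exact ⟨0, by simpa using hk⟩
  | succ m ih =>
    obtain ⟨n, hn⟩ := hc (c ^ m * k) (by rw [← mul_assoc, ← pow_succ', hk])
    obtain ⟨n', hn'⟩ := ih (r ^ n * k) (by rw [mul_left_comm, hn])
    exact ⟨n' + n, by rw [pow_add, mul_assoc, hn']⟩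

/-- The element `c` of the `B`-submodule `M` of `K` is a regular generator of `M` over the open
subset `D(g)` of `Spec B`. Regularity means that multiplication by `c` is injective on `K[g⁻¹]`. -/
structure IsGeneratorAway (M : Submodule A K) (ι : B →+* K) (g : B) (c : K) : Prop where
  mem : c ∈ M
  regular (k : K) : c * k = 0 → ∃ n : ℕ, ι g ^ n * k = 0
  generates (x : K) : x ∈ M → ∃ (n : ℕ) (b : B), ι g ^ n * x = ι b * c

namespace IsGeneratorAway

variable {ι} {g : B} {c : K} (h : IsGeneratorAway M ι g c)
include h

theorem exists_pow_mul_eq (β : A →+* B) (hβ : ι.comp β = algebraMap A K) (m : ℕ) :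
    ∀ x ∈ M ^ m, ∃ (n : ℕ) (b : B), ι g ^ n * x = ι b * c ^ m := by
  induction m with
  | zero =>
    intro x hx
    rw [pow_zero] at hx
    obtain ⟨a, rfl⟩ := Submodule.mem_one.mp hx
    exact ⟨0, β a, by rw [← RingHom.comp_apply, hβ, pow_zero, pow_zero, one_mul, mul_one]⟩
  | succ m ih =>
    intro x hx
    rw [pow_succ] at hx
    induction hx using Submodule.mul_induction_on' with
    | mem_mul_mem x hx y hy =>
      obtain ⟨n, b, e⟩ := ih x hx
      obtain ⟨n', b', e'⟩ := h.generates y hy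
      refine ⟨n + n', b * b', ?_⟩
      rw [map_mul]
      linear_combination ι g ^ n' * y * e + ι b * c ^ m * e'
    | add x hx y hy ihx ihy =>
      obtain ⟨n, b, e⟩ := ihx
      obtain ⟨n', b', e'⟩ := ihy
      refine ⟨n + n', g ^ n' * b + g ^ n * b', ?_⟩
      simp only [map_add, map_mul, map_pow]
      linear_combination ι g ^ n' * e + ι g ^ n * e'

/-- If `c` is a regular generator of `M` over `D(g)`, then the chart given by `g c T` is the
localization of `B` at `g`. -/
theorem isLocalization_chartHom (hι : Function.Injective ι)
    (β : A →+* B) (hβ : ι.comp β = algebraMap A K) :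
    letI := (chartHom ι hM ⟨ι g * c, hM g c h.mem⟩).toAlgebra
    IsLocalization.Away g (Away (reesGrade M) (degOne ⟨ι g * c, hM g c h.mem⟩)) := by
  set d : M := ⟨ι g * c, hM g c h.mem⟩ with hd
  let := (chartHom ι hM d).toAlgebra
  constructor; constructor
  · rintro ⟨_, n, rfl⟩
    rw [map_pow, RingHom.algebraMap_toAlgebra]
    refine IsUnit.pow _ (IsUnit.of_mul_eq_one
      (Away.mk _ (degOne_mem d) 1 (degOne ⟨c, h.mem⟩) (degOne_mem _)) ?_)
    apply awayEval_injective (degOne_mem d)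
    refine (isUnit_algebraMap_degOne d).mul_right_cancel ?_
    rw [map_mul, mul_assoc, awayEval_mk_degOne, awayEval_chartHom, map_one, one_mul, ← map_mul]
  · intro z
    obtain ⟨n, a, ha, rfl⟩ := Away.mk_surjective _ (degOne_mem d) z
    have ha' : reesEval M a ∈ M ^ n := by simpa using reesEval_mem ha
    obtain ⟨k, b, e⟩ := h.exists_pow_mul_eq β hβ n _ ha'
    refine ⟨⟨b, ⟨_, k + n, rfl⟩⟩, ?_⟩
    rw [RingHom.algebraMap_toAlgebra]
    apply awayEval_injective (degOne_mem d)
    refine (isUnit_algebraMap_pow (reesEval M (degOne d)) n).mul_right_cancel ?_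
    rw [map_mul, mul_right_comm, awayEval_mk, awayEval_chartHom, awayEval_chartHom, ← map_mul,
      ← map_mul, reesEval_degOne]
    congr 1
    simp only [map_pow, hd]
    linear_combination ι g ^ n * e
  · intro b b' e
    rw [RingHom.algebraMap_toAlgebra] at e
    have e' := congr_arg (awayEval (degOne d)) e
    rw [awayEval_chartHom, awayEval_chartHom,
      IsLocalization.eq_iff_exists (Submonoid.powers (reesEval M (degOne d)))] at e'
    obtain ⟨⟨_, n, rfl⟩, e'⟩ := e'
    simp only [reesEval_degOne, hd] at e'
    obtain ⟨m, hm⟩ := exists_pow_mul_eq_zero_of_regular h.regular n (ι g ^ n * ι (b - b')) (by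
      rw [map_sub]
      linear_combination e')
    refine ⟨⟨_, m + n, rfl⟩, hι ?_⟩
    simp only [map_mul, map_pow]
    rw [map_sub] at hm
    linear_combination hm

/-- If `c` is a regular generator of `M` over `D(g)`, then the open subset `D(g)` of the chart given
by `c' T` is contained in the chart given by `g c T`: a power of `g` is a multiple of
`g c / c'`. -/
theorem basicOpen_chartHom_le (c' : M) : PrimeSpectrum.basicOpen (chartHom ι hM c' g) ≤
    PrimeSpectrum.basicOpen (Away.isLocalizationElem (degOne_mem c')
      (degOne_mem ⟨ι g * c, hM g c h.mem⟩)) := by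
  obtain ⟨n, b, e⟩ := h.generates c' c'.2
  set d : M := ⟨ι g * c, hM g c h.mem⟩ with hd
  have he : chartHom ι hM c' g ^ (n + 1) =
      chartHom ι hM c' b * Away.isLocalizationElem (degOne_mem c') (degOne_mem d) := by
    apply awayEval_injective (degOne_mem c')
    have h1 := awayEval_mk (degOne_mem c') 1 (degOne d ^ 1)
      (SetLike.pow_mem_graded 1 (degOne_mem d))
    rw [map_pow (reesEval M) (degOne d), reesEval_degOne d, pow_one d.1] at h1
    refine (isUnit_algebraMap_pow (reesEval M (degOne c')) 1).mul_right_cancel ?_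
    rw [map_mul, mul_assoc, h1, ← map_pow (chartHom ι hM c'), awayEval_chartHom, awayEval_chartHom,
      ← map_mul, ← map_mul, pow_one, reesEval_degOne]
    congr 1
    rw [map_pow]
    linear_combination ι g * e
  intro w hw
  rw [PrimeSpectrum.mem_basicOpen] at hw ⊢
  intro h0
  refine hw (w.2.mem_of_pow_mem (n + 1) ?_)
  rw [he]
  exact Ideal.mul_mem_left _ _ h0

end IsGeneratorAway

/-- Conversely, `c` is a regular generator of `M` over `D(g)` if `B` and the chart given by `c T`
become isomorphic after inverting `g`. -/
theorem IsGeneratorAway.of_chartHom {ι : B →+* K} (hM : ∀ b, ∀ m ∈ M, ι b * m ∈ M) (g : B) (c : M)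
    (hK : ∀ k : K, ∃ (s : K) (b : B), IsUnit s ∧ s * k = ι b)
    (inj : ∀ b, chartHom ι hM c b = 0 → ∃ n : ℕ, g ^ n * b = 0)
    (surj : ∀ z, ∃ (n : ℕ) (b : B), chartHom ι hM c g ^ n * z = chartHom ι hM c b) :
    IsGeneratorAway M ι g c := by
  have hreg (k : K) (hk : c * k = 0) : ∃ n : ℕ, ι g ^ n * k = 0 := by
    obtain ⟨s, b, hs, e⟩ := hK k
    have hb : chartHom ι hM c b = 0 := by
      apply awayEval_injective (degOne_mem c)
      refine (isUnit_algebraMap_degOne c).mul_right_cancel ?_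
      rw [awayEval_chartHom, ← map_mul, ← e, mul_assoc, mul_comm k, hk, mul_zero, map_zero,
        map_zero, zero_mul]
    obtain ⟨n, hn⟩ := inj b hb
    refine ⟨n, hs.mul_left_cancel ?_⟩
    rw [mul_left_comm, e, ← map_pow, ← map_mul, hn, map_zero, mul_zero]
  refine ⟨c.2, hreg, fun x hx ↦ ?_⟩
  obtain ⟨n, b, e⟩ := surj (Away.mk _ (degOne_mem c) 1 (degOne ⟨x, hx⟩) (degOne_mem _))
  have e' := congr_arg (awayEval (degOne c)) e
  rw [← map_pow (chartHom ι hM c), map_mul, awayEval_chartHom, awayEval_chartHom,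
    ← (isUnit_algebraMap_degOne c).mul_left_inj, mul_assoc, awayEval_mk_degOne, ← map_mul,
    ← map_mul, IsLocalization.eq_iff_exists (Submonoid.powers (reesEval M (degOne c)))] at e'
  obtain ⟨⟨_, m, rfl⟩, e'⟩ := e'
  simp only [reesEval_degOne] at e'
  obtain ⟨l, hl⟩ := exists_pow_mul_eq_zero_of_regular hreg m (ι (g ^ n) * x - ι b * c)
    (by linear_combination e')
  refine ⟨l + n, g ^ l * b, ?_⟩
  rw [map_mul, map_pow]
  rw [map_pow] at hl
  linear_combination hl

end ReesCharts

/-! ### Rational functions on affine open sets -/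

section RationalFunctionsOnAffines

variable {X : Scheme.{u}}

theorem exists_affine_le (U : X.Opens) {x : X} (hx : x ∈ U) :
    ∃ V : X.Opens, IsAffineOpen V ∧ V ≤ U ∧ x ∈ V := by
  obtain ⟨V, hV, hxV, hle⟩ := X.isBasis_affineOpens.exists_subset_of_mem_open hx U.2
  obtain ⟨V, hV, rfl⟩ := hV
  exact ⟨V, hV, hle, hxV⟩

theorem ratRes_self {U : X.Opens} (s : RatFun X U) : ratRes (le_refl U) s = s := rfl

theorem ratRes_ratRes {U V W : X.Opens} (h : U ≤ V) (h' : V ≤ W) (s : RatFun X W) :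
    ratRes h (ratRes h' s) = ratRes (h.trans h') s := rfl

theorem ratRes_smul {U V : X.Opens} (h : U ≤ V) (a : Γ(X, V)) (s : RatFun X V) :
    ratRes h (a • s) = X.presheaf.map (homOfLE h).op a • ratRes h s := by
  rw [Algebra.smul_def, map_mul, ratRes_algebraMap, ← Algebra.smul_def]

theorem ratFun_ext {U : X.Opens} {s t : RatFun X U} (h : ∀ x, s.1 x = t.1 x) : s = t :=
  Subtype.ext (funext h)

theorem ratFun_ext_of_local {U : X.Opens} {s t : RatFun X U}
    (h : ∀ x ∈ U, ∃ (V : X.Opens) (hV : V ≤ U), x ∈ V ∧ ratRes hV s = ratRes hV t) : s = t := by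
  refine ratFun_ext fun x ↦ ?_
  obtain ⟨V, hV, hx, e⟩ := h x.1 x.2.1
  exact congr_fun (congr_arg Subtype.val e) ⟨x.1, hx, x.2.2⟩

/-- `𝒬_X` is a sheaf: compatible rational functions glue. -/
theorem exists_ratFun_glue {ι : Type*} {U : X.Opens} (V : ι → X.Opens) (hV : ∀ i, V i ≤ U)
    (hcov : ∀ x ∈ U, ∃ i, x ∈ V i) (s : ∀ i, RatFun X (V i))
    (hs : ∀ (i j) (x : X) (hi : x ∈ V i) (hj : x ∈ V j) (hx : x ∈ assPoints X),
      (s i).1 ⟨x, hi, hx⟩ = (s j).1 ⟨x, hj, hx⟩) :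
    ∃ t : RatFun X U, ∀ i, ratRes (hV i) t = s i := by
  choose i hi using hcov
  refine ⟨⟨fun x ↦ (s (i x.1 x.2.1)).1 ⟨x.1, hi x.1 x.2.1, x.2.2⟩, fun x ↦ ?_⟩,
    fun j ↦ ratFun_ext fun x ↦ hs _ _ x.1 (hi _ _) x.2.1 x.2.2⟩
  obtain ⟨W, t, hxW, ht⟩ := (s (i x.1 x.2.1)).2 ⟨x.1, hi x.1 x.2.1, x.2.2⟩
  refine ⟨W ⊓ V (i x.1 x.2.1), X.presheaf.map (homOfLE inf_le_left).op t,
    ⟨hxW, hi x.1 x.2.1⟩, fun y hy ↦ ?_⟩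
  rw [TopCat.Presheaf.germ_res_apply, ← ht ⟨y.1, hy.2, y.2.2⟩ hy.1]
  exact hs _ _ y.1 (hi _ _) hy.2 y.2.2

theorem isUnit_res_basicOpen {U : X.Opens} (g : Γ(X, U)) :
    IsUnit (X.presheaf.map (homOfLE (X.basicOpen_le g)).op g) :=
  RingedSpace.isUnit_res_basicOpen _ g

/-- The pointwise inverse of a rational function is again a rational function. -/
theorem isUnit_ratFun {U : X.Opens} (s : RatFun X U) (hs : ∀ x, IsUnit (s.1 x)) : IsUnit s := by
  choose t ht using fun x ↦ (hs x).exists_right_inv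
  refine IsUnit.of_mul_eq_one ⟨t, fun x ↦ ?_⟩ (ratFun_ext ht)
  obtain ⟨V, a, hx, ha⟩ := s.2 x
  have hxa : x.1 ∈ X.basicOpen a := by
    rw [X.mem_basicOpen _ _ hx, ← ha x hx]
    exact hs x
  obtain ⟨b, hb⟩ : ∃ b : Γ(X, X.basicOpen a),
      X.presheaf.map (homOfLE (X.basicOpen_le a)).op a * b = 1 :=
    (isUnit_res_basicOpen a).exists_right_inv
  refine ⟨X.basicOpen a, b, hxa, fun y hy ↦ ?_⟩
  have h1 := congr_arg (X.presheaf.germ (X.basicOpen a) y.1 hy) hb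
  rw [map_mul, map_one, TopCat.Presheaf.germ_res_apply] at h1
  refine (hs y).mul_left_cancel ((ht y).trans ?_)
  rw [ha y (X.basicOpen_le a hy)]
  exact h1.symm

theorem isUnit_ratFun_apply {U : X.Opens} {s : RatFun X U} (hs : IsUnit s) (x : AssIn X U) :
    IsUnit (s.1 x) :=
  hs.map ((Pi.evalRingHom _ x).comp (ratFunSubring X U).subtype)

/-- On an affine open set, every function on `D(g)` is of the form `a / gⁿ`. -/
theorem exists_res_eq_pow_mul {U : X.Opens} (hU : IsAffineOpen U) (g : Γ(X, U))
    (c : Γ(X, X.basicOpen g)) : ∃ (n : ℕ) (a : Γ(X, U)),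
      X.presheaf.map (homOfLE (X.basicOpen_le g)).op a =
        X.presheaf.map (homOfLE (X.basicOpen_le g)).op g ^ n * c := by
  let := (X.presheaf.map (homOfLE (X.basicOpen_le g)).op).hom.toAlgebra
  have hloc : IsLocalization.Away g Γ(X, X.basicOpen g) := hU.isLocalization_basicOpen g
  obtain ⟨⟨a, ⟨_, n, rfl⟩⟩, h⟩ := IsLocalization.surj (.powers g) c
  refine ⟨n, a, ?_⟩
  rw [mul_comm]
  simpa [RingHom.algebraMap_toAlgebra] using h.symm

variable [IsLocallyNoetherian X]

/-- At an associated point, every regular element of the local ring is a unit, because the maximal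
ideal annihilates a nonzero element. -/
theorem isUnit_of_mem_nonZeroDivisors_stalk {x : X} (hx : x ∈ assPoints X)
    {a : X.presheaf.stalk x} (ha : a ∈ nonZeroDivisors (X.presheaf.stalk x)) : IsUnit a := by
  by_contra h
  obtain ⟨hp, z, hz⟩ := isAssociatedPrime_iff.mp hx
  have h1 : a ∈ IsLocalRing.maximalIdeal (X.presheaf.stalk x) := h
  rw [hz, Submodule.mem_colon_singleton, Submodule.mem_bot, smul_eq_mul, mul_comm] at h1
  have h2 : z = 0 := (mem_nonZeroDivisors_iff.mp ha).2 z h1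
  refine hp.ne_top ((Ideal.eq_top_iff_one _).mpr ?_)
  rw [hz, Submodule.mem_colon_singleton, h2, smul_zero]
  exact zero_mem _

theorem isUnit_germ_of_mem_nonZeroDivisors {U : X.Opens} (hU : IsAffineOpen U) {a : Γ(X, U)}
    (ha : a ∈ nonZeroDivisors Γ(X, U)) (x : AssIn X U) :
    IsUnit (X.presheaf.germ U x.1 x.2.1 a) := by
  let := X.presheaf.algebra_section_stalk ⟨x.1, x.2.1⟩
  have := hU.isLocalization_stalk ⟨x.1, x.2.1⟩
  exact isUnit_of_mem_nonZeroDivisors_stalk x.2.2 (IsLocalization.map_nonZeroDivisors_le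
    (hU.primeIdealOf ⟨x.1, x.2.1⟩).asIdeal.primeCompl (X.presheaf.stalk x.1) ⟨a, ha, rfl⟩)

theorem isUnit_algebraMap_ratFun {U : X.Opens} (hU : IsAffineOpen U) {a : Γ(X, U)}
    (ha : a ∈ nonZeroDivisors Γ(X, U)) : IsUnit (algebraMap Γ(X, U) (RatFun X U) a) :=
  isUnit_ratFun _ fun x ↦ isUnit_germ_of_mem_nonZeroDivisors hU ha x

/-- Functions inject into rational functions. -/
theorem algebraMap_ratFun_injective (U : X.Opens) :
    Function.Injective (algebraMap Γ(X, U) (RatFun X U)) := by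
  rw [injective_iff_map_eq_zero]
  intro a ha
  choose V hV hle hx using fun x : U ↦ exists_affine_le U x.2
  refine X.sheaf.eq_of_locally_eq' V U (fun x ↦ homOfLE (hle x))
    (fun x hxU ↦ TopologicalSpace.Opens.mem_iSup.mpr ⟨⟨x, hxU⟩, hx _⟩) a 0 fun x ↦ ?_
  rw [map_zero]
  refine eq_zero_of_germ_eq_zero (hV x) _ fun y ↦ ?_
  have := congr_fun (congr_arg Subtype.val ha) ⟨y.1, hle x y.2.1, y.2.2⟩
  rw [algebraMap_ratFun_apply] at this
  refine (TopCat.Presheaf.germ_res_apply X.presheaf (homOfLE (hle x)) y.1 y.2.1 a).trans this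

/-- A rational function which is locally a function is a function. -/
theorem exists_algebraMap_eq_of_local {U : X.Opens} (s : RatFun X U)
    (hs : ∀ x ∈ U, ∃ (V : X.Opens) (h : V ≤ U) (a : Γ(X, V)), x ∈ V ∧
      ratRes h s = algebraMap Γ(X, V) (RatFun X V) a) :
    ∃ a : Γ(X, U), algebraMap Γ(X, U) (RatFun X U) a = s := by
  choose V hV a hx ha using fun x : U ↦ hs x.1 x.2
  obtain ⟨t, ht, -⟩ := X.sheaf.existsUnique_gluing' V U (fun x ↦ homOfLE (hV x))
    (fun x hxU ↦ TopologicalSpace.Opens.mem_iSup.mpr ⟨⟨x, hxU⟩, hx _⟩) a (fun x y ↦ by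
      apply algebraMap_ratFun_injective
      refine (ratRes_algebraMap inf_le_left (a x)).symm.trans
        (Eq.trans ?_ (ratRes_algebraMap inf_le_right (a y)))
      rw [← ha, ← ha, ratRes_ratRes, ratRes_ratRes])
  refine ⟨(t : Γ(X, U)), ratFun_ext_of_local fun x hxU ↦ ⟨V ⟨x, hxU⟩, hV _, hx _, ?_⟩⟩
  refine (ratRes_algebraMap _ _).trans ((congr_arg _ ?_).trans (ha _).symm)
  exact ht ⟨x, hxU⟩

/-- An ideal which contains a unit of the local ring at each associated point contains a regular
element: otherwise it would be annihilated by a nonzero element. -/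
theorem exists_mem_nonZeroDivisors {U : X.Opens} (hU : IsAffineOpen U) (N : Ideal Γ(X, U))
    (hN : ∀ x : AssIn X U, ∃ a ∈ N, IsUnit (X.presheaf.germ U x.1 x.2.1 a)) :
    ∃ a ∈ N, a ∈ nonZeroDivisors Γ(X, U) := by
  have : IsNoetherianRing Γ(X, U) := IsLocallyNoetherian.component_noetherian ⟨U, hU⟩
  by_contra! h
  have hd : Disjoint (N : Set Γ(X, U)) (nonZeroDivisors Γ(X, U)) :=
    Set.disjoint_left.mpr fun a ha ↦ h a ha
  obtain ⟨z, hz, hz0⟩ := SetLike.exists_of_lt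
    (Ideal.bot_lt_annihilator_of_disjoint_nonZeroDivisors hd)
  refine hz0 (eq_zero_of_germ_eq_zero hU z fun x ↦ ?_)
  obtain ⟨a, ha, hu⟩ := hN x
  have : z * a = 0 := by
    have := Module.mem_annihilator.mp hz ⟨a, ha⟩
    exact congr_arg Subtype.val this
  rw [← hu.mul_left_eq_zero, ← map_mul, this, map_zero]

/-- On an affine open set, a rational function is a fraction of functions. -/
theorem exists_smul_eq_algebraMap {U : X.Opens} (hU : IsAffineOpen U) (s : RatFun X U) :
    ∃ b ∈ nonZeroDivisors Γ(X, U), ∃ a, b • s = algebraMap Γ(X, U) (RatFun X U) a := by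
  -- the ideal of denominators of `s`
  let N : Ideal Γ(X, U) :=
    { carrier := {b | ∃ a, b • s = algebraMap Γ(X, U) (RatFun X U) a}
      add_mem' := by
        rintro b b' ⟨a, h⟩ ⟨a', h'⟩
        exact ⟨a + a', by rw [add_smul, h, h', map_add]⟩
      zero_mem' := ⟨0, by rw [zero_smul, map_zero]⟩
      smul_mem' := by
        rintro c b ⟨a, h⟩
        exact ⟨c * a, by rw [smul_eq_mul, mul_smul, h, map_mul, Algebra.smul_def]⟩ }
  obtain ⟨b, ⟨a, h⟩, hb⟩ := exists_mem_nonZeroDivisors hU N fun x ↦ by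
    obtain ⟨V, t, hxV, ht⟩ := s.2 x
    obtain ⟨g, hg, hxg⟩ := hU.exists_basicOpen_le ⟨x.1, hxV⟩ x.2.1
    obtain ⟨n, a, ha⟩ := exists_res_eq_pow_mul hU g (X.presheaf.map (homOfLE hg).op t)
    obtain ⟨m, hm⟩ := exists_pow_smul_eq_zero hU g (g ^ n • s - algebraMap _ _ a) (by
      rw [map_sub, sub_eq_zero, ratRes_algebraMap, ha, ratRes_smul, Algebra.smul_def, map_mul,
        map_pow]
      congr 1
      refine ratFun_ext fun y ↦ ?_
      rw [ratRes_apply, ht _ (hg y.2.1), algebraMap_ratFun_apply, TopCat.Presheaf.germ_res_apply])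
    refine ⟨g ^ (m + n), ⟨g ^ m * a, ?_⟩, ?_⟩
    · rw [smul_sub, sub_eq_zero] at hm
      rw [pow_add, mul_smul, hm, map_mul, Algebra.smul_def]
    · rw [map_pow]
      exact ((X.mem_basicOpen _ _ x.2.1).mp hxg).pow _
  exact ⟨b, hb, a, h⟩

end RationalFunctionsOnAffines

/-! ### Coherent submodules of the sheaf of rational functions -/

section CoherentSubmodules

variable {X : Scheme.{u}}

theorem ratRes_mem_span {U V : X.Opens} (h : U ≤ V) {T : Set (RatFun X V)} {s : RatFun X V}
    (hs : s ∈ Submodule.span Γ(X, V) T) :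
    ratRes h s ∈ Submodule.span Γ(X, U) (ratRes h '' T) := by
  induction hs using Submodule.span_induction with
  | mem x hx => exact Submodule.subset_span ⟨x, hx, rfl⟩
  | zero => rw [map_zero]; exact zero_mem _
  | add x y _ _ hx hy => rw [map_add]; exact add_mem hx hy
  | smul a x _ hx => rw [ratRes_smul]; exact Submodule.smul_mem _ _ hx

/-- The submodule of `𝒬_X` of all rational functions which locally belong to `P`, where `P` is a
presheaf of submodules. -/
def RatSubmodule.ofPresheaf (P : ∀ U : X.Opens, Submodule Γ(X, U) (RatFun X U))
    (hP : ∀ {U V : X.Opens} (h : U ≤ V), ∀ s ∈ P V, ratRes h s ∈ P U) : RatSubmodule X where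
  sections U :=
    { carrier := {s | ∀ x ∈ U, ∃ (V : X.Opens) (h : V ≤ U), x ∈ V ∧ ratRes h s ∈ P V}
      add_mem' := fun {s t} hs ht x hx ↦ by
        obtain ⟨V, h, hxV, hV⟩ := hs x hx
        obtain ⟨W, h', hxW, hW⟩ := ht x hx
        refine ⟨V ⊓ W, inf_le_left.trans h, ⟨hxV, hxW⟩, ?_⟩
        rw [map_add]
        exact add_mem (hP inf_le_left _ hV) (hP inf_le_right _ hW)
      zero_mem' := fun x hx ↦ ⟨U, le_rfl, hx, by rw [map_zero]; exact zero_mem _⟩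
      smul_mem' := fun a s hs x hx ↦ by
        obtain ⟨V, h, hxV, hV⟩ := hs x hx
        refine ⟨V, h, hxV, ?_⟩
        rw [ratRes_smul]
        exact Submodule.smul_mem _ _ hV }
  res_mem {U V} h s hs x hx := by
    obtain ⟨W, h', hxW, hW⟩ := hs x (h hx)
    exact ⟨W ⊓ U, inf_le_right, ⟨hxW, hx⟩, hP inf_le_left _ hW⟩
  mem_of_local {U} s hs x hx := by
    obtain ⟨V, h, hxV, hV⟩ := hs x hx
    obtain ⟨W, h', hxW, hW⟩ := hV x hxV
    exact ⟨W, h'.trans h, hxW, hW⟩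

/-- An element of the submodule generated by `N` over `D(g)` extends to an element of `N`, up to a
power of `g`. -/
theorem exists_res_eq_of_mem_span {U : X.Opens} (hU : IsAffineOpen U) (g : Γ(X, U))
    (N : Submodule Γ(X, U) (RatFun X U)) {t : RatFun X (X.basicOpen g)}
    (ht : t ∈ Submodule.span Γ(X, X.basicOpen g) (ratRes (X.basicOpen_le g) '' N)) :
    ∃ (n : ℕ) (m : RatFun X U), m ∈ N ∧ ratRes (X.basicOpen_le g) m =
      X.presheaf.map (homOfLE (X.basicOpen_le g)).op g ^ n • t := by
  induction ht using Submodule.span_induction with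
  | mem x hx =>
    obtain ⟨m, hm, rfl⟩ := hx
    exact ⟨0, m, hm, by rw [pow_zero, one_smul]⟩
  | zero => exact ⟨0, 0, zero_mem _, by rw [map_zero, smul_zero]⟩
  | add x y _ _ hx hy =>
    obtain ⟨n, m, hm, e⟩ := hx
    obtain ⟨n', m', hm', e'⟩ := hy
    refine ⟨n + n', g ^ n' • m + g ^ n • m',
      add_mem (Submodule.smul_mem _ _ hm) (Submodule.smul_mem _ _ hm'), ?_⟩
    rw [map_add, ratRes_smul, ratRes_smul, e, e', smul_smul, smul_smul, map_pow, map_pow,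
      ← pow_add, ← pow_add, add_comm n' n, smul_add]
  | smul c x _ hx =>
    obtain ⟨n, m, hm, e⟩ := hx
    obtain ⟨k, a, ha⟩ := exists_res_eq_pow_mul hU g c
    refine ⟨k + n, a • m, Submodule.smul_mem _ _ hm, ?_⟩
    rw [ratRes_smul, ha, e, smul_smul, smul_smul]
    congr 1
    ring

/-- An ideal is the unit ideal if it contains powers of functions `g` such that the sets `D(g)`
cover the affine open set `U`. -/
theorem ideal_eq_top_of_forall_mem {U : X.Opens} (hU : IsAffineOpen U) (N : Ideal Γ(X, U))
    (hN : ∀ x ∈ U, ∃ g : Γ(X, U), x ∈ X.basicOpen g ∧ ∃ n : ℕ, g ^ n ∈ N) : N = ⊤ := by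
  rw [← Ideal.span_eq N, ← hU.self_le_iSup_basicOpen_iff]
  intro x hx
  obtain ⟨g, hxg, n, hn⟩ := hN x hx
  refine TopologicalSpace.Opens.mem_iSup.mpr
    ⟨⟨g ^ (n + 1), by rw [pow_succ]; exact N.mul_mem_right g hn⟩, ?_⟩
  rwa [X.basicOpen_pow _ n.succ_pos]

theorem RatSubmodule.mem_of_iSup {I : RatSubmodule X} {ι : Type*} {U : X.Opens} (V : ι → X.Opens)
    (hV : ∀ i, V i ≤ U) (hcov : ∀ x ∈ U, ∃ i, x ∈ V i) {s : RatFun X U}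
    (hs : ∀ i, ratRes (hV i) s ∈ I.sections (V i)) : s ∈ I.sections U :=
  I.mem_of_local s fun x hx ↦ by
    obtain ⟨i, hi⟩ := hcov x hx
    exact ⟨V i, hV i, hi, hs i⟩

namespace RatSubmodule

variable {I : RatSubmodule X}

variable (I) in
/-- Coherence of a submodule of `𝒬_X` on a single affine open set. That `s` vanishes up to a power
of `g` if it vanishes on `D(g)` holds for all rational functions, by `exists_pow_smul_eq_zero`. -/
structure IsCoherentOn (U : X.Opens) : Prop where
  fg : (I.sections U).FG
  exists_res_eq_smul (g : Γ(X, U)) : ∀ s ∈ I.sections (X.basicOpen g),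
    ∃ (n : ℕ) (t : RatFun X U), t ∈ I.sections U ∧ ratRes (X.basicOpen_le g) t =
      (X.presheaf.map (homOfLE (X.basicOpen_le g)).op g) ^ n • s

theorem IsCoherentOn.exists_res_eq {U V : X.Opens} (h : I.IsCoherentOn U) (g : Γ(X, U))
    (hV : V = X.basicOpen g) (hVU : V ≤ U) (s : RatFun X V) (hs : s ∈ I.sections V) :
    ∃ (n : ℕ) (t : RatFun X U), t ∈ I.sections U ∧
      ratRes hVU t = (X.presheaf.map (homOfLE hVU).op g) ^ n • s := by
  subst hV
  exact h.exists_res_eq_smul g s hs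

/-- If the sections over `D(g)` are finitely generated, then they are generated by finitely many
sections over `U`. -/
theorem exists_fg_le_of_fg {U : X.Opens} (g : Γ(X, U))
    (hfg : (I.sections (X.basicOpen g)).FG)
    (hext : ∀ s ∈ I.sections (X.basicOpen g), ∃ (n : ℕ) (t : RatFun X U), t ∈ I.sections U ∧
      ratRes (X.basicOpen_le g) t = (X.presheaf.map (homOfLE (X.basicOpen_le g)).op g) ^ n • s) :
    ∃ N : Submodule Γ(X, U) (RatFun X U), N.FG ∧ N ≤ I.sections U ∧
      I.sections (X.basicOpen g) ≤
        Submodule.span Γ(X, X.basicOpen g) (ratRes (X.basicOpen_le g) '' N) := by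
  obtain ⟨T, hT⟩ := hfg
  choose n t ht e using fun s : T ↦ hext s.1 (hT ▸ Submodule.subset_span s.2)
  refine ⟨Submodule.span _ (Set.range t), Submodule.fg_span (Set.finite_range t),
    Submodule.span_le.mpr (by rintro _ ⟨s, rfl⟩; exact ht s), ?_⟩
  rw [← hT, Submodule.span_le]
  intro s hs
  obtain ⟨w, hw⟩ := (isUnit_res_basicOpen g).pow (n ⟨s, hs⟩)
  have : s = (↑w⁻¹ : Γ(X, X.basicOpen g)) • ratRes (X.basicOpen_le g) (t ⟨s, hs⟩) := by
    rw [e, ← hw, smul_smul, Units.inv_mul, one_smul]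
  rw [this]
  exact Submodule.smul_mem _ _ (Submodule.subset_span
    ⟨_, Submodule.subset_span ⟨⟨s, hs⟩, rfl⟩, rfl⟩)

theorem IsCoherentOn.fg_of_res {U V : X.Opens} (hVU : V ≤ U) {N : Submodule Γ(X, U) (RatFun X U)}
    (hN : N.FG) (h : I.sections V = Submodule.span Γ(X, V) (ratRes hVU '' N)) :
    (I.sections V).FG := by
  obtain ⟨T, rfl⟩ := hN
  rw [h]
  have : Submodule.span Γ(X, V) (ratRes hVU '' (Submodule.span Γ(X, U) (T : Set (RatFun X U)))) =
      Submodule.span Γ(X, V) (ratRes hVU '' T) := by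
    refine le_antisymm (Submodule.span_le.mpr ?_)
      (Submodule.span_mono (Set.image_mono Submodule.subset_span))
    rintro _ ⟨s, hs, rfl⟩
    exact ratRes_mem_span hVU hs
  rw [this]
  exact Submodule.fg_span (T.finite_toSet.image _)

theorem IsCoherentOn.basicOpen {U : X.Opens} (hU : IsAffineOpen U) (h : I.IsCoherentOn U)
    (f : Γ(X, U)) : I.IsCoherentOn (X.basicOpen f) := by
  constructor
  · refine fg_of_res (X.basicOpen_le f) h.fg (le_antisymm ?_ (Submodule.span_le.mpr ?_))
    · intro s hs
      obtain ⟨n, t, ht, e⟩ := h.exists_res_eq_smul f s hs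
      obtain ⟨w, hw⟩ := (isUnit_res_basicOpen f).pow n
      have : s = (↑w⁻¹ : Γ(X, X.basicOpen f)) • ratRes (X.basicOpen_le f) t := by
        rw [e, ← hw, smul_smul, Units.inv_mul, one_smul]
      rw [this]
      exact Submodule.smul_mem _ _ (Submodule.subset_span ⟨_, ht, rfl⟩)
    · rintro _ ⟨s, hs, rfl⟩
      exact I.res_mem _ hs
  · intro g s hs
    obtain ⟨k, a, ha⟩ := exists_res_eq_pow_mul hU f g
    have hle := X.basicOpen_le g
    -- with `a = fᵏ g` on `D(f)`, the open set `D(g) ⊆ D(f)` is `D(f a)`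
    have e : X.basicOpen g = X.basicOpen (f * a) := by
      have h1 : X.basicOpen (X.presheaf.map (homOfLE (X.basicOpen_le f)).op a) =
          X.basicOpen g := by
        rw [ha, X.basicOpen_mul, X.basicOpen_of_isUnit ((isUnit_res_basicOpen f).pow k)]
        exact inf_eq_right.mpr hle
      rw [X.basicOpen_mul, ← h1, X.basicOpen_res]
    obtain ⟨n, t, ht, ht'⟩ := h.exists_res_eq (f * a) e (hle.trans (X.basicOpen_le f)) s hs
    obtain ⟨w, hw⟩ := (isUnit_res_basicOpen f).pow (n + k * n)
    refine ⟨n, (↑w⁻¹ : Γ(X, X.basicOpen f)) • ratRes (X.basicOpen_le f) t,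
      Submodule.smul_mem _ _ (I.res_mem _ ht), ?_⟩
    rw [ratRes_smul, ratRes_ratRes, ht', smul_smul]
    congr 1
    have h2 : X.presheaf.map (homOfLE (hle.trans (X.basicOpen_le f))).op (f * a) =
        X.presheaf.map (homOfLE hle).op
          (X.presheaf.map (homOfLE (X.basicOpen_le f)).op (f * a)) := by
      rw [← ConcreteCategory.comp_apply, ← X.presheaf.map_comp]
      rfl
    have h3 : (↑w⁻¹ : Γ(X, X.basicOpen f)) *
        X.presheaf.map (homOfLE (X.basicOpen_le f)).op (f * a) ^ n = g ^ n := by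
      rw [map_mul, ha, mul_pow, mul_pow, ← pow_mul, ← mul_assoc (_ ^ n), ← pow_add, ← mul_assoc,
        ← hw, Units.inv_mul, one_mul]
    have h4 := congr_arg (X.presheaf.map (homOfLE hle).op) h3
    rw [h2]
    rwa [map_mul, map_pow, map_pow] at h4

end RatSubmodule

variable [IsLocallyNoetherian X]

/-- Membership in a submodule `N` of `𝒬_X(U)`, for `U` affine, can be checked locally in the
submodules generated by `N`. -/
theorem mem_of_local_mem_span {U : X.Opens} (hU : IsAffineOpen U)
    (N : Submodule Γ(X, U) (RatFun X U)) (s : RatFun X U)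
    (hs : ∀ x ∈ U, ∃ (V : X.Opens) (h : V ≤ U), x ∈ V ∧
      ratRes h s ∈ Submodule.span Γ(X, V) (ratRes h '' N)) : s ∈ N := by
  -- the ideal of all functions which multiply `s` into `N` is the unit ideal
  have key : (LinearMap.toSpanSingleton Γ(X, U) (RatFun X U) s ⁻¹' N : Set Γ(X, U)) = Set.univ := by
    have := ideal_eq_top_of_forall_mem hU (N.comap (LinearMap.toSpanSingleton Γ(X, U) _ s))
      fun x hx ↦ by
      obtain ⟨V, h, hxV, hV⟩ := hs x hx
      obtain ⟨g, hg, hxg⟩ := hU.exists_basicOpen_le ⟨x, hxV⟩ hx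
      refine ⟨g, hxg, ?_⟩
      have h1 := ratRes_mem_span hg hV
      rw [Set.image_image] at h1
      obtain ⟨n, m, hm, e⟩ := exists_res_eq_of_mem_span hU g N h1
      obtain ⟨k, hk⟩ := exists_pow_smul_eq_zero hU g (g ^ n • s - m) (by
        rw [map_sub, ratRes_smul, e, map_pow, ratRes_ratRes, sub_self])
      refine ⟨k + n, ?_⟩
      rw [smul_sub, sub_eq_zero, smul_smul, ← pow_add] at hk
      rw [Submodule.mem_comap, LinearMap.toSpanSingleton_apply, hk]
      exact Submodule.smul_mem _ _ hm
    exact congr_arg SetLike.coe this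
  have h1 : (1 : Γ(X, U)) ∈
      (LinearMap.toSpanSingleton Γ(X, U) (RatFun X U) s ⁻¹' N : Set Γ(X, U)) :=
    key ▸ Set.mem_univ _
  simpa using h1

namespace RatSubmodule

variable {I : RatSubmodule X}

theorem pow_mul_eq_pow_mul_of_le {R : Type*} [CommRing R] {a b b' : R} {m n n' m₀ n₀ : ℕ}
    (hm : m + n₀ + n₀ ≤ m₀) (hn : n ≤ n₀) (hn' : n' ≤ n₀)
    (h : a ^ (m + n') * b = a ^ (m + n) * b') :
    a ^ (m₀ + (n₀ - n)) * b = a ^ (m₀ + (n₀ - n')) * b' := by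
  have e1 : m₀ + (n₀ - n) = m₀ + n₀ - n - m - n' + (m + n') := by omega
  have e2 : m₀ + (n₀ - n') = m₀ + n₀ - n - m - n' + (m + n) := by omega
  rw [e1, e2, pow_add, pow_add _ _ (m + n), mul_assoc, mul_assoc, h]

/-- If `I` is coherent on the members of a finite cover of `U` by sets `D(f)`, then a section `s` of
`I` over `D(g)` extends to `U`, up to a power of `g`: first `s` extends to sections `t f` over the
sets `D(f)`, up to powers `n f` of `g`, and then these glue after multiplication by further powers
of `g`. -/
theorem exists_res_eq_smul_of_cover {U : X.Opens} (hU : IsAffineOpen U) (S : Finset Γ(X, U))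
    (hcov : ∀ x ∈ U, ∃ f : S, x ∈ X.basicOpen f.1)
    (h : ∀ f ∈ S, I.IsCoherentOn (X.basicOpen f)) (g : Γ(X, U)) (s : RatFun X (X.basicOpen g))
    (hs : s ∈ I.sections (X.basicOpen g)) :
    ∃ (n : ℕ) (t : RatFun X U), t ∈ I.sections U ∧ ratRes (X.basicOpen_le g) t =
      (X.presheaf.map (homOfLE (X.basicOpen_le g)).op g) ^ n • s := by
  have h1 (f : S) : ∃ (n : ℕ) (t : RatFun X (X.basicOpen f.1)),
      t ∈ I.sections (X.basicOpen f.1) ∧ ∀ (x : X) (hx : x ∈ X.basicOpen f.1)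
        (hg : x ∈ X.basicOpen g) (ha : x ∈ assPoints X),
        t.1 ⟨x, hx, ha⟩ = X.presheaf.germ U x (X.basicOpen_le g hg) g ^ n * s.1 ⟨x, hg, ha⟩ := by
    have e : X.basicOpen f.1 ⊓ X.basicOpen g =
        X.basicOpen (X.presheaf.map (homOfLE (X.basicOpen_le f.1)).op g) :=
      (X.basicOpen_res _ _).symm
    obtain ⟨n, t, ht, ht'⟩ := (h f.1 f.2).exists_res_eq
      (X.presheaf.map (homOfLE (X.basicOpen_le f.1)).op g) e inf_le_left
      (ratRes inf_le_right s) (I.res_mem _ hs)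
    refine ⟨n, t, ht, fun x hx hg ha ↦ ?_⟩
    have := congr_fun (congr_arg Subtype.val ht') ⟨x, ⟨hx, hg⟩, ha⟩
    rw [smul_ratFun_apply, map_pow, TopCat.Presheaf.germ_res_apply,
      TopCat.Presheaf.germ_res_apply] at this
    exact this
  choose n t ht ht' using h1
  have h2 (f f' : S) : ∃ m : ℕ, ∀ (x : X) (hx : x ∈ X.basicOpen f.1) (hx' : x ∈ X.basicOpen f'.1)
      (ha : x ∈ assPoints X), X.presheaf.germ U x (X.basicOpen_le _ hx) g ^ (m + n f') *
        (t f).1 ⟨x, hx, ha⟩ = X.presheaf.germ U x (X.basicOpen_le _ hx) g ^ (m + n f) *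
          (t f').1 ⟨x, hx', ha⟩ := by
    have hle1 : X.basicOpen (f.1 * f'.1) ≤ X.basicOpen f.1 := by
      rw [X.basicOpen_mul]; exact inf_le_left
    have hle2 : X.basicOpen (f.1 * f'.1) ≤ X.basicOpen f'.1 := by
      rw [X.basicOpen_mul]; exact inf_le_right
    let g' := X.presheaf.map (homOfLE (X.basicOpen_le (f.1 * f'.1))).op g
    have hg' : X.basicOpen g' ≤ X.basicOpen g := by
      rw [X.basicOpen_res]; exact inf_le_right
    obtain ⟨m, hm⟩ := exists_pow_smul_eq_zero (hU.basicOpen (f.1 * f'.1)) g'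
      (g' ^ n f' • ratRes hle1 (t f) - g' ^ n f • ratRes hle2 (t f')) (by
        rw [map_sub, sub_eq_zero]
        refine ratFun_ext fun x ↦ ?_
        have hx := X.basicOpen_le g' x.2.1
        rw [ratRes_apply, ratRes_apply, smul_ratFun_apply, smul_ratFun_apply, ratRes_apply,
          ratRes_apply, ht' f x.1 (hle1 hx) (hg' x.2.1) x.2.2,
          ht' f' x.1 (hle2 hx) (hg' x.2.1) x.2.2, map_pow, map_pow,
          TopCat.Presheaf.germ_res_apply]
        ring)
    refine ⟨m, fun x hx hx' ha ↦ ?_⟩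
    have hxx : x ∈ X.basicOpen (f.1 * f'.1) := by
      rw [X.basicOpen_mul]; exact ⟨hx, hx'⟩
    rw [smul_sub, sub_eq_zero] at hm
    have := congr_fun (congr_arg Subtype.val hm) ⟨x, hxx, ha⟩
    rw [smul_ratFun_apply, smul_ratFun_apply, smul_ratFun_apply, smul_ratFun_apply, map_pow,
      map_pow, map_pow, TopCat.Presheaf.germ_res_apply, ratRes_apply, ratRes_apply] at this
    rw [pow_add, pow_add, mul_assoc, mul_assoc]
    exact this
  choose m hm using h2
  -- multiply `t f` by `g` to the power `m₀ + (n₀ - n f)`, so that all of them become `s` times `g`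
  -- to the power `m₀ + n₀` on `D(g)`
  let n₀ := Finset.univ.sup n
  have hn₀ (f : S) : n f ≤ n₀ := Finset.le_sup (Finset.mem_univ f)
  let m₀ := Finset.univ.sup (fun p : S × S ↦ m p.1 p.2) + n₀ + n₀
  have hm₀ (f f' : S) : m f f' + n₀ + n₀ ≤ m₀ := by
    have := Finset.le_sup (f := fun p : S × S ↦ m p.1 p.2) (Finset.mem_univ (f, f'))
    exact Nat.add_le_add_right (Nat.add_le_add_right this _) _
  obtain ⟨T, hT⟩ := exists_ratFun_glue (fun f : S ↦ X.basicOpen f.1)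
    (fun f ↦ X.basicOpen_le f.1) hcov (fun f ↦
      X.presheaf.map (homOfLE (X.basicOpen_le f.1)).op (g ^ (m₀ + (n₀ - n f))) • t f)
    fun f f' x hx hx' ha ↦ by
      rw [smul_ratFun_apply, smul_ratFun_apply, TopCat.Presheaf.germ_res_apply,
        TopCat.Presheaf.germ_res_apply, map_pow, map_pow]
      exact pow_mul_eq_pow_mul_of_le (hm₀ f f') (hn₀ f) (hn₀ f') (hm f f' x hx hx' ha)
  refine ⟨m₀ + n₀, T, I.mem_of_iSup _ (fun f : S ↦ X.basicOpen_le f.1) hcov fun f ↦ ?_, ?_⟩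
  · rw [hT f]
    exact Submodule.smul_mem _ _ (ht f)
  · refine ratFun_ext fun x ↦ ?_
    obtain ⟨f, hf⟩ := hcov x.1 (X.basicOpen_le g x.2.1)
    have := congr_fun (congr_arg Subtype.val (hT f)) ⟨x.1, hf, x.2.2⟩
    rw [smul_ratFun_apply, TopCat.Presheaf.germ_res_apply, ht' f x.1 hf x.2.1 x.2.2,
      map_pow, ← mul_assoc, ← pow_add, add_assoc, Nat.sub_add_cancel (hn₀ f)] at this
    rw [smul_ratFun_apply, map_pow, TopCat.Presheaf.germ_res_apply]
    exact this

theorem IsCoherentOn.of_cover {U : X.Opens} (hU : IsAffineOpen U) (S : Finset Γ(X, U))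
    (hS : Ideal.span (S : Set Γ(X, U)) = ⊤) (h : ∀ f ∈ S, I.IsCoherentOn (X.basicOpen f)) :
    I.IsCoherentOn U := by
  have hcov (x : X) (hx : x ∈ U) : ∃ f : S, x ∈ X.basicOpen f.1 := by
    have := (hU.self_le_iSup_basicOpen_iff (s := S)).mpr hS hx
    exact TopologicalSpace.Opens.mem_iSup.mp this
  have hext := exists_res_eq_smul_of_cover hU S hcov h
  refine ⟨?_, hext⟩
  have h3 (f : S) := exists_fg_le_of_fg f.1 (h f.1 f.2).fg (hext f.1)
  choose N hN hle hle' using h3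
  have : I.sections U = ⨆ f, N f := by
    refine le_antisymm (fun s hs ↦ ?_) (iSup_le hle)
    refine mem_of_local_mem_span hU _ s fun x hx ↦ ?_
    obtain ⟨f, hf⟩ := hcov x hx
    refine ⟨X.basicOpen f.1, X.basicOpen_le f.1, hf,
      Submodule.span_mono (Set.image_mono (le_iSup N f)) (hle' f (I.res_mem _ hs))⟩
  rw [this]
  exact Submodule.fg_iSup _ hN

/-- Coherence of a submodule of `𝒬_X` can be checked on an affine open cover. -/
theorem isCoherent_of_cover (h : ∀ x : X, ∃ U : X.Opens, IsAffineOpen U ∧ x ∈ U ∧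
    I.IsCoherentOn U) : I.IsCoherent := by
  choose V hV hxV hI using h
  have key (U : X.affineOpens) : I.IsCoherentOn U := by
    refine of_affine_open_cover (P := fun U ↦ I.IsCoherentOn U.1) (fun x ↦ ⟨V x, hV x⟩) ?_ U
      (fun U f h ↦ h.basicOpen U.2 f) (fun U S hS h ↦ .of_cover U.2 S hS fun f hf ↦ h ⟨f, hf⟩) hI
    exact top_le_iff.mp fun x _ ↦ TopologicalSpace.Opens.mem_iSup.mpr ⟨x, hxV x⟩
  exact ⟨fun {U} hU ↦ (key ⟨U, hU⟩).fg,
    fun hU g s _ hs ↦ exists_pow_smul_eq_zero hU g s hs,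
    fun {U} hU g ↦ (key ⟨U, hU⟩).exists_res_eq_smul g⟩

end RatSubmodule

end CoherentSubmodules

/-! ### Submodules which have a rank -/

section Rank

variable {X : Scheme.{u}}

namespace RatSubmodule

/-- A submodule of `𝒬_X` which is `𝒬_X` at every associated point. -/
def IsFull (I : RatSubmodule X) : Prop :=
  ∀ (x : X) (hx : x ∈ assPoints X), ∃ (U : X.Opens) (h : x ∈ U) (s : RatFun X U),
    s ∈ I.sections U ∧ IsUnit (s.1 ⟨x, h, hx⟩)

/-- The submodule is zero. -/
def IsZero (I : RatSubmodule X) : Prop := ∀ U, ∀ s ∈ I.sections U, s = 0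

theorem IsZero.hasRank {I : RatSubmodule X} (h : I.IsZero) : I.HasRank := by
  refine ⟨0, fun x hx ↦ ?_⟩
  have : Subsingleton (I.stalk hx) := by
    have h0 (a : I.stalk hx) : a = 0 := by
      obtain ⟨_, U, hU, s, hs, rfl⟩ := a
      apply Subtype.ext
      change s.1 _ = 0
      rw [h U s hs]
      rfl
    exact ⟨fun a b ↦ (h0 a).trans (h0 b).symm⟩
  exact ⟨LinearEquiv.ofSubsingleton _ _⟩

theorem IsFull.hasRank {I : RatSubmodule X} (h : I.IsFull) : I.HasRank := by
  refine ⟨1, fun x hx ↦ ?_⟩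
  obtain ⟨U, hU, s, hs, hu⟩ := h x hx
  have : I.stalk hx = ⊤ := Ideal.eq_top_of_isUnit_mem (I.stalk hx) ⟨U, hU, s, hs, rfl⟩ hu
  rw [this]
  exact ⟨Submodule.topEquiv.trans (LinearEquiv.funUnique (Fin 1) _ _).symm⟩

theorem isFull_of_isUnit {I : RatSubmodule X} (h : ∀ x : X, ∃ (U : X.Opens) (s : RatFun X U),
    x ∈ U ∧ s ∈ I.sections U ∧ IsUnit s) : I.IsFull := fun x hx ↦ by
  obtain ⟨U, s, hxU, hs, hu⟩ := h x
  exact ⟨U, hxU, s, hs, isUnit_ratFun_apply hu _⟩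

theorem res_mem_of_smul_mem {I : RatSubmodule X} {U : X.Opens} {g : Γ(X, U)} {n : ℕ}
    {s : RatFun X (X.basicOpen g)} (h : X.presheaf.map (homOfLE (X.basicOpen_le g)).op g ^ n • s ∈
      I.sections (X.basicOpen g)) : s ∈ I.sections (X.basicOpen g) := by
  obtain ⟨w, hw⟩ := (isUnit_res_basicOpen g).pow n
  have : s = (↑w⁻¹ : Γ(X, X.basicOpen g)) •
      (X.presheaf.map (homOfLE (X.basicOpen_le g)).op g ^ n • s) := by
    rw [← hw, smul_smul, Units.inv_mul, one_smul]
  rw [this]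
  exact Submodule.smul_mem _ _ h

/-- An inclusion of a coherent submodule can be checked on an affine open cover. -/
theorem sections_le_of_cover {I I' : RatSubmodule X} (hI : I.IsCoherent)
    (h : ∀ x : X, ∃ V : X.Opens, IsAffineOpen V ∧ x ∈ V ∧ I.sections V ≤ I'.sections V)
    (U : X.Opens) : I.sections U ≤ I'.sections U := by
  intro s hs
  refine I'.mem_of_local s fun x hx ↦ ?_
  obtain ⟨V, hV, hxV, hle⟩ := h x
  obtain ⟨g, hg, hxg⟩ := hV.exists_basicOpen_le ⟨x, hx⟩ hxV
  obtain ⟨n, t, ht, e⟩ := hI.exists_res_eq_smul hV g _ (I.res_mem hg hs)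
  refine ⟨X.basicOpen g, hg, hxg, res_mem_of_smul_mem (n := n) ?_⟩
  rw [← e]
  exact I'.res_mem _ (hle ht)

variable [IsLocallyNoetherian X]

/-- At an associated point `x`, the free submodules of `𝒪_{X,x}` are `0` and `𝒪_{X,x}`, because
every regular element of `𝒪_{X,x}` is a unit. -/
theorem HasRank.isZero_or_isFull {I : RatSubmodule X} (h : I.HasRank) : I.IsZero ∨ I.IsFull := by
  obtain ⟨r, hr⟩ := h
  rcases r with _ | r
  · refine .inl fun U s hs ↦ ratFun_ext fun x ↦ ?_
    obtain ⟨e⟩ := hr x.1 x.2.2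
    have : (⟨s.1 x, U, x.2.1, s, hs, rfl⟩ : I.stalk x.2.2) = 0 :=
      e.injective (Subsingleton.elim _ _)
    exact congr_arg Subtype.val this
  · refine .inr fun x hx ↦ ?_
    obtain ⟨e⟩ := hr x hx
    obtain ⟨U, hU, s, hs, h⟩ := (e.symm (Pi.single 0 1)).2
    refine ⟨U, hU, s, hs, isUnit_of_mem_nonZeroDivisors_stalk hx ?_⟩
    rw [h, mem_nonZeroDivisors_iff_right]
    intro z hz
    have h0 : z • e.symm (Pi.single 0 1) = 0 := Subtype.ext hz
    have h1 := congr_fun (congr_arg e h0) 0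
    rwa [map_smul, e.apply_symm_apply, map_zero, Pi.smul_apply, Pi.single_eq_same, smul_eq_mul,
      mul_one] at h1

/-- A full coherent submodule has a section over each affine open set which is a unit of `𝒬_X`: its
intersection with `𝒪_X` is an ideal which is the unit ideal at each associated point. -/
theorem IsFull.exists_isUnit {I : RatSubmodule X} (h : I.IsFull) (hc : I.IsCoherent)
    {U : X.Opens} (hU : IsAffineOpen U) : ∃ s ∈ I.sections U, IsUnit s := by
  obtain ⟨b, hb, hb'⟩ := exists_mem_nonZeroDivisors hU
    ((I.sections U).comap (Algebra.linearMap Γ(X, U) (RatFun X U))) fun x ↦ by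
      obtain ⟨V, hxV, s, hs, hu⟩ := h x.1 x.2.2
      obtain ⟨g, hg, hxg⟩ := hU.exists_basicOpen_le ⟨x.1, hxV⟩ x.2.1
      obtain ⟨n, t, ht, e⟩ := hc.exists_res_eq_smul hU g (ratRes hg s) (I.res_mem hg hs)
      obtain ⟨c, hc, a, ha⟩ := exists_smul_eq_algebraMap hU t
      refine ⟨a, ?_, ?_⟩
      · rw [Submodule.mem_comap, Algebra.linearMap_apply, ← ha]
        exact Submodule.smul_mem _ _ ht
      · have h1 := congr_fun (congr_arg Subtype.val ha) x
        rw [smul_ratFun_apply, algebraMap_ratFun_apply] at h1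
        rw [← h1]
        refine (isUnit_germ_of_mem_nonZeroDivisors hU hc x).mul ?_
        have h2 := congr_fun (congr_arg Subtype.val e) ⟨x.1, hxg, x.2.2⟩
        rw [smul_ratFun_apply, map_pow, ratRes_apply, ratRes_apply] at h2
        rw [h2]
        exact (((isUnit_res_basicOpen g).map (X.presheaf.germ _ x.1 hxg).hom).pow n).mul hu
  exact ⟨_, hb, isUnit_algebraMap_ratFun hU hb'⟩

end RatSubmodule

end Rank

/-! ### Quotients of submodules of the sheaf of rational functions -/

section Colon

variable {X : Scheme.{u}}

namespace RatSubmodule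

/-- The submodule of all rational functions which multiply `P` into `I`. -/
def colon (I P : RatSubmodule X) : RatSubmodule X where
  sections U :=
    { carrier := {q | ∀ (V : X.Opens) (h : V ≤ U), ∀ p ∈ P.sections V,
        ratRes h q * p ∈ I.sections V}
      add_mem' := fun {s t} hs ht V h p hp ↦ by
        rw [map_add, add_mul]
        exact add_mem (hs V h p hp) (ht V h p hp)
      zero_mem' := fun V h p hp ↦ by
        rw [map_zero, zero_mul]
        exact zero_mem _
      smul_mem' := fun a s hs V h p hp ↦ by
        rw [ratRes_smul, smul_mul_assoc]
        exact Submodule.smul_mem _ _ (hs V h p hp) }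
  res_mem h s hs V h' p hp := hs V (h'.trans h) p hp
  mem_of_local {U} s hs V h p hp := by
    refine I.mem_of_local _ fun x hx ↦ ?_
    obtain ⟨W, hW, hxW, hs'⟩ := hs x (h hx)
    refine ⟨W ⊓ V, inf_le_right, ⟨hxW, hx⟩, ?_⟩
    rw [map_mul]
    exact hs' (W ⊓ V) inf_le_left _ (P.res_mem _ hp)

variable {I P : RatSubmodule X}

/-- If `P` is coherent, then membership in `(I : P)` over an affine open set `U` can be tested on
the sections of `P` over `U`. -/
theorem mem_colon_of_affine (hP : P.IsCoherent) {U : X.Opens} (hU : IsAffineOpen U)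
    {q : RatFun X U} (hq : ∀ p ∈ P.sections U, q * p ∈ I.sections U) :
    q ∈ (I.colon P).sections U := by
  intro V h p hp
  refine I.mem_of_local _ fun x hx ↦ ?_
  obtain ⟨g, hg, hxg⟩ := hU.exists_basicOpen_le ⟨x, hx⟩ (h hx)
  obtain ⟨n, t, ht, e⟩ := hP.exists_res_eq_smul hU g _ (P.res_mem hg hp)
  refine ⟨X.basicOpen g, hg, hxg, res_mem_of_smul_mem (n := n) ?_⟩
  rw [map_mul, ← mul_smul_comm, ← e, ratRes_ratRes, ← map_mul]
  exact I.res_mem _ (hq t ht)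

variable [IsLocallyNoetherian X]

/-- Multiplication by a unit `p` in `P` embeds `(I : P)` into `I`, hence `(I : P)` is finitely
generated. It is compatible with localization because `P` is finitely generated. -/
theorem isCoherent_colon (hI : I.IsCoherent) (hP : P.IsCoherent) (hP' : P.IsFull) :
    (I.colon P).IsCoherent := by
  refine ⟨fun {U} hU ↦ ?_, fun hU g s _ hs ↦ exists_pow_smul_eq_zero hU g s hs,
    fun {U} hU g s hs ↦ ?_⟩
  · have : IsNoetherianRing Γ(X, U) := IsLocallyNoetherian.component_noetherian ⟨U, hU⟩
    obtain ⟨p, hp, hu⟩ := hP'.exists_isUnit hP hU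
    refine Submodule.fg_of_fg_map_injective (LinearMap.mulRight Γ(X, U) p)
      (fun a b h ↦ hu.mul_right_cancel h) ?_
    have : IsNoetherian Γ(X, U) (I.sections U) := isNoetherian_of_fg_of_noetherian _ (hI.fg hU)
    refine isNoetherian_submodule.mp this _ ?_
    rintro _ ⟨q, hq, rfl⟩
    exact hq U le_rfl p hp
  · obtain ⟨p, hp, hu⟩ := hP'.exists_isUnit hP hU
    obtain ⟨n, i, hi, e⟩ := hI.exists_res_eq_smul hU g _ (hs _ le_rfl _ (P.res_mem _ hp))
    obtain ⟨w, rfl⟩ := hu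
    -- on `D(g)`, the rational function `i / p` is `s` up to a power of `g`
    have hT : ratRes (X.basicOpen_le g) (i * ↑w⁻¹) =
        X.presheaf.map (homOfLE (X.basicOpen_le g)).op g ^ n • s := by
      rw [map_mul, e, smul_mul_assoc, ratRes_self, mul_assoc, ← map_mul, Units.mul_inv, map_one,
        mul_one]
    have hk : ∀ q ∈ P.sections U, ∃ m : ℕ, g ^ m • (i * ↑w⁻¹ * q) ∈ I.sections U := by
      intro q hq
      obtain ⟨m, t, ht, e'⟩ := hI.exists_res_eq_smul hU g
        (ratRes (X.basicOpen_le g) (i * ↑w⁻¹ * q)) (by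
          rw [map_mul, hT, smul_mul_assoc]
          exact Submodule.smul_mem _ _ (hs _ le_rfl _ (P.res_mem _ hq)))
      obtain ⟨l, hl⟩ := exists_pow_smul_eq_zero hU g (g ^ m • (i * ↑w⁻¹ * q) - t) (by
        rw [map_sub, ratRes_smul, e', map_pow, sub_self])
      refine ⟨l + m, ?_⟩
      rw [smul_sub, sub_eq_zero, smul_smul, ← pow_add] at hl
      rw [hl]
      exact Submodule.smul_mem _ _ ht
    obtain ⟨m, hm⟩ : ∃ m : ℕ, ∀ q ∈ P.sections U, g ^ m • (i * ↑w⁻¹ * q) ∈ I.sections U := by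
      obtain ⟨S, hS⟩ := hP.fg hU
      choose m hm using fun q : S ↦ hk q.1 (hS ▸ Submodule.subset_span q.2)
      refine ⟨Finset.univ.sup m, fun q hq ↦ ?_⟩
      rw [← hS] at hq
      induction hq using Submodule.span_induction with
      | mem q hq =>
        have : m ⟨q, hq⟩ ≤ Finset.univ.sup m := Finset.le_sup (Finset.mem_univ _)
        rw [← Nat.sub_add_cancel this, pow_add, mul_smul]
        exact Submodule.smul_mem _ _ (hm ⟨q, hq⟩)
      | zero => rw [mul_zero, smul_zero]; exact zero_mem _
      | add x y _ _ hx hy => rw [mul_add, smul_add]; exact add_mem hx hy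
      | smul a x _ hx =>
        rw [mul_smul_comm, smul_comm]
        exact Submodule.smul_mem _ _ hx
    refine ⟨m + n, g ^ m • (i * ↑w⁻¹), mem_colon_of_affine hP hU fun q hq ↦ ?_, ?_⟩
    · rw [smul_mul_assoc]
      exact hm q hq
    · rw [ratRes_smul, hT, smul_smul, map_pow, pow_add]

/-- A common denominator of generators of `P`, multiplied by a unit in `I`, is a unit in
`(I : P)`. -/
theorem isFull_colon (hI : I.IsCoherent) (hP : P.IsCoherent) (hI' : I.IsFull) :
    (I.colon P).IsFull := by
  refine isFull_of_isUnit fun x ↦ ?_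
  obtain ⟨U, hU, -, hxU⟩ := exists_affine_le (⊤ : X.Opens) (x := x) trivial
  obtain ⟨i, hi, hu⟩ := hI'.exists_isUnit hI hU
  obtain ⟨b, hb, hb'⟩ : ∃ b ∈ nonZeroDivisors Γ(X, U), ∀ p ∈ P.sections U,
      ∃ a, b • p = algebraMap Γ(X, U) (RatFun X U) a := by
    obtain ⟨S, hS⟩ := hP.fg hU
    choose b hb a ha using fun s : S ↦ exists_smul_eq_algebraMap hU s.1
    refine ⟨∏ s, b s, prod_mem fun s _ ↦ hb s, fun q hq ↦ ?_⟩
    rw [← hS] at hq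
    induction hq using Submodule.span_induction with
    | mem q hq =>
      obtain ⟨c, hc⟩ := Finset.dvd_prod_of_mem b (Finset.mem_univ ⟨q, hq⟩)
      exact ⟨c * a ⟨q, hq⟩, by rw [hc, mul_comm, mul_smul, ha ⟨q, hq⟩, map_mul, Algebra.smul_def]⟩
    | zero => exact ⟨0, by rw [smul_zero, map_zero]⟩
    | add x y _ _ hx hy =>
      obtain ⟨c, hc⟩ := hx
      obtain ⟨d, hd⟩ := hy
      exact ⟨c + d, by rw [smul_add, hc, hd, map_add]⟩
    | smul d x _ hx =>
      obtain ⟨c, hc⟩ := hx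
      exact ⟨d * c, by rw [smul_comm, hc, map_mul, Algebra.smul_def]⟩
  refine ⟨U, b • i, hxU, mem_colon_of_affine hP hU fun p hp ↦ ?_, ?_⟩
  · obtain ⟨a, ha⟩ := hb' p hp
    rw [smul_mul_assoc, ← mul_smul_comm, ha, mul_comm, ← Algebra.smul_def]
    exact Submodule.smul_mem _ _ hi
  · rw [Algebra.smul_def]
    exact (isUnit_algebraMap_ratFun hU hb).mul hu

/-- A rational function is determined by the multiplication with a full submodule. -/
theorem IsFull.ratFun_ext (hP : P.IsCoherent) (hP' : P.IsFull) {U : X.Opens} {q q' : RatFun X U}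
    (h : ∀ (V : X.Opens) (hV : V ≤ U), IsAffineOpen V → ∀ p ∈ P.sections V,
      ratRes hV q * p = ratRes hV q' * p) : q = q' := by
  refine ratFun_ext_of_local fun x hx ↦ ?_
  obtain ⟨V, hV, hle, hxV⟩ := exists_affine_le U hx
  obtain ⟨p, hp, hu⟩ := hP'.exists_isUnit hP hV
  exact ⟨V, hle, hxV, hu.mul_right_cancel (h V hle hV p hp)⟩

theorem isZero_colon (hP : P.IsCoherent) (hP' : P.IsFull) (hI : I.IsZero) :
    (I.colon P).IsZero := by
  intro U q hq
  refine hP'.ratFun_ext hP fun V hV _ p hp ↦ ?_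
  rw [hI V _ (hq V hV p hp), map_zero, zero_mul]

end RatSubmodule

end Colon

/-! ### Direct images under bifractional morphisms -/

section DirectImage

variable {X Y : Scheme.{u}} {f : Y ⟶ X}

namespace RatComorphism

variable (θ : RatComorphism f)

theorem app_smul (U : X.Opens) (a : Γ(X, U)) (s : RatFun X U) :
    θ.app U (a • s) = f.app U a • θ.app U s := by
  rw [Algebra.smul_def, map_mul, θ.app_algebraMap, ← Algebra.smul_def]

variable {θ} (hθ : θ.IsIso)

/-- The isomorphism `𝒬_X(U) ≅ 𝒬_Y(f⁻¹ U)` for a bifractional morphism `f`. -/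
noncomputable def equiv (U : X.Opens) : RatFun X U ≃+* RatFun Y (f ⁻¹ᵁ U) :=
  RingEquiv.ofBijective (θ.app U) (hθ U)

theorem app_equiv_symm (U : X.Opens) (s : RatFun Y (f ⁻¹ᵁ U)) :
    θ.app U ((equiv hθ U).symm s) = s := (equiv hθ U).apply_symm_apply s

theorem equiv_symm_app (U : X.Opens) (s : RatFun X U) :
    (equiv hθ U).symm (θ.app U s) = s := (equiv hθ U).symm_apply_apply s

theorem ratRes_equiv_symm {U V : X.Opens} (h : U ≤ V) (s : RatFun Y (f ⁻¹ᵁ V)) :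
    ratRes h ((equiv hθ V).symm s) = (equiv hθ U).symm (ratRes (f.preimage_mono h) s) := by
  apply (hθ U).injective
  rw [θ.app_res, app_equiv_symm, app_equiv_symm]

/-- The functions on `f⁻¹ U`, as rational functions on `U`. -/
noncomputable def functionHom (U : X.Opens) : Γ(Y, f ⁻¹ᵁ U) →+* RatFun X U :=
  (equiv hθ U).symm.toRingHom.comp (algebraMap _ _)

theorem app_functionHom (U : X.Opens) (b : Γ(Y, f ⁻¹ᵁ U)) :
    θ.app U (functionHom hθ U b) = algebraMap _ _ b := app_equiv_symm hθ U _

theorem app_functionHom_mul (U : X.Opens) (b : Γ(Y, f ⁻¹ᵁ U)) (s : RatFun X U) :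
    θ.app U (functionHom hθ U b * s) = b • θ.app U s := by
  rw [map_mul, app_functionHom, Algebra.smul_def]

theorem functionHom_comp (U : X.Opens) :
    (functionHom hθ U).comp (f.app U).hom = algebraMap Γ(X, U) (RatFun X U) := by
  ext1 a
  apply (hθ U).injective
  rw [RingHom.comp_apply, app_functionHom, θ.app_algebraMap]

theorem ratRes_functionHom {U V : X.Opens} (h : U ≤ V) (b : Γ(Y, f ⁻¹ᵁ V)) :
    ratRes h (functionHom hθ V b) =
      functionHom hθ U (Y.presheaf.map (homOfLE (f.preimage_mono h)).op b) := by
  apply (hθ U).injective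
  rw [θ.app_res, app_functionHom, app_functionHom, ratRes_algebraMap]

theorem functionHom_injective [IsLocallyNoetherian Y] (U : X.Opens) :
    Function.Injective (functionHom hθ U) :=
  (equiv hθ U).symm.injective.comp (algebraMap_ratFun_injective _)

end RatComorphism

open RatComorphism

theorem app_res {U V : X.Opens} (h : V ≤ U) (a : Γ(X, U)) :
    f.app V (X.presheaf.map (homOfLE h).op a) =
      Y.presheaf.map (homOfLE (f.preimage_mono h)).op (f.app U a) := by
  have := f.naturality (homOfLE h).op
  exact congr($this a)

namespace RatSubmodule

theorem IsCoherent.isCoherentOn {I : RatSubmodule X} (hI : I.IsCoherent) {U : X.Opens}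
    (hU : IsAffineOpen U) : I.IsCoherentOn U := ⟨hI.fg hU, hI.exists_res_eq_smul hU⟩

variable {θ : RatComorphism f} {J : RatSubmodule Y}

theorem mem_pushforward {U : X.Opens} {s : RatFun X U} :
    s ∈ (θ.pushforward J).sections U ↔ θ.app U s ∈ J.sections (f ⁻¹ᵁ U) := Iff.rfl

/-- The direct image is a module over the functions of `Y`. -/
theorem functionHom_mul_mem_pushforward (hθ : θ.IsIso) {U : X.Opens} (b : Γ(Y, f ⁻¹ᵁ U))
    {s : RatFun X U} (hs : s ∈ (θ.pushforward J).sections U) :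
    functionHom hθ U b * s ∈ (θ.pushforward J).sections U := by
  rw [mem_pushforward, app_functionHom_mul]
  exact Submodule.smul_mem _ _ hs

variable [IsFinite f]

/-- If `N` is a finitely generated module over the functions on `f⁻¹ U`, then it is finitely
generated over the functions on `U`, because `f` is finite. -/
theorem fg_of_forall_mem_iff (hθ : θ.IsIso) {U : X.Opens} (hU : IsAffineOpen U)
    {N : Submodule Γ(X, U) (RatFun X U)} {N' : Submodule Γ(Y, f ⁻¹ᵁ U) (RatFun Y (f ⁻¹ᵁ U))}
    (h : ∀ s, s ∈ N ↔ θ.app U s ∈ N') (hN' : N'.FG) : N.FG := by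
  algebraize [(f.app U).hom]
  have hfin : Module.Finite Γ(X, U) Γ(Y, f ⁻¹ᵁ U) := f.finite_app U hU
  obtain ⟨T, hT⟩ := hfin.fg_top
  obtain ⟨S, rfl⟩ := hN'
  have key : N = Submodule.span Γ(X, U) (Set.image2 (fun b s ↦ (equiv hθ U).symm (b • s))
      (T : Set Γ(Y, f ⁻¹ᵁ U)) (S : Set (RatFun Y (f ⁻¹ᵁ U)))) := by
    apply le_antisymm
    · intro s hs
      rw [h] at hs
      have h1 : ∀ t ∈ Submodule.span Γ(Y, f ⁻¹ᵁ U) (S : Set (RatFun Y (f ⁻¹ᵁ U))),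
          ∀ b : Γ(Y, f ⁻¹ᵁ U), (equiv hθ U).symm (b • t) ∈
          Submodule.span Γ(X, U) (Set.image2 (fun b s ↦ (equiv hθ U).symm (b • s))
            (T : Set Γ(Y, f ⁻¹ᵁ U)) (S : Set (RatFun Y (f ⁻¹ᵁ U)))) := by
        intro t ht
        induction ht using Submodule.span_induction with
        | mem t ht =>
          intro b
          have hb : b ∈ Submodule.span Γ(X, U) (T : Set Γ(Y, f ⁻¹ᵁ U)) := by
            rw [hT]; exact Submodule.mem_top
          induction hb using Submodule.span_induction with
          | mem b hb => exact Submodule.subset_span ⟨b, hb, t, ht, rfl⟩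
          | zero => rw [zero_smul, map_zero]; exact zero_mem _
          | add x y _ _ hx hy => rw [add_smul, map_add]; exact add_mem hx hy
          | smul a x _ hx =>
            have : (equiv hθ U).symm ((a • x) • t) = a • (equiv hθ U).symm (x • t) := by
              apply (hθ U).injective
              rw [app_smul, app_equiv_symm, app_equiv_symm, smul_smul]
              rfl
            rw [this]
            exact Submodule.smul_mem _ _ hx
        | zero => intro b; rw [smul_zero, map_zero]; exact zero_mem _
        | add x y _ _ hx hy =>
          intro b; rw [smul_add, map_add]; exact add_mem (hx b) (hy b)
        | smul c x _ hx => intro b; rw [smul_smul]; exact hx _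
      have h2 := h1 _ hs 1
      rwa [one_smul, equiv_symm_app] at h2
    · rw [Submodule.span_le]
      rintro _ ⟨b, -, s, hs, rfl⟩
      rw [SetLike.mem_coe, h, app_equiv_symm]
      exact Submodule.smul_mem _ _ (Submodule.subset_span hs)
  rw [key]
  exact Submodule.fg_span (Set.Finite.image2 _ T.finite_toSet S.finite_toSet)

theorem IsCoherent.pushforward [IsLocallyNoetherian X] (hθ : θ.IsIso) (hJ : J.IsCoherent) :
    (θ.pushforward J).IsCoherent := by
  refine ⟨fun {U} hU ↦ fg_of_forall_mem_iff hθ hU (fun s ↦ mem_pushforward)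
    (hJ.fg (hU.preimage f)), fun hU g s _ hs ↦ exists_pow_smul_eq_zero hU g s hs,
    fun {U} hU g s hs ↦ ?_⟩
  obtain ⟨n, t, ht, e⟩ := (hJ.isCoherentOn (hU.preimage f)).exists_res_eq (f.app U g)
    (f.preimage_basicOpen g) (f.preimage_mono (X.basicOpen_le g)) _ hs
  refine ⟨n, (equiv hθ U).symm t, ?_, ?_⟩
  · rwa [mem_pushforward, app_equiv_symm]
  · apply (hθ _).injective
    rw [app_smul, θ.app_res, app_equiv_symm, e, map_pow, app_res]

theorem IsFull.pushforward [IsLocallyNoetherian Y] (hθ : θ.IsIso) (hJ : J.IsCoherent)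
    (hJ' : J.IsFull) : (θ.pushforward J).IsFull := by
  refine isFull_of_isUnit fun x ↦ ?_
  obtain ⟨U, hU, -, hxU⟩ := exists_affine_le (⊤ : X.Opens) (x := x) trivial
  obtain ⟨j, hj, hu⟩ := hJ'.exists_isUnit hJ (hU.preimage f)
  refine ⟨U, (equiv hθ U).symm j, hxU, ?_, hu.map (equiv hθ U).symm⟩
  rwa [mem_pushforward, app_equiv_symm]

end RatSubmodule

end DirectImage

/-! ### The submodule generated on the source of a bifractional morphism -/

section Extension

variable {X Y : Scheme.{u}} {f : Y ⟶ X} {θ : RatComorphism f}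

open RatComorphism

namespace RatSubmodule

variable (θ) in
/-- The `𝒪_Y`-submodule of `𝒬_Y` generated by a submodule `C` of `𝒬_X`. -/
noncomputable def extend (C : RatSubmodule X) : RatSubmodule Y :=
  ofPresheaf (fun D ↦ Submodule.span Γ(Y, D) {t | ∃ (U : X.Opens) (h : D ≤ f ⁻¹ᵁ U)
    (c : RatFun X U), c ∈ C.sections U ∧ t = ratRes h (θ.app U c)}) fun {D D'} h s hs ↦ by
      refine Submodule.span_mono ?_ (ratRes_mem_span h hs)
      rintro _ ⟨_, ⟨U, hU, c, hc, rfl⟩, rfl⟩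
      exact ⟨U, h.trans hU, c, hc, rfl⟩

variable {C : RatSubmodule X}

theorem app_mem_extend {U : X.Opens} {c : RatFun X U} (hc : c ∈ C.sections U) :
    θ.app U c ∈ (C.extend θ).sections (f ⁻¹ᵁ U) :=
  fun _ hx ↦ ⟨_, le_rfl, hx, Submodule.subset_span ⟨U, le_rfl, c, hc, rfl⟩⟩

theorem IsZero.extend (hC : C.IsZero) : (C.extend θ).IsZero := by
  intro D s hs
  refine ratFun_ext_of_local fun y hy ↦ ?_
  obtain ⟨V, h, hyV, hV⟩ := hs y hy
  refine ⟨V, h, hyV, ?_⟩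
  rw [map_zero]
  generalize ratRes h s = t at hV
  induction hV using Submodule.span_induction with
  | mem t ht =>
    obtain ⟨U, hU, c, hc, rfl⟩ := ht
    rw [hC U c hc, map_zero, map_zero]
  | zero => rfl
  | add x y _ _ hx hy => rw [hx, hy, add_zero]
  | smul a x _ hx => rw [hx, smul_zero]

theorem IsFull.extend [IsLocallyNoetherian X] (hC : C.IsCoherent) (hC' : C.IsFull) :
    (C.extend θ).IsFull := by
  refine isFull_of_isUnit fun y ↦ ?_
  obtain ⟨U, hU, -, hyU⟩ := exists_affine_le (⊤ : X.Opens) (x := f y) trivial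
  obtain ⟨c, hc, hu⟩ := hC'.exists_isUnit hC hU
  exact ⟨f ⁻¹ᵁ U, θ.app U c, hyU, app_mem_extend hc, hu.map _⟩

/-- Near each point, the submodule generated by `C` is generated by the sections of `C` over any
affine open set `U` whose inverse image contains the point. -/
theorem exists_res_mem_span_of_mem_extend (hC : C.IsCoherent) {U : X.Opens} (hU : IsAffineOpen U)
    {D : Y.Opens} (hD : D ≤ f ⁻¹ᵁ U) {s : RatFun Y D} (hs : s ∈ (C.extend θ).sections D) {y : Y}
    (hy : y ∈ D) : ∃ (V : Y.Opens) (h : V ≤ D), y ∈ V ∧ ratRes h s ∈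
      Submodule.span Γ(Y, V) (ratRes (h.trans hD) '' (θ.app U '' C.sections U)) := by
  obtain ⟨W, hWD, hyW, hW⟩ := hs y hy
  suffices H : ∃ (V : Y.Opens) (h : V ≤ W), y ∈ V ∧ ratRes h (ratRes hWD s) ∈
      Submodule.span Γ(Y, V) (ratRes ((h.trans hWD).trans hD) '' (θ.app U '' C.sections U)) by
    obtain ⟨V, h, hyV, hV⟩ := H
    exact ⟨V, h.trans hWD, hyV, hV⟩
  have hres {V V' : Y.Opens} (h : V' ≤ V) (hV : V ≤ f ⁻¹ᵁ U) {t : RatFun Y V}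
      (ht : t ∈ Submodule.span Γ(Y, V) (ratRes hV '' (θ.app U '' C.sections U))) :
      ratRes h t ∈ Submodule.span Γ(Y, V') (ratRes (h.trans hV) '' (θ.app U '' C.sections U)) := by
    have := ratRes_mem_span h ht
    rwa [Set.image_image] at this
  generalize ratRes hWD s = t at hW
  induction hW using Submodule.span_induction with
  | mem t ht =>
    obtain ⟨U', hU', c, hc, rfl⟩ := ht
    obtain ⟨g, hg, hyg⟩ := hU.exists_basicOpen_le ⟨f y, hU' hyW⟩ (hD hy)
    obtain ⟨n, c₀, hc₀, e⟩ := hC.exists_res_eq_smul hU g _ (C.res_mem hg hc)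
    refine ⟨W ⊓ f ⁻¹ᵁ X.basicOpen g, inf_le_left, ⟨hyW, hyg⟩, ?_⟩
    obtain ⟨w, hw⟩ := (isUnit_res_basicOpen g).pow n
    have h1 : ratRes hg c = (↑w⁻¹ : Γ(X, X.basicOpen g)) • ratRes (X.basicOpen_le g) c₀ := by
      rw [e, ← hw, smul_smul, Units.inv_mul, one_smul]
    have h2 := congr_arg (ratRes (inf_le_right : W ⊓ f ⁻¹ᵁ X.basicOpen g ≤ _))
      (congr_arg (θ.app _) h1)
    rw [app_smul, ratRes_smul, θ.app_res, θ.app_res] at h2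
    rw [ratRes_ratRes]
    refine Eq.symm h2 ▸ ?_
    exact Submodule.smul_mem _ _ (Submodule.subset_span ⟨_, ⟨c₀, hc₀, rfl⟩, rfl⟩)
  | zero => exact ⟨W, le_rfl, hyW, by rw [map_zero]; exact zero_mem _⟩
  | add a b _ _ ha hb =>
    obtain ⟨V, h, hyV, hV⟩ := ha
    obtain ⟨V', h', hyV', hV'⟩ := hb
    refine ⟨V ⊓ V', inf_le_left.trans h, ⟨hyV, hyV'⟩, ?_⟩
    rw [map_add]
    exact add_mem (hres inf_le_left _ hV) (hres inf_le_right _ hV')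
  | smul a b _ hb =>
    obtain ⟨V, h, hyV, hV⟩ := hb
    refine ⟨V, h, hyV, ?_⟩
    rw [ratRes_smul]
    exact Submodule.smul_mem _ _ hV

variable [IsLocallyNoetherian Y] [IsFinite f]

/-- If `C` is a module over the functions of `Y`, then it is the direct image of the submodule
which it generates. -/
theorem mem_extend_iff (hθ : θ.IsIso) (hC : C.IsCoherent)
    (hCY : ∀ (U : X.Opens) (b : Γ(Y, f ⁻¹ᵁ U)), ∀ c ∈ C.sections U,
      functionHom hθ U b * c ∈ C.sections U)
    {U : X.Opens} (hU : IsAffineOpen U) {s : RatFun X U} :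
    θ.app U s ∈ (C.extend θ).sections (f ⁻¹ᵁ U) ↔ s ∈ C.sections U := by
  refine ⟨fun hs ↦ ?_, app_mem_extend⟩
  -- the sections of `C`, as a submodule of `𝒬_Y(f⁻¹ U)` over the functions of `Y`
  let N : Submodule Γ(Y, f ⁻¹ᵁ U) (RatFun Y (f ⁻¹ᵁ U)) :=
    { carrier := θ.app U '' C.sections U
      add_mem' := by
        rintro _ _ ⟨a, ha, rfl⟩ ⟨b, hb, rfl⟩
        exact ⟨a + b, add_mem ha hb, map_add _ _ _⟩
      zero_mem' := ⟨0, zero_mem _, map_zero _⟩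
      smul_mem' := by
        rintro b _ ⟨c, hc, rfl⟩
        exact ⟨_, hCY U b c hc, app_functionHom_mul hθ U b c⟩ }
  obtain ⟨t, ht, e⟩ : θ.app U s ∈ N := mem_of_local_mem_span (hU.preimage f) N _
    fun y hy ↦ exists_res_mem_span_of_mem_extend hC hU le_rfl hs hy
  rwa [← (hθ U).injective e]

theorem IsCoherent.extend (hθ : θ.IsIso) (hC : C.IsCoherent)
    (hCY : ∀ (U : X.Opens) (b : Γ(Y, f ⁻¹ᵁ U)), ∀ c ∈ C.sections U,
      functionHom hθ U b * c ∈ C.sections U) : (C.extend θ).IsCoherent := by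
  refine isCoherent_of_cover fun y ↦ ?_
  obtain ⟨U, hU, -, hyU⟩ := exists_affine_le (⊤ : X.Opens) (x := f y) trivial
  refine ⟨f ⁻¹ᵁ U, hU.preimage f, hyU, ?_, fun g s hs ↦ ?_⟩
  · obtain ⟨S, hS⟩ := hC.fg hU
    have : (C.extend θ).sections (f ⁻¹ᵁ U) = Submodule.span _ (θ.app U '' S) := by
      apply le_antisymm
      · intro s hs
        rw [← app_equiv_symm hθ U s, mem_extend_iff hθ hC hCY hU, ← hS] at hs
        rw [← app_equiv_symm hθ U s]
        generalize (equiv hθ U).symm s = t at hs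
        induction hs using Submodule.span_induction with
        | mem x hx => exact Submodule.subset_span ⟨x, hx, rfl⟩
        | zero => rw [map_zero]; exact zero_mem _
        | add x y _ _ hx hy => rw [map_add]; exact add_mem hx hy
        | smul a x _ hx => rw [app_smul]; exact Submodule.smul_mem _ _ hx
      · rw [Submodule.span_le]
        rintro _ ⟨c, hc, rfl⟩
        exact app_mem_extend (hS ▸ Submodule.subset_span hc)
    rw [this]
    exact Submodule.fg_span (S.finite_toSet.image _)
  · refine exists_res_eq_of_mem_span (hU.preimage f) g _ ?_
    refine mem_of_local_mem_span ((hU.preimage f).basicOpen g) _ s fun x hx ↦ ?_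
    obtain ⟨V, h, hxV, hV⟩ := exists_res_mem_span_of_mem_extend hC hU (Y.basicOpen_le g) hs hx
    refine ⟨V, h, hxV, Submodule.span_mono ?_ hV⟩
    rintro _ ⟨_, ⟨c, hc, rfl⟩, rfl⟩
    exact ⟨_, Submodule.subset_span ⟨_, app_mem_extend hc, rfl⟩, rfl⟩

end RatSubmodule

end Extension

/-! ### The conductor -/

section Conductor

variable {X Y : Scheme.{u}} {f : Y ⟶ X} {θ : RatComorphism f}

open RatComorphism

namespace HomSection

variable {J : RatSubmodule Y} {I : RatSubmodule X} {U : X.Opens}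

theorem hom_ext {φ ψ : HomSection f J I U} (h : ∀ V hV j, φ.app V hV j = ψ.app V hV j) : φ = ψ := by
  cases φ
  cases ψ
  congr 1
  funext V hV
  exact AddMonoidHom.ext fun j ↦ h V hV j

/-- Multiplication by a section of `(I : f_* J)`, as a homomorphism from `f_* J` to `I`. -/
noncomputable def ofColon (hθ : θ.IsIso) (q : (I.colon (θ.pushforward J)).sections U) :
    HomSection f J I U where
  app V h :=
    { toFun := fun j ↦ ⟨ratRes h q.1 * (equiv hθ V).symm j.1, q.2 V h _ (by
        rw [RatSubmodule.mem_pushforward, app_equiv_symm]; exact j.2)⟩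
      map_zero' := Subtype.ext (by
        change _ * (equiv hθ V).symm 0 = 0
        rw [map_zero, mul_zero])
      map_add' := fun x y ↦ Subtype.ext (by
        change _ * (equiv hθ V).symm (x.1 + y.1) = _ * _ + _ * _
        rw [map_add, mul_add]) }
  app_smul V h a j := Subtype.ext (by
    change ratRes h q.1 * (equiv hθ V).symm (f.app V a • j.1) =
      a • (ratRes h q.1 * (equiv hθ V).symm j.1)
    apply (hθ V).injective
    rw [map_mul, θ.app_smul, map_mul, app_equiv_symm, app_equiv_symm, mul_smul_comm])
  app_res V W h h' j := by
    change ratRes (h'.trans h) q.1 * (equiv hθ W).symm (ratRes (f.preimage_mono h') j.1) =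
      ratRes h' (ratRes h q.1 * (equiv hθ V).symm j.1)
    rw [map_mul, ratRes_equiv_symm, ratRes_ratRes]

theorem app_ofColon (hθ : θ.IsIso) (q : (I.colon (θ.pushforward J)).sections U) (V : X.Opens)
    (h : V ≤ U) (j : J.sections (f ⁻¹ᵁ V)) :
    ((ofColon hθ q).app V h j).1 = ratRes h q.1 * (equiv hθ V).symm j.1 := rfl

theorem eq_of_isZero (hJ : J.IsZero) (φ ψ : HomSection f J I U) : φ = ψ := by
  refine hom_ext fun V hV j ↦ ?_
  have : j = 0 := Subtype.ext (hJ _ j.1 j.2)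
  rw [this, map_zero, map_zero]

variable [IsLocallyNoetherian X] [IsLocallyNoetherian Y] [IsFinite f]

/-- Over an affine open set, a homomorphism from `f_* J` to `I` is the multiplication by the
value at a unit `p` in `f_* J`, divided by `p`: every element of `f_* J` is of the form `a p / b`
for functions `a` and `b` with `b` regular. -/
theorem exists_eq_mul_of_affine (hθ : θ.IsIso) (hJ : J.IsCoherent) (hJ' : J.IsFull)
    (φ : HomSection f J I U) {V : X.Opens} (hV : IsAffineOpen V) (hVU : V ≤ U) :
    ∃ q : RatFun X V, ∀ j : J.sections (f ⁻¹ᵁ V),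
      (φ.app V hVU j).1 = q * (equiv hθ V).symm j.1 := by
  obtain ⟨p, hp, hu⟩ := (hJ'.pushforward hθ hJ).exists_isUnit (hJ.pushforward hθ) hV
  obtain ⟨w, rfl⟩ := hu
  refine ⟨(φ.app V hVU ⟨_, hp⟩).1 * ↑w⁻¹, fun j ↦ ?_⟩
  obtain ⟨b, hb, a, e⟩ := exists_smul_eq_algebraMap hV ((equiv hθ V).symm j.1 * ↑w⁻¹)
  have h1 : f.app V b • j = f.app V a • (⟨_, hp⟩ : J.sections (f ⁻¹ᵁ V)) := by
    apply Subtype.ext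
    change f.app V b • j.1 = f.app V a • θ.app V w
    rw [← θ.app_smul, Algebra.smul_def a, ← e, smul_mul_assoc, mul_assoc, Units.inv_mul, mul_one,
      θ.app_smul, app_equiv_symm]
  have h2 := congr_arg (fun z ↦ (φ.app V hVU z).1) h1
  simp only [φ.app_smul] at h2
  replace h2 : b • (φ.app V hVU j).1 = a • (φ.app V hVU ⟨_, hp⟩).1 := h2
  refine (isUnit_algebraMap_ratFun hV hb).mul_left_cancel ?_
  rw [← Algebra.smul_def, h2, Algebra.smul_def, ← e, Algebra.smul_def]
  ring

/-- Every homomorphism from `f_* J` to `I` is the multiplication by a rational function. -/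
theorem ofColon_surjective (hθ : θ.IsIso) (hJ : J.IsCoherent) (hJ' : J.IsFull) :
    Function.Surjective (ofColon hθ : (I.colon (θ.pushforward J)).sections U → _) := by
  intro φ
  have hP := hJ.pushforward hθ
  have hP' := hJ'.pushforward hθ hJ
  choose q hq using fun (V : X.Opens) (hV : IsAffineOpen V) (hVU : V ≤ U) ↦
    exists_eq_mul_of_affine hθ hJ hJ' φ hV hVU
  have hres {V W : X.Opens} (hV : IsAffineOpen V) (hW : IsAffineOpen W) (hVU : V ≤ U)
      (h : W ≤ V) : ratRes h (q V hV hVU) = q W hW (h.trans hVU) := by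
    obtain ⟨p, hp, hu⟩ := hP'.exists_isUnit hP hV
    refine (hu.map (ratRes h)).mul_right_cancel ?_
    have h1 := φ.app_res V W hVU h ⟨_, hp⟩
    rw [hq V hV, hq W hW, ← ratRes_equiv_symm hθ h, equiv_symm_app] at h1
    rw [← map_mul, h1]
  -- the multipliers on affine open sets glue
  choose V hV hVU hxV using fun x : U ↦ exists_affine_le U x.2
  obtain ⟨t, ht⟩ := exists_ratFun_glue V hVU (fun x hx ↦ ⟨⟨x, hx⟩, hxV _⟩)
    (fun x ↦ q (V x) (hV x) (hVU x)) fun x x' y hy hy' ha ↦ by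
      obtain ⟨W, hW, hle, hyW⟩ := exists_affine_le (V x ⊓ V x') (x := y) ⟨hy, hy'⟩
      have h1 := (hres (hV x) hW (hVU x) (hle.trans inf_le_left)).trans
        (hres (hV x') hW (hVU x') (hle.trans inf_le_right)).symm
      exact congr_fun (congr_arg Subtype.val h1) ⟨y, hyW, ha⟩
  have key (W : X.Opens) (hW : W ≤ U) (j : J.sections (f ⁻¹ᵁ W)) :
      (φ.app W hW j).1 = ratRes hW t * (equiv hθ W).symm j.1 := by
    refine ratFun_ext_of_local fun x hx ↦ ?_
    obtain ⟨W', hW', hle, hxW'⟩ := exists_affine_le (W ⊓ V ⟨x, hW hx⟩) (x := x) ⟨hx, hxV _⟩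
    have hle1 : W' ≤ W := hle.trans inf_le_left
    have hle2 : W' ≤ V ⟨x, hW hx⟩ := hle.trans inf_le_right
    refine ⟨W', hle1, hxW', ?_⟩
    rw [← φ.app_res W W' hW hle1 j, hq W' hW', map_mul, ratRes_equiv_symm, ratRes_ratRes,
      ← hres (hV _) hW' (hVU _) hle2, ← ht ⟨x, hW hx⟩, ratRes_ratRes]
  refine ⟨⟨t, fun W hW p hp ↦ ?_⟩, hom_ext fun W hW j ↦ Subtype.ext (key W hW j).symm⟩
  have := key W hW ⟨θ.app W p, hp⟩
  rw [equiv_symm_app] at this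
  rw [← this]
  exact Subtype.prop _

theorem ofColon_injective (hθ : θ.IsIso) (hJ : J.IsCoherent) (hJ' : J.IsFull) :
    Function.Injective (ofColon hθ : (I.colon (θ.pushforward J)).sections U → _) := by
  intro q q' h
  refine Subtype.ext ((hJ'.pushforward hθ hJ).ratFun_ext (hJ.pushforward hθ) fun V hV _ p hp ↦ ?_)
  have := congr_arg (fun φ : HomSection f J I U ↦ (φ.app V hV ⟨θ.app V p, hp⟩).1) h
  simpa only [app_ofColon, equiv_symm_app] using this

end HomSection

namespace RatSubmodule

variable {J : RatSubmodule Y} {I C : RatSubmodule X}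

section Uniqueness

variable [IsLocallyNoetherian X] [IsLocallyNoetherian Y] [IsFinite f]

/-- For nonzero `J`, the conductor is the quotient `(I : f_* J)`. -/
theorem isConductor_colon (hθ : θ.IsIso) (hJ : J.IsCoherent) (hJ' : J.IsFull) :
    IsConductor θ J I (I.colon (θ.pushforward J)) := fun U ↦
  ⟨HomSection.ofColon hθ, ⟨HomSection.ofColon_injective hθ hJ hJ',
    HomSection.ofColon_surjective hθ hJ hJ'⟩, fun c V h j ↦ by
      rw [HomSection.app_ofColon, map_mul, app_equiv_symm]⟩

theorem eq_colon_of_isConductor (hθ : θ.IsIso) (hJ : J.IsCoherent) (hJ' : J.IsFull)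
    (hC : IsConductor θ J I C) : C = I.colon (θ.pushforward J) := by
  refine RatSubmodule.ext (funext fun U ↦ le_antisymm (fun c hc ↦ ?_) fun q hq ↦ ?_)
  · obtain ⟨e, -, he⟩ := hC U
    intro V h p hp
    have h1 := he ⟨c, hc⟩ V h ⟨θ.app V p, hp⟩
    rw [← map_mul] at h1
    rw [← (hθ V).injective h1]
    exact Subtype.prop _
  · obtain ⟨e, hb, he⟩ := hC U
    obtain ⟨c, hc⟩ := hb.surjective (HomSection.ofColon hθ ⟨q, hq⟩)
    have : c.1 = q := by
      refine (hJ'.pushforward hθ hJ).ratFun_ext (hJ.pushforward hθ) fun V hV _ p hp ↦ ?_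
      have h1 := he c V hV ⟨θ.app V p, hp⟩
      rw [hc, HomSection.app_ofColon, equiv_symm_app, ← map_mul] at h1
      exact ((hθ V).injective h1).symm
    exact this ▸ c.2

end Uniqueness

/-- The zero submodule of `𝒬_X`. -/
noncomputable instance : Zero (RatSubmodule X) :=
  ⟨{ sections := fun _ ↦ ⊥
     res_mem := fun h s hs ↦ by
       rw [Submodule.mem_bot] at hs ⊢
       rw [hs, map_zero]
     mem_of_local := fun s hs ↦ by
       rw [Submodule.mem_bot]
       refine ratFun_ext_of_local fun x hx ↦ ?_
       obtain ⟨V, h, hxV, hV⟩ := hs x hx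
       exact ⟨V, h, hxV, by rw [map_zero]; exact hV⟩ }⟩

theorem isZero_zero : (0 : RatSubmodule X).IsZero := fun _ _ hs ↦ hs

theorem IsZero.eq_zero (h : C.IsZero) : C = 0 :=
  RatSubmodule.ext (funext fun U ↦ (Submodule.eq_bot_iff _).mpr (h U))

theorem isCoherent_zero : (0 : RatSubmodule X).IsCoherent :=
  ⟨fun _ ↦ Submodule.fg_bot, fun _ _ s hs _ ↦ ⟨0, by rw [isZero_zero _ s hs, smul_zero]⟩,
    fun _ _ s hs ↦ ⟨0, 0, zero_mem _, by rw [isZero_zero _ s hs, map_zero, smul_zero]⟩⟩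

/-- There is exactly one homomorphism from `0`, hence the conductor of `0` is `0`. -/
theorem isConductor_iff_of_isZero (hJ : J.IsZero) : IsConductor θ J I C ↔ C.IsZero := by
  constructor
  · intro h U s hs
    obtain ⟨e, he, -⟩ := h U
    exact congr_arg Subtype.val (he.injective (HomSection.eq_of_isZero hJ (e ⟨s, hs⟩) (e 0)))
  · intro h U
    let φ : HomSection f J I U :=
      { app := fun _ _ ↦ 0
        app_smul := fun V _ a _ ↦ (smul_zero a).symm
        app_res := fun _ _ _ _ _ ↦ (map_zero (ratRes _)).symm }
    refine ⟨fun _ ↦ φ, ⟨fun c c' _ ↦ Subtype.ext ((h U _ c.2).trans (h U _ c'.2).symm),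
      fun ψ ↦ ⟨0, HomSection.eq_of_isZero hJ _ _⟩⟩, fun c V hV j ↦ ?_⟩
    rw [h U _ c.2, map_zero, map_zero, zero_mul]
    exact map_zero _

/-- The conductor exists, is unique, and is a module over the functions of `Y`. -/
theorem exists_isConductor [IsLocallyNoetherian X] [IsLocallyNoetherian Y] [IsFinite f]
    (hθ : θ.IsIso) (J : FracIdeal Y) (I : FracIdeal X) :
    ∃ C : FracIdeal X, IsConductor θ J.toRatSubmodule I.toRatSubmodule C.toRatSubmodule ∧
      (∀ D : RatSubmodule X, IsConductor θ J.toRatSubmodule I.toRatSubmodule D →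
        D = C.toRatSubmodule) ∧
      ∀ (U : X.Opens) (b : Γ(Y, f ⁻¹ᵁ U)), ∀ c ∈ C.sections U,
        functionHom hθ U b * c ∈ C.sections U := by
  rcases J.hasRank.isZero_or_isFull with hJ | hJ
  · refine ⟨⟨0, isCoherent_zero, isZero_zero.hasRank⟩,
      (isConductor_iff_of_isZero hJ).mpr isZero_zero,
      fun D hD ↦ ((isConductor_iff_of_isZero hJ).mp hD).eq_zero, fun U b c hc ↦ ?_⟩
    rw [isZero_zero U c hc, mul_zero]
    exact zero_mem _
  · have hP := J.isCoherent.pushforward hθ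
    have hP' := hJ.pushforward hθ J.isCoherent
    refine ⟨⟨I.toRatSubmodule.colon (θ.pushforward J.toRatSubmodule),
      isCoherent_colon I.isCoherent hP hP', ?_⟩, isConductor_colon hθ J.isCoherent hJ,
      fun D hD ↦ eq_colon_of_isConductor hθ J.isCoherent hJ hD, fun U b c hc V h p hp ↦ ?_⟩
    · rcases I.hasRank.isZero_or_isFull with hI | hI
      · exact (isZero_colon hP hP' hI).hasRank
      · exact (isFull_colon I.isCoherent hP hI).hasRank
    · rw [map_mul, ratRes_functionHom, mul_comm (functionHom hθ V _), mul_assoc]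
      exact hc V h _ (functionHom_mul_mem_pushforward hθ _ hp)

theorem fracIdeal_ext {I I' : FracIdeal X} (h : I.toRatSubmodule = I'.toRatSubmodule) : I = I' := by
  cases I; cases I'; congr

/-- A fractional ideal on `X` which is a module over the functions of `Y` comes from a unique
fractional ideal on `Y`. -/
theorem exists_pushforward_eq [IsLocallyNoetherian X] [IsLocallyNoetherian Y] [IsFinite f]
    (hθ : θ.IsIso) (C : FracIdeal X)
    (hCY : ∀ (U : X.Opens) (b : Γ(Y, f ⁻¹ᵁ U)), ∀ c ∈ C.sections U,
        functionHom hθ U b * c ∈ C.sections U) :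
    ∃ C' : FracIdeal Y, θ.pushforward C'.toRatSubmodule = C.toRatSubmodule ∧
      ∀ D : FracIdeal Y, θ.pushforward D.toRatSubmodule = C.toRatSubmodule → D = C' := by
  have hC := C.isCoherent
  have hE : (C.toRatSubmodule.extend θ).IsCoherent := hC.extend hθ hCY
  refine ⟨⟨C.toRatSubmodule.extend θ, hE, ?_⟩, ?_, fun D hD ↦ ?_⟩
  · rcases C.hasRank.isZero_or_isFull with h | h
    · exact h.extend.hasRank
    · exact (h.extend hC).hasRank
  · have key {U : X.Opens} (hU : IsAffineOpen U) :
        (θ.pushforward (C.toRatSubmodule.extend θ)).sections U = C.sections U :=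
      Submodule.ext fun s ↦ mem_extend_iff hθ hC hCY hU
    have hcov (x : X) := exists_affine_le (⊤ : X.Opens) (x := x) trivial
    refine RatSubmodule.ext (funext fun U ↦ le_antisymm
      (sections_le_of_cover (hE.pushforward hθ) (fun x ↦ ?_) U)
      (sections_le_of_cover hC (fun x ↦ ?_) U))
    · obtain ⟨V, hV, -, hx⟩ := hcov x
      exact ⟨V, hV, hx, (key hV).le⟩
    · obtain ⟨V, hV, -, hx⟩ := hcov x
      exact ⟨V, hV, hx, (key hV).ge⟩
  · have key {U : X.Opens} (hU : IsAffineOpen U) :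
        D.sections (f ⁻¹ᵁ U) = (C.toRatSubmodule.extend θ).sections (f ⁻¹ᵁ U) := by
      ext s
      rw [← app_equiv_symm hθ U s, mem_extend_iff hθ hC hCY hU, ← hD]
      rfl
    have hcov (y : Y) := exists_affine_le (⊤ : X.Opens) (x := f y) trivial
    refine fracIdeal_ext (RatSubmodule.ext (funext fun U ↦ le_antisymm
      (sections_le_of_cover D.isCoherent (fun x ↦ ?_) U)
      (sections_le_of_cover hE (fun x ↦ ?_) U)))
    · obtain ⟨V, hV, -, hx⟩ := hcov x
      exact ⟨f ⁻¹ᵁ V, hV.preimage f, hx, (key hV).le⟩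
    · obtain ⟨V, hV, -, hx⟩ := hcov x
      exact ⟨f ⁻¹ᵁ V, hV.preimage f, hx, (key hV).ge⟩

end RatSubmodule

end Conductor

/-! ### Invertible submodules -/

section Invertible

variable {X Y : Scheme.{u}} {f : Y ⟶ X} {θ : RatComorphism f}

open RatComorphism

namespace RatSubmodule

variable [IsLocallyNoetherian Y] [IsFinite f] {C' : RatSubmodule Y}

/-- An invertible submodule of `𝒬_Y` is locally generated by a regular section of its direct
image. -/
theorem IsInvertible.exists_isGeneratorAway [IsLocallyNoetherian X] (hθ : θ.IsIso)
    (hC' : C'.IsCoherent) (h : C'.IsInvertible)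
    {U : X.Opens} (hU : IsAffineOpen U) {y : Y} (hy : f y ∈ U) :
    ∃ (g : Γ(Y, f ⁻¹ᵁ U)) (c : RatFun X U), y ∈ Y.basicOpen g ∧
      IsGeneratorAway ((θ.pushforward C').sections U) (functionHom hθ U) g c := by
  have hW := hU.preimage f
  obtain ⟨D, s, hyD, hs, hs'⟩ := h y
  obtain ⟨g, hg, hyg⟩ := hW.exists_basicOpen_le ⟨y, hyD⟩ hy
  -- the local generator `s` extends to `f⁻¹ U`, up to a power of `g`
  obtain ⟨n, t, ht, e⟩ := hC'.exists_res_eq_smul hW g _ (C'.res_mem hg hs)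
  refine ⟨g, (equiv hθ U).symm t, hyg, ?_, fun k hk ↦ ?_, fun x hx ↦ ?_⟩
  · rwa [mem_pushforward, app_equiv_symm]
  · -- write `k = a / b`; then `a` annihilates `s`
    obtain ⟨b, hb, a, hba⟩ := exists_smul_eq_algebraMap hU k
    have h1 : f.app U a • t = 0 := by
      have : a • (equiv hθ U).symm t = 0 := by
        rw [Algebra.smul_def, ← hba, smul_mul_assoc, mul_comm, hk, smul_zero]
      rw [← app_equiv_symm hθ U t, ← θ.app_smul, this, map_zero]
    have h2 : Y.presheaf.map (homOfLE (Y.basicOpen_le g)).op (f.app U a) • ratRes hg s = 0 := by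
      obtain ⟨w, hw⟩ := (isUnit_res_basicOpen g).pow n
      have := congr_arg (ratRes (Y.basicOpen_le g)) h1
      rw [ratRes_smul, e, map_zero, smul_comm, ← hw] at this
      simpa [smul_smul] using congr_arg (fun z ↦ (↑w⁻¹ : Γ(Y, Y.basicOpen g)) • z) this
    have h3 : Y.presheaf.map (homOfLE (Y.basicOpen_le g)).op (f.app U a) = 0 :=
      (hs' _ hg 0 (zero_mem _)).unique h2 (zero_smul _ _)
    have h4 : ratRes (Y.basicOpen_le g) (θ.app U k) = 0 := by
      have := (((isUnit_algebraMap_ratFun hU hb).map (θ.app U)).map (ratRes (Y.basicOpen_le g)))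
      refine this.mul_left_cancel ?_
      rw [← map_mul, ← map_mul, ← Algebra.smul_def, hba, θ.app_algebraMap, ratRes_algebraMap, h3,
        map_zero, mul_zero]
    obtain ⟨m, hm⟩ := exists_pow_smul_eq_zero hW g _ h4
    refine ⟨m, (hθ U).injective ?_⟩
    rw [← map_pow, app_functionHom_mul, hm, map_zero]
  · obtain ⟨a, ha, -⟩ := hs' _ hg _ (C'.res_mem (Y.basicOpen_le g) hx)
    obtain ⟨m, b, hb⟩ := exists_res_eq_pow_mul hW g a
    obtain ⟨k, hk⟩ := exists_pow_smul_eq_zero hW g (g ^ (n + m) • θ.app U x - b • t) (by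
      rw [map_sub, ratRes_smul, ratRes_smul, ← ha, e, hb, map_pow, smul_smul, smul_smul,
        sub_eq_zero]
      congr 1
      ring)
    refine ⟨k + (n + m), g ^ k * b, (hθ U).injective ?_⟩
    rw [smul_sub, sub_eq_zero] at hk
    rw [← map_pow, app_functionHom_mul, app_functionHom_mul, app_equiv_symm, pow_add, mul_smul, hk,
      mul_smul]

/-- Conversely, a submodule of `𝒬_Y` is invertible if it is locally generated by a regular section
of its direct image, because regular rational functions on an affine open set are units. -/
theorem isInvertible_of_isGeneratorAway (hθ : θ.IsIso) (hC' : C'.IsCoherent)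
    (h : ∀ y : Y, ∃ (U : X.Opens) (g : Γ(Y, f ⁻¹ᵁ U)) (c : RatFun X U), IsAffineOpen U ∧
      y ∈ Y.basicOpen g ∧
      IsGeneratorAway ((θ.pushforward C').sections U) (functionHom hθ U) g c) :
    C'.IsInvertible := by
  intro y
  obtain ⟨U, g, c, hU, hy, hgc⟩ := h y
  have hW := hU.preimage f
  set s := ratRes (Y.basicOpen_le g) (θ.app U c) with hs
  have hreg (z : Γ(Y, Y.basicOpen g)) (hz : z • s = 0) : z = 0 := by
    obtain ⟨n, b, hb⟩ := exists_res_eq_pow_mul hW g z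
    obtain ⟨m, hm⟩ := exists_pow_smul_eq_zero hW g (b • θ.app U c) (by
      rw [ratRes_smul, hb, mul_smul, hz, smul_zero])
    obtain ⟨l, hl⟩ := hgc.regular (functionHom hθ U (g ^ m * b)) (by
      apply (hθ U).injective
      rw [mul_comm, app_functionHom_mul, mul_smul, hm, map_zero])
    rw [← map_pow, ← map_mul, ← mul_assoc, ← pow_add] at hl
    have h0 : g ^ (l + m) * b = 0 := functionHom_injective hθ U (hl.trans (map_zero _).symm)
    have h1 := congr_arg (Y.presheaf.map (homOfLE (Y.basicOpen_le g)).op) h0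
    rw [map_mul, map_pow, map_zero, hb, ← mul_assoc, ← pow_add] at h1
    exact ((isUnit_res_basicOpen g).pow _).mul_right_eq_zero.mp h1
  have hunit : IsUnit s := by
    have hD := hW.basicOpen g
    obtain ⟨d, hd, b, e⟩ := exists_smul_eq_algebraMap hD s
    have hb : b ∈ nonZeroDivisors Γ(Y, Y.basicOpen g) := by
      rw [mem_nonZeroDivisors_iff_right]
      intro z hz
      refine hreg z ((isUnit_algebraMap_ratFun hD hd).mul_left_cancel ?_)
      rw [mul_smul_comm, ← Algebra.smul_def, e, Algebra.smul_def, ← map_mul, hz, map_zero, mul_zero]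
    have := isUnit_algebraMap_ratFun hD hb
    rw [← e, Algebra.smul_def] at this
    exact isUnit_of_mul_isUnit_right this
  refine ⟨Y.basicOpen g, s, hy, C'.res_mem _ hgc.mem, fun V hV t ht ↦ ?_⟩
  obtain ⟨w, hw⟩ := hunit.map (ratRes hV)
  -- the rational function `t / s` is locally a function, because `s` generates
  obtain ⟨a, ha⟩ := exists_algebraMap_eq_of_local (t * (↑w⁻¹ : RatFun Y V)) fun x hx ↦ by
    obtain ⟨g', hg', hxg'⟩ := hW.exists_basicOpen_le ⟨x, hx⟩ (Y.basicOpen_le g (hV hx))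
    obtain ⟨n, x', hx', e⟩ := hC'.exists_res_eq_smul hW g' _ (C'.res_mem hg' ht)
    obtain ⟨m, b, hb⟩ := hgc.generates ((equiv hθ U).symm x') (by
      rwa [mem_pushforward, app_equiv_symm])
    have hb' : g ^ m • x' = b • θ.app U c := by
      have := congr_arg (θ.app U) hb
      rwa [← map_pow, app_functionHom_mul, app_functionHom_mul, app_equiv_symm] at this
    have h1 := congr_arg (ratRes (Y.basicOpen_le g')) hb'
    have h2 : IsUnit (Y.presheaf.map (homOfLE (Y.basicOpen_le g')).op g) := by
      have := (isUnit_res_basicOpen g).map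
        (Y.presheaf.map (homOfLE (hg'.trans hV)).op).hom
      convert this using 1
      change _ = (Y.presheaf.map _ ≫ Y.presheaf.map _) g
      rw [← Y.presheaf.map_comp]
      rfl
    obtain ⟨v, hv⟩ := ((isUnit_res_basicOpen g').pow n).mul (h2.pow m)
    refine ⟨Y.basicOpen g', hg',
      ↑v⁻¹ * Y.presheaf.map (homOfLE (Y.basicOpen_le g')).op b, hxg', ?_⟩
    rw [ratRes_smul, ratRes_smul, e, smul_smul, map_pow, mul_comm, ← hv] at h1
    have h3 : ratRes hg' t = (↑v⁻¹ * Y.presheaf.map (homOfLE (Y.basicOpen_le g')).op b) •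
        ratRes (hg'.trans hV) s := by
      rw [mul_smul]
      refine Eq.trans ?_ (congr_arg (fun z ↦ (↑v⁻¹ : Γ(Y, Y.basicOpen g')) • z) h1)
      simp [smul_smul]
    rw [map_mul (ratRes hg'), h3, ← ratRes_ratRes hg' hV, ← hw, smul_mul_assoc, ← map_mul,
      Units.mul_inv, map_one, Algebra.smul_def, mul_one]
  refine ⟨a, ?_, fun a' ha' ↦ algebraMap_ratFun_injective V ?_⟩
  · change a • ratRes hV s = t
    rw [Algebra.smul_def, ha, ← hw, mul_assoc, Units.inv_mul, mul_one]
  · rw [ha, ← ha', ← hw, Algebra.smul_def, mul_assoc, Units.mul_inv, mul_one]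

end RatSubmodule

end Invertible

/-! ### Charts of the blow up -/

section Charts

open HomogeneousLocalization Limits

/-- An open immersion of affine schemes whose image contains `D(g)` is an isomorphism on rings after
inverting `g`. -/
theorem exists_pow_of_basicOpen_le_opensRange {R S : Type u} [CommRing R] [CommRing S]
    (φ : R →+* S) [IsOpenImmersion (Spec.map (CommRingCat.ofHom φ))] (g : R)
    (hg : PrimeSpectrum.basicOpen g ≤ (Spec.map (CommRingCat.ofHom φ)).opensRange) :
    (∀ r, φ r = 0 → ∃ n : ℕ, g ^ n * r = 0) ∧
      ∀ s, ∃ (n : ℕ) (r : R), φ g ^ n * s = φ r := by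
  set q := Spec.map (CommRingCat.ofHom φ) with hq
  let ε (T : Type u) [CommRing T] : T ≃+* Γ(Spec (.of T), ⊤) :=
    (Scheme.ΓSpecIso (.of T)).symm.commRingCatIsoToRingEquiv
  have hε (r : R) : q.appTop (ε R r) = ε S (φ r) :=
    (congr($(Scheme.ΓSpecIso_inv_naturality (CommRingCat.ofHom φ)) r)).symm
  have hD : (Spec (.of R)).basicOpen (ε R g) = PrimeSpectrum.basicOpen g :=
    basicOpen_eq_of_affine (R := .of R) g
  have hR := isAffineOpen_top (Spec (.of R))
  have hS := isAffineOpen_top (Spec (.of S))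
  have := q.isIso_app ((Spec (.of R)).basicOpen (ε R g)) (hD.trans_le hg)
  have hbij := ConcreteCategory.bijective_of_isIso (q.app ((Spec (.of R)).basicOpen (ε R g)))
  have hnat (r : Γ(Spec (.of R), ⊤)) :
      q.app _ ((Spec (.of R)).presheaf.map (homOfLE ((Spec (.of R)).basicOpen_le (ε R g))).op r) =
        (Spec (.of S)).presheaf.map (homOfLE le_top).op (q.appTop r) :=
    congr($(q.naturality (homOfLE ((Spec (.of R)).basicOpen_le (ε R g))).op) r)
  refine ⟨fun r hr ↦ ?_, fun s ↦ ?_⟩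
  · have h0 : (Spec (.of R)).presheaf.map
        (homOfLE ((Spec (.of R)).basicOpen_le (ε R g))).op (ε R r) = 0 := by
      apply hbij.injective
      rw [hnat, hε, hr, map_zero, map_zero, map_zero]
    obtain ⟨n, hn⟩ := exists_pow_mul_eq_zero_of_res_basicOpen_eq_zero_of_isAffineOpen _ hR _ _ h0
    refine ⟨n, (ε R).injective ?_⟩
    rw [map_mul, map_pow, map_zero, hn]
  · obtain ⟨t, ht⟩ := hbij.surjective ((Spec (.of S)).presheaf.map (homOfLE le_top).op (ε S s))
    obtain ⟨n, b, hb⟩ := exists_res_eq_pow_mul hR (ε R g) t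
    have h1 : (Spec (.of S)).presheaf.map (homOfLE le_top).op
        (q.appTop b - q.appTop (ε R g) ^ n * ε S s) =
          (0 : Γ(Spec (.of S), q ⁻¹ᵁ (Spec (.of R)).basicOpen (ε R g))) := by
      rw [map_sub, ← hnat, hb, map_mul, map_pow, hnat, ht, map_mul, map_pow, sub_self]
    have h2 : (Spec (.of S)).presheaf.map
        (homOfLE ((Spec (.of S)).basicOpen_le (q.appTop (ε R g)))).op
        (q.appTop b - q.appTop (ε R g) ^ n * ε S s) = 0 := by
      have := congr_arg ((Spec (.of S)).presheaf.map
        (eqToHom (q.preimage_basicOpen_top (ε R g)).symm).op) h1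
      rwa [map_zero, ← ConcreteCategory.comp_apply, ← Functor.map_comp] at this
    obtain ⟨m, hm⟩ := exists_pow_mul_eq_zero_of_res_basicOpen_eq_zero_of_isAffineOpen _ hS _ _ h2
    refine ⟨m + n, g ^ m * (ε R).symm b, (ε S).injective ?_⟩
    rw [← hε (g ^ m * _), map_mul (ε R), RingEquiv.apply_symm_apply, map_mul q.appTop.hom,
      map_pow (ε R), map_pow q.appTop.hom, map_mul (ε S), map_pow (ε S), ← hε]
    linear_combination -hm

variable {X Y : Scheme.{u}} {C : RatSubmodule X}

theorem awayι_projReesToSpec {U : X.Opens} {d : ℕ} (hd : 0 < d) {s : rees (C.sections U)}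
    (hs : s ∈ reesGrade (C.sections U) d) :
    Proj.awayι (reesGrade (C.sections U)) s hs hd ≫ projReesToSpec C U =
      Spec.map (CommRingCat.ofHom (toAway s)) := by
  rw [projReesToSpec, Proj.awayι_toSpecZero_assoc, ← Spec.map_comp]
  rfl

section

variable [IsLocallyNoetherian X] (hC : C.IsCoherent)

/-- The open immersion of `Proj (⨁ₙ C(U)ⁿ)` into the blow up. -/
noncomputable def projReesι (U : X.AffineZariskiSite) : projRees C U.1 ⟶ blowUp hC :=
  colimit.ι (blowUpGluingData hC).functor U

instance (U : X.AffineZariskiSite) : IsOpenImmersion (projReesι hC U) :=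
  (blowUpGluingData hC).cover.map_prop U

theorem projReesι_blowUpMap (U : X.AffineZariskiSite) :
    projReesι hC U ≫ blowUpMap hC = projReesToSpec C U.1 ≫ U.2.fromSpec :=
  ((blowUpGluingData hC).ι_toBase U).trans (projReesToOpen_ι C U)

theorem opensRange_projReesι (U : X.AffineZariskiSite) :
    (projReesι hC U).opensRange = blowUpMap hC ⁻¹ᵁ U.1 := by
  refine ((blowUpGluingData hC).toBase_preimage_eq_opensRange_ι U).symm.trans ?_
  change blowUpMap hC ⁻¹ᵁ U.1.ι.opensRange = _
  rw [Scheme.Opens.opensRange_ι]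

theorem projReesMap_projReesι {U V : X.AffineZariskiSite} (h : U ≤ V) :
    projReesMap hC h ≫ projReesι hC V = projReesι hC U :=
  colimit.w (blowUpGluingData hC).functor (homOfLE h)

/-- The covering of `Proj (⨁ₙ C(U)ⁿ)` by the charts given by the elements `c T` of degree one. -/
noncomputable def projReesCover (C : RatSubmodule X) (U : X.Opens) :
    (projRees C U).AffineOpenCover :=
  Proj.affineOpenCoverOfIrrelevantLESpan _ (degOne (M := C.sections U)) degOne_mem
    (fun _ ↦ Nat.one_pos) irrelevant_le_span_degOne

/-- The chart of the blow up given by `c T`. -/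
noncomputable def blowUpChart (U : X.AffineZariskiSite) (c : C.sections U.1) :
    Spec (.of (Away (reesGrade (C.sections U.1)) (degOne c))) ⟶ blowUp hC :=
  Proj.awayι _ (degOne c) (degOne_mem c) Nat.one_pos ≫ projReesι hC U

instance (U : X.AffineZariskiSite) (c : C.sections U.1) : IsOpenImmersion (blowUpChart hC U c) := by
  delta blowUpChart
  infer_instance

theorem blowUpChart_blowUpMap (U : X.AffineZariskiSite) (c : C.sections U.1) :
    blowUpChart hC U c ≫ blowUpMap hC =
      Spec.map (CommRingCat.ofHom (toAway (degOne c))) ≫ U.2.fromSpec := by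
  rw [blowUpChart, Category.assoc, projReesι_blowUpMap, ← Category.assoc, awayι_projReesToSpec]

theorem exists_blowUpChart_eq {U : X.AffineZariskiSite} {z : blowUp hC}
    (hz : blowUpMap hC z ∈ U.1) : ∃ (c : C.sections U.1) (w : _), blowUpChart hC U c w = z := by
  have : z ∈ (projReesι hC U).opensRange := by rwa [opensRange_projReesι]
  obtain ⟨w, rfl⟩ := this
  obtain ⟨c, v, rfl⟩ := (projReesCover C U.1).openCover.exists_eq w
  exact ⟨c, v, rfl⟩

end

variable {f : Y ⟶ X}

/-- A morphism over `X` from an affine scheme over `U` to `Y` is a homomorphism of algebras. -/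
theorem exists_eq_specMap_fromSpec [IsAffineHom f] {U : X.Opens} (hU : IsAffineOpen U) {T : Type u}
    [CommRing T] (τ : Γ(X, U) →+* T) (v : Spec (.of T) ⟶ Y)
    (hv : v ≫ f = Spec.map (CommRingCat.ofHom τ) ≫ hU.fromSpec) :
    ∃ φ : Γ(Y, f ⁻¹ᵁ U) →+* T, v = Spec.map (CommRingCat.ofHom φ) ≫ (hU.preimage f).fromSpec ∧
      φ.comp (f.app U).hom = τ := by
  have hW := hU.preimage f
  have hr : Set.range v ⊆ Set.range hW.fromSpec := by
    rw [hW.range_fromSpec]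
    rintro _ ⟨z, rfl⟩
    change f (v z) ∈ U
    rw [← Scheme.Hom.comp_apply, hv, Scheme.Hom.comp_apply, ← SetLike.mem_coe, ← hU.range_fromSpec]
    exact ⟨_, rfl⟩
  obtain ⟨φ, hφ⟩ := Spec.map_surjective (IsOpenImmersion.lift hW.fromSpec v hr)
  have h1 : Spec.map φ ≫ hW.fromSpec = v := by rw [hφ, IsOpenImmersion.lift_fac]
  refine ⟨φ.hom, h1.symm, ?_⟩
  have h2 : Spec.map (f.app U ≫ φ) = Spec.map (CommRingCat.ofHom τ) := by
    rw [← cancel_mono hU.fromSpec, ← hv, ← h1, Spec.map_comp, Category.assoc, Category.assoc,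
      Scheme.Hom.app_eq_appLE, hU.SpecMap_appLE_fromSpec _ hW]
  exact congr_arg CommRingCat.Hom.hom (Spec.map_injective h2)

variable {θ : RatComorphism f} (hθ : θ.IsIso)

open RatComorphism

section

variable [IsLocallyNoetherian X] [IsLocallyNoetherian Y]
include hθ

/-- The functions on `f⁻¹ U` are fractions with denominators on `U`. -/
theorem exists_isUnit_mul_eq {U : X.Opens} (hU : IsAffineOpen U) (b : Γ(Y, f ⁻¹ᵁ U)) :
    ∃ s a : Γ(X, U), IsUnit (algebraMap Γ(X, U) (RatFun X U) s) ∧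
      (f.app U).hom s * b = (f.app U).hom a := by
  obtain ⟨s, hs, a, h⟩ := exists_smul_eq_algebraMap hU (functionHom hθ U b)
  refine ⟨s, a, isUnit_algebraMap_ratFun hU hs, functionHom_injective hθ U ?_⟩
  have h' (a : Γ(X, U)) : functionHom hθ U ((f.app U).hom a) = algebraMap _ _ a :=
    congr($(functionHom_comp hθ U) a)
  rw [map_mul, h', h', ← h, Algebra.smul_def]

/-- There is at most one morphism over `X` from a chart of `Proj (⨁ₙ C(U)ⁿ)` to `Y`. -/
theorem spec_away_hom_ext [IsAffineHom f] {U : X.Opens} (hU : IsAffineOpen U) {d : ℕ}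
    {s : rees (C.sections U)} (hs : s ∈ reesGrade (C.sections U) d)
    {v w : Spec (.of (Away (reesGrade (C.sections U)) s)) ⟶ Y}
    (hv : v ≫ f = Spec.map (CommRingCat.ofHom (toAway s)) ≫ hU.fromSpec)
    (hw : w ≫ f = Spec.map (CommRingCat.ofHom (toAway s)) ≫ hU.fromSpec) : v = w := by
  obtain ⟨φ, rfl, hφ⟩ := exists_eq_specMap_fromSpec hU _ v hv
  obtain ⟨ψ, rfl, hψ⟩ := exists_eq_specMap_fromSpec hU _ w hw
  rw [ringHom_away_ext (f.app U).hom (exists_isUnit_mul_eq hθ hU) hs hφ hψ]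

end

end Charts

/-! ### Morphisms from the blow up -/

section BlowUpMorphisms

open HomogeneousLocalization Limits RatComorphism

variable {X Y : Scheme.{u}} {f : Y ⟶ X} {θ : RatComorphism f} (hθ : θ.IsIso) {C : RatSubmodule X}
  [IsAffineHom f]
  (hM : ∀ (U : X.Opens) (b : Γ(Y, f ⁻¹ᵁ U)), ∀ c ∈ C.sections U,
    functionHom hθ U b * c ∈ C.sections U)

section Uniqueness

variable [IsLocallyNoetherian X] [IsLocallyNoetherian Y]
include hθ

/-- There is at most one morphism over `X` from `Proj (⨁ₙ C(U)ⁿ)` to `Y`. -/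
theorem projRees_hom_ext {U : X.Opens} (hU : IsAffineOpen U) {v w : projRees C U ⟶ Y}
    (hv : v ≫ f = projReesToSpec C U ≫ hU.fromSpec)
    (hw : w ≫ f = projReesToSpec C U ≫ hU.fromSpec) : v = w := by
  refine (projReesCover C U).openCover.hom_ext _ _ fun c ↦ ?_
  refine spec_away_hom_ext hθ hU (degOne_mem c) ?_ ?_
  · refine (Category.assoc _ _ _).trans ?_
    rw [hv, ← awayι_projReesToSpec Nat.one_pos (degOne_mem c), Category.assoc]
    rfl
  · refine (Category.assoc _ _ _).trans ?_
    rw [hw, ← awayι_projReesToSpec Nat.one_pos (degOne_mem c), Category.assoc]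
    rfl

end Uniqueness

/-- If `C` is a module over the functions of `Y`, then each chart of `Proj (⨁ₙ C(U)ⁿ)` is a scheme
over `Y`. -/
noncomputable def chartTo {U : X.Opens} (hU : IsAffineOpen U) (c : C.sections U) :
    Spec (.of (Away (reesGrade (C.sections U)) (degOne c))) ⟶ Y :=
  Spec.map (CommRingCat.ofHom (chartHom (functionHom hθ U) (hM U) c)) ≫ (hU.preimage f).fromSpec

theorem chartTo_comp {U : X.Opens} (hU : IsAffineOpen U) (c : C.sections U) :
    chartTo hθ hM hU c ≫ f = Spec.map (CommRingCat.ofHom (toAway (degOne c))) ≫ hU.fromSpec := by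
  rw [chartTo, Category.assoc, ← hU.SpecMap_appLE_fromSpec f (hU.preimage f) le_rfl,
    ← Scheme.Hom.app_eq_appLE, ← chartHom_comp _ (hM U) (f.app U).hom (functionHom_comp hθ U),
    ← Category.assoc, ← Spec.map_comp]
  rfl

variable [IsLocallyNoetherian X] [IsLocallyNoetherian Y]

/-- The morphisms from the charts to `Y` agree on the intersections of the charts, by uniqueness. -/
theorem pullback_fst_chartTo {U : X.Opens} (hU : IsAffineOpen U) (c c' : C.sections U) :
    pullback.fst (Proj.awayι (reesGrade (C.sections U)) (degOne c) (degOne_mem c) Nat.one_pos)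
        (Proj.awayι _ (degOne c') (degOne_mem c') Nat.one_pos) ≫ chartTo hθ hM hU c =
      pullback.snd _ _ ≫ chartTo hθ hM hU c' := by
  rw [← cancel_epi (Proj.pullbackAwayιIso (reesGrade (C.sections U)) (degOne_mem c) Nat.one_pos
    (degOne_mem c') Nat.one_pos rfl).inv, Proj.pullbackAwayιIso_inv_fst_assoc,
    Proj.pullbackAwayιIso_inv_snd_assoc]
  refine spec_away_hom_ext hθ hU (SetLike.mul_mem_graded (degOne_mem c) (degOne_mem c')) ?_ ?_
  · rw [Category.assoc, chartTo_comp, ← awayι_projReesToSpec Nat.one_pos (degOne_mem c),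
      ← awayι_projReesToSpec (Nat.one_pos.trans_le (Nat.le_add_right 1 1)), Category.assoc,
      Category.assoc, Proj.SpecMap_awayMap_awayι_assoc]
  · rw [Category.assoc, chartTo_comp, ← awayι_projReesToSpec Nat.one_pos (degOne_mem c'),
      ← awayι_projReesToSpec (Nat.one_pos.trans_le (Nat.le_add_right 1 1)), Category.assoc,
      Category.assoc, Proj.SpecMap_awayMap_awayι_assoc]

/-- The morphism from `Proj (⨁ₙ C(U)ⁿ)` to `Y`. -/
noncomputable def projReesTo {U : X.Opens} (hU : IsAffineOpen U) : projRees C U ⟶ Y :=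
  (projReesCover C U).openCover.glueMorphisms (chartTo hθ hM hU) (pullback_fst_chartTo hθ hM hU)

theorem awayι_projReesTo {U : X.Opens} (hU : IsAffineOpen U) (c : C.sections U) :
    Proj.awayι _ (degOne c) (degOne_mem c) Nat.one_pos ≫ projReesTo hθ hM hU = chartTo hθ hM hU c :=
  (projReesCover C U).openCover.ι_glueMorphisms _ _ c

theorem projReesTo_comp {U : X.Opens} (hU : IsAffineOpen U) :
    projReesTo hθ hM hU ≫ f = projReesToSpec C U ≫ hU.fromSpec := by
  refine (projReesCover C U).openCover.hom_ext _ _ fun c ↦ ?_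
  refine ((Category.assoc _ _ _).symm.trans (congr_arg (· ≫ f) (awayι_projReesTo hθ hM hU c))).trans
    ((chartTo_comp hθ hM hU c).trans ?_)
  rw [← awayι_projReesToSpec Nat.one_pos (degOne_mem c), Category.assoc]
  rfl

variable (hC : C.IsCoherent)

/-- If `C` is a module over the functions of `Y`, then the blow up of `C` is a scheme over `Y`. -/
noncomputable def blowUpTo : blowUp hC ⟶ Y :=
  colimit.desc (blowUpGluingData hC).functor
    { pt := Y
      ι :=
        { app := fun U : X.AffineZariskiSite ↦ projReesTo hθ hM U.2
          naturality := fun (U V : X.AffineZariskiSite) i ↦ by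
            refine (projRees_hom_ext hθ U.2 ?_ (projReesTo_comp hθ hM U.2)).trans
              (Category.comp_id _).symm
            change (projReesMap hC i.le ≫ _) ≫ f = _
            rw [Category.assoc, projReesTo_comp, ← projReesι_blowUpMap hC,
              ← projReesι_blowUpMap hC, ← Category.assoc, projReesMap_projReesι] } }

theorem projReesι_blowUpTo (U : X.AffineZariskiSite) :
    projReesι hC U ≫ blowUpTo hθ hM hC = projReesTo hθ hM U.2 :=
  colimit.ι_desc _ _

theorem blowUpTo_comp : blowUpTo hθ hM hC ≫ f = blowUpMap hC := by
  refine colimit.hom_ext fun (U : X.AffineZariskiSite) ↦ ?_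
  change projReesι hC U ≫ _ = projReesι hC U ≫ _
  rw [← Category.assoc, projReesι_blowUpTo, projReesTo_comp, projReesι_blowUpMap]

theorem blowUpChart_blowUpTo (U : X.AffineZariskiSite) (c : C.sections U.1) :
    blowUpChart hC U c ≫ blowUpTo hθ hM hC = chartTo hθ hM U.2 c := by
  rw [blowUpChart, Category.assoc, projReesι_blowUpTo, awayι_projReesTo]

include hM in
/-- If `Y` is the blow up of `C`, then `C` is locally on `Y` generated by a regular section. -/
theorem exists_isGeneratorAway_of_iso (e : Y ≅ blowUp hC) (he : e.hom ≫ blowUpMap hC = f)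
    (U : X.AffineZariskiSite) {y : Y} (hy : f y ∈ U.1) :
    ∃ (g : Γ(Y, f ⁻¹ᵁ U.1)) (c : RatFun X U.1), y ∈ Y.basicOpen g ∧
      IsGeneratorAway (C.sections U.1) (functionHom hθ U.1) g c := by
  have hW := U.2.preimage f
  obtain ⟨c, w, hw⟩ := exists_blowUpChart_eq hC (U := U) (z := e.hom y) (by
    rwa [← Scheme.Hom.comp_apply, he])
  -- by uniqueness, the isomorphism is given by `chartHom` on the chart of `c`
  have hj : blowUpChart hC U c ≫ e.inv = chartTo hθ hM U.2 c := by
    refine spec_away_hom_ext hθ U.2 (degOne_mem c) ?_ (chartTo_comp hθ hM U.2 c)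
    rw [← he, Category.assoc, e.inv_hom_id_assoc, blowUpChart_blowUpMap]
  set q := Spec.map (CommRingCat.ofHom (chartHom (functionHom hθ U.1) (hM U.1) c)) with hq
  have hjq : blowUpChart hC U c ≫ e.inv = q ≫ hW.fromSpec := hj
  have hqo : IsOpenImmersion q := by
    have : IsOpenImmersion (q ≫ hW.fromSpec) := by
      rw [← hjq]
      infer_instance
    exact IsOpenImmersion.of_comp q hW.fromSpec
  have hyw : hW.fromSpec (q w) = y := by
    rw [← Scheme.Hom.comp_apply, ← hjq, Scheme.Hom.comp_apply, hw, ← Scheme.Hom.comp_apply,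
      e.hom_inv_id]
    rfl
  obtain ⟨_, ⟨_, ⟨g, rfl⟩, rfl⟩, hwg, hg⟩ :=
    PrimeSpectrum.isBasis_basic_opens.exists_subset_of_mem_open
      (show q w ∈ q.opensRange from ⟨w, rfl⟩) q.opensRange.2
  obtain ⟨inj, surj⟩ := exists_pow_of_basicOpen_le_opensRange _ g hg
  refine ⟨g, c, ?_, .of_chartHom (hM U.1) g c (fun k ↦ ?_) inj surj⟩
  · rw [← hyw]
    change q w ∈ hW.fromSpec ⁻¹ᵁ Y.basicOpen g
    rwa [hW.fromSpec_preimage_basicOpen]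
  · obtain ⟨b, hb, a, hba⟩ := exists_smul_eq_algebraMap U.2 k
    refine ⟨_, f.app U.1 a, isUnit_algebraMap_ratFun U.2 hb, ?_⟩
    rw [← Algebra.smul_def, hba, ← functionHom_comp hθ]
    rfl

/-- If `C` is locally on `Y` generated by a regular section, then `Y` is the blow up of `C`. -/
theorem isIso_blowUpTo
    (h : ∀ y : Y, ∃ (U : X.AffineZariskiSite) (g : Γ(Y, f ⁻¹ᵁ U.1)) (c : RatFun X U.1),
      y ∈ Y.basicOpen g ∧ IsGeneratorAway (C.sections U.1) (functionHom hθ U.1) g c) :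
    IsIso (blowUpTo hθ hM hC) := by
  -- near each point, a chart of the blow up is the inverse image of an open set of `Y` which it
  -- is mapped to isomorphically
  have key (y : Y) : ∃ (U : X.AffineZariskiSite) (d : C.sections U.1),
      ∃ _ : IsOpenImmersion (chartTo hθ hM U.2 d), y ∈ (chartTo hθ hM U.2 d).opensRange ∧
        blowUpTo hθ hM hC ⁻¹ᵁ (chartTo hθ hM U.2 d).opensRange =
          (blowUpChart hC U d).opensRange := by
    obtain ⟨U, g, c, hy, hgc⟩ := h y
    have hW := U.2.preimage f
    let d : C.sections U.1 := ⟨functionHom hθ U.1 g * c, hM U.1 g c hgc.mem⟩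
    let := (chartHom (functionHom hθ U.1) (hM U.1) d).toAlgebra
    have hloc : IsLocalization.Away g (Away (reesGrade (C.sections U.1)) (degOne d)) :=
      hgc.isLocalization_chartHom (hM U.1) (functionHom_injective hθ U.1) _
        (functionHom_comp hθ U.1)
    have hq : IsOpenImmersion (Spec.map (CommRingCat.ofHom
        (chartHom (functionHom hθ U.1) (hM U.1) d))) := IsOpenImmersion.of_isLocalization g
    have hd : IsOpenImmersion (chartTo hθ hM U.2 d) := IsOpenImmersion.comp _ hW.fromSpec
    have hr : (chartTo hθ hM U.2 d).opensRange = Y.basicOpen g := by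
      rw [← hW.fromSpec_image_basicOpen]
      refine (Scheme.Hom.opensRange_comp _ _).trans (congr_arg (hW.fromSpec ''ᵁ ·) ?_)
      ext1
      exact PrimeSpectrum.localization_away_comap_range _ g
    refine ⟨U, d, hd, hr.symm ▸ hy, le_antisymm (fun z hz ↦ ?_) ?_⟩
    · replace hz : blowUpTo hθ hM hC z ∈ (chartTo hθ hM U.2 d).opensRange := hz
      have hzU : blowUpMap hC z ∈ U.1 := by
        rw [← blowUpTo_comp hθ hM hC, Scheme.Hom.comp_apply]
        exact Y.basicOpen_le g (hr ▸ hz)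
      -- if `z` lies in the chart of `c'`, then it also lies in the chart of `d`
      obtain ⟨c', w, rfl⟩ := exists_blowUpChart_eq hC hzU
      have hw : w ∈ PrimeSpectrum.basicOpen (chartHom (functionHom hθ U.1) (hM U.1) c' g) := by
        rw [hr, ← Scheme.Hom.comp_apply, blowUpChart_blowUpTo] at hz
        have : Spec.map (CommRingCat.ofHom (chartHom (functionHom hθ U.1) (hM U.1) c')) w ∈
          hW.fromSpec ⁻¹ᵁ Y.basicOpen g := hz
        rwa [hW.fromSpec_preimage_basicOpen] at this
      have hw' := hgc.basicOpen_chartHom_le (hM U.1) c' hw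
      rw [← Proj.awayι_preimage_basicOpen _ (degOne_mem c') Nat.one_pos (degOne_mem d) Nat.one_pos]
        at hw'
      have hw'' : Proj.awayι _ (degOne c') (degOne_mem c') Nat.one_pos w ∈
          (Proj.awayι _ (degOne d) (degOne_mem d) Nat.one_pos).opensRange := by
        rwa [Proj.opensRange_awayι]
      obtain ⟨v, hv⟩ := hw''
      refine ⟨v, ?_⟩
      rw [blowUpChart, blowUpChart, Scheme.Hom.comp_apply, hv, ← Scheme.Hom.comp_apply]
    · rintro _ ⟨w, rfl⟩
      change blowUpTo hθ hM hC (blowUpChart hC U d w) ∈ (chartTo hθ hM U.2 d).opensRange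
      rw [← Scheme.Hom.comp_apply, blowUpChart_blowUpTo]
      exact ⟨w, rfl⟩
  choose U d hd hyd hr using key
  have (y : Y) := hd y
  let 𝒰 : Y.AffineOpenCover :=
    { I₀ := Y
      X := fun y ↦ .of (Away (reesGrade (C.sections (U y).1)) (degOne (d y)))
      f := fun y ↦ chartTo hθ hM (U y).2 (d y)
      idx := id
      covers := hyd }
  refine (IsZariskiLocalAtTarget.iff_of_openCover (P := MorphismProperty.isomorphisms Scheme)
    𝒰.openCover).mpr fun (y : Y) ↦ ?_
  have hp : IsPullback (𝟙 _) (blowUpChart hC (U y) (d y)) (chartTo hθ hM (U y).2 (d y))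
      (blowUpTo hθ hM hC) :=
    IsOpenImmersion.isPullback _ _ _ _ (by rw [blowUpChart_blowUpTo, Category.id_comp]) (hr y)
  change IsIso (pullback.snd (blowUpTo hθ hM hC) (chartTo hθ hM (U y).2 (d y)))
  rw [← hp.flip.isoPullback_inv_snd]
  infer_instance

end BlowUpMorphisms

end ConductorBlowUp

theorem mainTheorem3 {X Y : Scheme.{u}} [IsLocallyNoetherian X] [IsLocallyNoetherian Y]
    (f : Y ⟶ X) [IsFinite f] (θ : RatComorphism f) (hθ : θ.IsIso)
    (J : FracIdeal Y) (I : FracIdeal X) :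
    ∃ (C : FracIdeal X) (C' : FracIdeal Y),
      (IsConductor θ J.toRatSubmodule I.toRatSubmodule C.toRatSubmodule ∧
        ∀ D : FracIdeal X,
          IsConductor θ J.toRatSubmodule I.toRatSubmodule D.toRatSubmodule → D = C) ∧
      (θ.pushforward C'.toRatSubmodule = C.toRatSubmodule ∧
        ∀ D : FracIdeal Y, θ.pushforward D.toRatSubmodule = C.toRatSubmodule → D = C') ∧
      ((∃ e : Y ≅ blowUp C.isCoherent, e.hom ≫ blowUpMap C.isCoherent = f) ↔
        C'.toRatSubmodule.IsInvertible) := by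
  obtain ⟨C, hC, hC_unique, hM⟩ := RatSubmodule.exists_isConductor hθ J I
  obtain ⟨C', hC', hC'_unique⟩ := RatSubmodule.exists_pushforward_eq hθ C hM
  refine ⟨C, C', ⟨hC, fun D hD ↦ RatSubmodule.fracIdeal_ext (hC_unique _ hD)⟩, ⟨hC', hC'_unique⟩,
    fun ⟨e, he⟩ ↦ ?_, fun h ↦ ?_⟩
  · refine RatSubmodule.isInvertible_of_isGeneratorAway hθ C'.isCoherent fun y ↦ ?_
    obtain ⟨U, hU, -, hy⟩ := exists_affine_le (⊤ : X.Opens) (x := f y) trivial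
    obtain ⟨g, c, hyg, hgc⟩ := exists_isGeneratorAway_of_iso hθ hM C.isCoherent e he ⟨U, hU⟩ hy
    exact ⟨U, g, c, hU, hyg, hC' ▸ hgc⟩
  · have : CategoryTheory.IsIso (blowUpTo hθ hM C.isCoherent) := by
      refine isIso_blowUpTo hθ hM C.isCoherent fun y ↦ ?_
      obtain ⟨U, hU, -, hy⟩ := exists_affine_le (⊤ : X.Opens) (x := f y) trivial
      obtain ⟨g, c, hyg, hgc⟩ := h.exists_isGeneratorAway hθ C'.isCoherent hU hy
      exact ⟨⟨U, hU⟩, g, c, hyg, hC' ▸ hgc⟩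
    refine ⟨(asIso (blowUpTo hθ hM C.isCoherent)).symm, ?_⟩
    rw [← blowUpTo_comp hθ hM C.isCoherent]
    exact IsIso.inv_hom_id_assoc _ f
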